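/- **Setting.** Let $d$ be the space dimension. Fix a smooth radial function $\chi:\mathbb R^d\to\mathbb R$, nonincreasing in $|\xi|$, supported in the ball $B(0,\tfrac43)$ and equal to $1$ in a neighbourhood of $B(0,\tfrac34)$. Let $\Delta_j=0$ for $j\le-2$, $\Delta_{-1}=\chi(D)$ and $\Delta_j=\chi(2^{-j-1}D)-\chi(2^{-j}D)$ for $j\ge0$, where $m(D)u=\mathcal F^{-1}(m\,\mathcal Fu)$. For $\sigma\in\mathbb R$, $p,r\in[1,\infty]$ and $t\in[0,\infty]$ set $$\|u\|_{B^\sigma_{p,r}}=\Bigl\|\bigl(2^{j\sigma}\|\Delta_ju\|_{L^p(\mathbb R^d)}\bigr)_{j}\Bigr\|_{\ell^r},\qquad \|u\|_{\widetilde L^1_t(B^\sigma_{p,r})}=\Bigl\|\Bigl(2^{j\sigma}\int_0^t\|\Delta_ju(\tau)\|_{L^p(\mathbb R^d)}\,d\tau\Bigr)_{j}\Bigr\|_{\ell^r},$$ these being $+\infty$ when the quantity is not finite, and with the convention $0\cdot\infty=0$. For a scalar function $\varphi$ and a vector field $F$ put $[\varphi,\Delta_j]F=\varphi\,\Delta_jF-\Delta_j(\varphi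 F)$. **Lemma 4.1.** Let $s>0$ and $(p,r)\in[1,+\infty]^2$. In both parts $t\in[0,\infty]$ is arbitrary and $\varphi,\psi:(0,t)\times\mathbb R^d\to\mathbb R$ are arbitrary measurable functions such that, for almost every $\tau\in(0,t)$, $\varphi(\tau,\cdot)$ and $\psi(\tau,\cdot)$ are Lipschitz continuous on $\mathbb R^d$ (with constants that may depend on $\tau$ in any way). 1. There is a constant $C>0$, depending only on $d,\chi,s,p,r$, such that $$\int^t_0\Bigl\|\Bigl(2^{js}\bigl\|[\varphi,\Delta_j]\nabla\psi\bigr\|_{L^p}\Bigr)_j\Bigr\|_{\ell^r}d\tau\;\le\;C\int^t_0\Bigl(\|\nabla\varphi\|_{L^\infty}\|\psi\|_{B^{s}_{p,r}}+\|\nabla\varphi\|_{B^{s-1}_{p,r}}\|\nabla\psi\|_{L^\infty}\Bigr)d\tau .$$ 2. For all $\theta,\eta\in(0,1]$ there is a constant $C>0$, depending only on $d,\chi,s,p,r,\theta,\eta$, such that for all $s_1,s_2,\sigma_1,\sigma_2\in\mathbb R$ with $$s+1=\theta s_1+(1-\theta)s_2=\eta\sigma_1+(1-\eta)\sigma_2$$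 and for every $\varepsilon>0$, $$\begin{aligned}\Bigl\|\Bigl(2^{js}\int^t_0\bigl\|\nabla\bigl([\varphi,\Delta_j]\nabla\psi\bigr)\bigr\|_{L^p}d\tau\Bigr)_j\Bigr\|_{\ell^r} \le\;&\frac{C\theta}{\varepsilon^{(1-\theta)/\theta}}\int^t_0\|\nabla\varphi\|^{1/\theta}_{L^\infty}\|\psi\|_{B^{s_1}_{p,r}}\,d\tau +\frac{C\eta}{\varepsilon^{(1-\eta)/\eta}}\int^t_0\|\nabla\psi\|^{1/\eta}_{L^\infty}\|\nabla\varphi\|_{B^{\sigma_1-1}_{p,r}}\,d\tau\\ &+(1-\theta)\,\varepsilon\,\|\psi\|_{\widetilde L^1_t(B^{s_2}_{p,r})}+(1-\eta)\,\varepsilon\,\|\nabla\varphi\|_{\widetilde L^1_t(B^{\sigma_2-1}_{p,r})}.\end{aligned}$$ -/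

import Mathlib

open MeasureTheory Filter Topology Metric
open scoped ENNReal NNReal FourierTransform ContDiff

noncomputable section

namespace LittlewoodPaley

/-- The Euclidean space `ℝ^d`. -/
abbrev Rd (d : ℕ) : Type := EuclideanSpace ℝ (Fin d)

/-- The low frequency cut-off of the Littlewood-Paley decomposition: a smooth radial function,
supported in the ball of radius `4/3`, equal to `1` in a neighbourhood of the ball of radius `3/4`
and nonincreasing in the radial variable. -/
structure IsCutoff {d : ℕ} (χ : Rd d → ℝ) : Prop where
  smooth : ContDiff ℝ ∞ χ
  radial : ∀ ξ ζ : Rd d, ‖ξ‖ = ‖ζ‖ → χ ξ = χ ζ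
  support_subset : tsupport χ ⊆ closedBall 0 (4 / 3)
  eq_one : ∀ᶠ ξ in 𝓝ˢ (ball (0 : Rd d) (3 / 4)), χ ξ = 1
  antitone : ∀ ξ ζ : Rd d, ‖ξ‖ ≤ ‖ζ‖ → χ ζ ≤ χ ξ

/-- The convolution kernel `(2π)^{-d} ∫ e^{i x·ξ} m(ξ) dξ` of the operator `m(D)`, for a real even
symbol `m` (so that the kernel is real). Mathlib's inverse Fourier transform uses the character
`e^{2πi x·ξ}`, whence the dilation by `2π`. -/
def kernel {d : ℕ} (m : Rd d → ℝ) (x : Rd d) : ℝ :=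
  (𝓕⁻ (fun ξ : Rd d => ((m ((2 * Real.pi) • ξ) : ℝ) : ℂ)) x).re

/-- The Fourier multiplier `m(D)`, acting by convolution with its kernel on functions with values
in a real normed space. If `m` is smooth and compactly supported, the kernel is a Schwartz function
and the integral converges for every measurable `u` of at most polynomial growth. -/
def multiplier {d : ℕ} {F : Type*} [NormedAddCommGroup F] [NormedSpace ℝ F]
    (m : Rd d → ℝ) (u : Rd d → F) (x : Rd d) : F :=
  ∫ y, kernel m (x - y) • u y

/-- The symbol of the dyadic block `Δ_j`: it is `0` for `j ≤ -2`, `χ(ξ)` for `j = -1`, and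
`χ(2^{-j}ξ/2) - χ(2^{-j}ξ)` for `j ≥ 0`. -/
def dyadicSymbol {d : ℕ} (χ : Rd d → ℝ) (j : ℤ) (ξ : Rd d) : ℝ :=
  if j ≤ -2 then 0
  else if j = -1 then χ ξ
  else χ ((2 : ℝ)⁻¹ • (2 : ℝ) ^ (-j) • ξ) - χ ((2 : ℝ) ^ (-j) • ξ)

/-- The dyadic block `Δ_j u`. -/
def dyadicBlock {d : ℕ} {F : Type*} [NormedAddCommGroup F] [NormedSpace ℝ F]
    (χ : Rd d → ℝ) (j : ℤ) (u : Rd d → F) : Rd d → F :=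
  multiplier (dyadicSymbol χ j) u

/-- The commutator `[φ, Δ_j] u = φ Δ_j u - Δ_j (φ u)`. -/
def commutator {d : ℕ} {F : Type*} [NormedAddCommGroup F] [NormedSpace ℝ F]
    (χ : Rd d → ℝ) (φ : Rd d → ℝ) (j : ℤ) (u : Rd d → F) (x : Rd d) : F :=
  φ x • dyadicBlock χ j u x - dyadicBlock χ j (fun y => φ y • u y) x

/-- The norm `‖(2^{js} a_j)_j‖_{ℓ^r}` of a nonnegative sequence. -/
def weightedNorm (s : ℝ) (r : ℝ≥0∞) (a : ℤ → ℝ≥0∞) : ℝ≥0∞ :=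
  eLpNorm (fun j : ℤ => (2 : ℝ≥0∞) ^ ((j : ℝ) * s) * a j) r Measure.count

/-- The Besov norm `‖u‖_{B^s_{p,r}}`, with value `∞` outside of the space. -/
def besovNorm {d : ℕ} {F : Type*} [NormedAddCommGroup F] [NormedSpace ℝ F]
    (χ : Rd d → ℝ) (s : ℝ) (p r : ℝ≥0∞) (u : Rd d → F) : ℝ≥0∞ :=
  weightedNorm s r (fun j => eLpNorm (dyadicBlock χ j u) p volume)

/-- Lebesgue measure on the time interval `(0, T)`, where `T ∈ [0, ∞]`. -/
def timeMeasure (T : ℝ≥0∞) : Measure ℝ :=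
  volume.restrict {τ : ℝ | 0 < τ ∧ ENNReal.ofReal τ < T}

/-- The Chemin-Lerner norm `‖u‖_{L̃^q_T(B^s_{p,r})} = ‖(2^{js} ‖Δ_j u‖_{L^q_T(L^p)})_j‖_{ℓ^r}`. -/
def cheminLernerNorm {d : ℕ} {F : Type*} [NormedAddCommGroup F] [NormedSpace ℝ F]
    (χ : Rd d → ℝ) (q : ℝ≥0∞) (T : ℝ≥0∞) (s : ℝ) (p r : ℝ≥0∞) (u : ℝ → Rd d → F) : ℝ≥0∞ :=
  weightedNorm s r (fun j =>
    eLpNorm (fun τ => eLpNorm (dyadicBlock χ j (u τ)) p volume) q (timeMeasure T))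

/-- A time-dependent real function on `(0, T) × ℝ^d` that is measurable and, at almost every time,
Lipschitz continuous in space, with a constant that may depend on the time in any way. -/
structure IsLipschitzField {d : ℕ} (T : ℝ≥0∞) (f : ℝ → Rd d → ℝ) : Prop where
  aestronglyMeasurable :
    AEStronglyMeasurable (Function.uncurry f) ((timeMeasure T).prod volume)
  lipschitz : ∀ᵐ τ ∂(timeMeasure T), ∃ K : ℝ≥0, LipschitzWith K (f τ)

end LittlewoodPaley

end

/-!
The proof is carried out on kernels; no paraproducts are used.

*The commutator at a fixed time.* Let `K` be the kernel of `Δ_j`, which lives at scale `2^{-j}`,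
and let `S` be the low frequency cut-off at `2^{j-2}`. The commutator `[φ, Δ_j] u` is the integral
operator with kernel `K(x - y) (φ(x) - φ(y))`. If `u = ∇g`, integrating by parts puts the derivative
on this kernel, where the factor `2^j` coming from `K` is compensated by the increment of `φ`; hence
`[φ, Δ_j] ∇g` is bounded by `‖∇φ‖_∞` times an average of `|g|` at scale `2^{-j}`, and a further
difference in `x` costs `2^j` (`KernelBound.enorm_commutator_gradient_le`,
`KernelBound.enorm_commutator_gradient_sub_le`). Integration by parts is done as an inequality on
difference quotients (`enorm_integral_smul_gradient_le`), since the functions are only Lipschitz.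

*Removal of the low frequencies.* Write `ψ = g + Sψ`. Because `Δ_j` kills `S∇ψ` as well as the
product `Sφ S∇ψ`, whose spectrum lies in a ball disjoint from that of the block, the remaining part
`[φ, Δ_j] S∇ψ` is `-Δ_j ((φ - Sφ) S∇ψ)` (`LittlewoodPaleyBound.commutator_eq_sub`). This is
controlled by `‖∇ψ‖_∞` and `φ - Sφ`. The functions `g = ψ - Sψ` and `φ - Sφ` are sums of the blocks
of index `k ≥ j - 2`, and for the second one Bernstein's inequality `‖Δ_k φ‖ ≲ 2^{-k} ‖Δ_k ∇φ‖`
brings in the gradient (`KernelBound.eLpNorm_le_gradient`). For `j ≤ 1` nothing has to be removed.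
Altogether the commutator, and `2^{-j}` times its gradient, are bounded by
`∑_{k ≥ j-2} (‖∇φ‖_∞ ‖Δ_k ψ‖_p + 2^{-k} ‖Δ_k ∇φ‖_p ‖∇ψ‖_∞)` (`exists_eLpNorm_commutator_le`).

*Summation.* As `s > 0`, the operator `a ↦ (∑_{k ≥ j-2} a_k)_j` is bounded on the sequence space with
weight `2^{js}` (`exists_weightedNorm_tsum_le`). This gives the first estimate by integration in time,
and the second one after an interpolation by Young's inequality inside the time integral and
Minkowski's inequality (`weightedNorm_lintegral_mul_le`). The second estimate exchanges sums and time
integrals, so it needs the blocks of `ψ` and `∇φ` to be measurable in time; this is deduced from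
joint measurability of the fields, and for `∇φ` from Rademacher's theorem
(`HasMeasurableSections.gradient`).
-/


/-! ### Integral inequalities in Lebesgue spaces -/

section LebesgueNorms

variable {α β : Type*} [MeasurableSpace α] [MeasurableSpace β]

/-- The `L^p` norm of the sections of a jointly measurable function is measurable. -/
theorem measurable_eLpNorm_section {f : α → β → ℝ≥0∞} (hf : Measurable (Function.uncurry f))
    (p : ℝ≥0∞) (ν : Measure β) [SFinite ν] : Measurable fun a => eLpNorm (f a) p ν := by
  rcases eq_or_ne p 0 with rfl | hp0
  · simp
  rcases eq_or_ne p ∞ with rfl | hp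
  · refine measurable_of_Iic fun c => ?_
    have h : (fun a => eLpNorm (f a) ∞ ν) ⁻¹' Set.Iic c
        = {a | ν (Prod.mk a ⁻¹' {z : α × β | c < f z.1 z.2}) = 0} := by
      ext a
      simp only [Set.mem_preimage, Set.mem_Iic, eLpNorm_exponent_top, eLpNormEssSup,
        enorm_eq_self, Set.mem_ofPred_eq, Set.preimage_ofPred_eq]
      constructor
      · intro h
        have := ENNReal.ae_le_essSup (μ := ν) (f a)
        rw [ae_iff] at this
        refine measure_mono_null (fun b hb => ?_) this
        simp only [Set.mem_ofPred_eq, not_le] at hb ⊢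
        exact lt_of_le_of_lt h hb
      · intro h
        refine essSup_le_of_ae_le _ ?_
        rw [EventuallyLE, ae_iff]
        simpa using h
    rw [h]
    exact measurable_measure_prodMk_left (measurableSet_lt measurable_const hf)
      (measurableSet_singleton 0)
  · simp only [eLpNorm_eq_lintegral_rpow_enorm_toReal hp0 hp, enorm_eq_self]
    exact (Measurable.lintegral_prod_right' (f := fun z : α × β => f z.1 z.2 ^ p.toReal)
      (hf.pow_const _)).pow_const _

theorem le_of_rpow_le_rpow_sub_one_mul {p : ℝ} (hp : 1 ≤ p) {u v : ℝ≥0∞} (hu : u ≠ ⊤)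
    (h : u ^ p ≤ u ^ (p - 1) * v) : u ≤ v := by
  rcases eq_or_ne u 0 with rfl | hu0
  · simp
  have h1 : u ^ p = u ^ (p - 1) * u := by
    conv_rhs => rw [← ENNReal.rpow_one u, ← ENNReal.rpow_mul, one_mul]
    rw [← ENNReal.rpow_add _ _ hu0 hu]; simp
  rw [h1] at h
  refine (ENNReal.mul_le_mul_iff_right ?_ ?_).1 h
  · exact (ENNReal.rpow_pos (pos_iff_ne_zero.2 hu0) hu).ne'
  · exact ENNReal.rpow_ne_top_of_nonneg (by linarith) hu

/-- **Minkowski's integral inequality**, proved by duality: `∫ G^q` is written as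
`∫∫ G^{q-1} f` and Hölder's inequality is applied for fixed `y`. Dividing by a power of `∫ G^q`
needs this integral to be finite, whence the truncation of `G`. -/
theorem eLpNorm_lintegral_le {μ : Measure α} {ν : Measure β} [SigmaFinite μ] [SFinite ν]
    {f : α → β → ℝ≥0∞} (hf : Measurable (Function.uncurry f)) {p : ℝ≥0∞} (hp : 1 ≤ p) :
    eLpNorm (fun x => ∫⁻ y, f x y ∂ν) p μ ≤ ∫⁻ y, eLpNorm (fun x => f x y) p μ ∂ν := by
  have hswap : Measurable (Function.uncurry fun y x => f x y) := hf.comp measurable_swap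
  have hN : Measurable fun y => eLpNorm (fun x => f x y) p μ :=
    measurable_eLpNorm_section hswap p μ
  rcases eq_or_ne p ∞ with rfl | hptop
  · simp only [eLpNorm_exponent_top, eLpNormEssSup, enorm_eq_self] at hN ⊢
    refine essSup_le_of_ae_le _ ?_
    have hle : ∀ y, ∀ᵐ x ∂μ, f x y ≤ (fun y => essSup (fun x => f x y) μ) y := fun y =>
      ENNReal.ae_le_essSup _
    change (fun x => ∫⁻ y, f x y ∂ν) ≤ᵐ[μ]
      fun _ => ∫⁻ y, (fun y => essSup (fun x => f x y) μ) y ∂ν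
    generalize (fun y => essSup (fun x => f x y) μ) = N at hN hle
    have hset : MeasurableSet {z : β × α | f z.2 z.1 ≤ N z.1} :=
      measurableSet_le hswap (hN.comp measurable_fst)
    have h1 : ∀ᵐ z ∂ν.prod μ, f z.2 z.1 ≤ N z.1 :=
      (Measure.ae_prod_iff_ae_ae hset).2 (Eventually.of_forall hle)
    have h2 : ∀ᵐ z ∂μ.prod ν, f z.1 z.2 ≤ N z.2 :=
      (Measure.measurePreserving_swap (μ := μ) (ν := ν)).quasiMeasurePreserving.ae h1
    filter_upwards [Measure.ae_ae_of_ae_prod h2] with x hx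
    exact lintegral_mono_ae hx
  · have hp0 : p ≠ 0 := (zero_lt_one.trans_le hp).ne'
    set q := p.toReal with hq
    have hq1 : 1 ≤ q := by
      rw [hq, ← ENNReal.toReal_one]; exact ENNReal.toReal_mono hptop hp
    have hq0 : 0 < q := by linarith
    set G : α → ℝ≥0∞ := fun x => ∫⁻ y, f x y ∂ν with hG
    have hGm : Measurable G := Measurable.lintegral_prod_right' (f := fun z : α × β => f z.1 z.2) hf
    set R := ∫⁻ y, eLpNorm (fun x => f x y) p μ ∂ν with hR
    -- the inequality for functions below `G` with finite norm
    have key : ∀ H : α → ℝ≥0∞, Measurable H → (∀ x, H x ≤ G x) →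
        (∫⁻ x, H x ^ q ∂μ) ≠ ⊤ → (∫⁻ x, H x ^ q ∂μ) ^ (1 / q) ≤ R := by
      intro H hH hle hfin
      refine le_of_rpow_le_rpow_sub_one_mul hq1
        (ENNReal.rpow_ne_top_of_nonneg (by positivity) hfin) ?_
      have e1 : ((∫⁻ x, H x ^ q ∂μ) ^ (1 / q)) ^ q = ∫⁻ x, H x ^ q ∂μ := by
        rw [← ENNReal.rpow_mul, one_div, inv_mul_cancel₀ hq0.ne', ENNReal.rpow_one]
      rw [e1]
      calc ∫⁻ x, H x ^ q ∂μ ≤ ∫⁻ x, H x ^ (q - 1) * G x ∂μ := by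
            refine lintegral_mono fun x => ?_
            have : H x ^ q = H x ^ ((q - 1) + 1) := by ring_nf
            rw [this, ENNReal.rpow_add_of_nonneg _ _ (by linarith) zero_le_one, ENNReal.rpow_one]
            gcongr
            exact hle x
        _ = ∫⁻ x, ∫⁻ y, H x ^ (q - 1) * f x y ∂ν ∂μ := by
            refine lintegral_congr fun x => ?_
            exact (lintegral_const_mul (f := fun y => f x y) _
              (hf.comp measurable_prodMk_left)).symm
        _ = ∫⁻ y, ∫⁻ x, H x ^ (q - 1) * f x y ∂μ ∂ν := by
            refine lintegral_lintegral_swap ?_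
            exact (((hH.comp measurable_fst).pow_const _).mul hf).aemeasurable
        _ ≤ ∫⁻ y, ((∫⁻ x, H x ^ q ∂μ) ^ (1 / q)) ^ (q - 1) * eLpNorm (fun x => f x y) p μ ∂ν := by
            refine lintegral_mono fun y => ?_
            have hfy : Measurable fun x => f x y := hswap.comp measurable_prodMk_left
            rw [eLpNorm_eq_lintegral_rpow_enorm_toReal hp0 hptop]
            simp only [enorm_eq_self, ← hq]
            rcases eq_or_lt_of_le hq1 with h1 | h1
            · simp [← h1]
            · have hpq : (q / (q - 1)).HolderConjugate q :=
                (Real.HolderConjugate.conjExponent h1).symm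
              refine (ENNReal.lintegral_mul_le_Lp_mul_Lq μ hpq (hH.pow_const _).aemeasurable
                hfy.aemeasurable).trans (le_of_eq ?_)
              congr 1
              rw [← ENNReal.rpow_mul]
              have h3 : q - 1 ≠ 0 := by linarith
              congr 1
              · refine lintegral_congr fun x => ?_
                rw [← ENNReal.rpow_mul]
                congr 1
                field_simp
              · field_simp
        _ = ((∫⁻ x, H x ^ q ∂μ) ^ (1 / q)) ^ (q - 1) * R := by
            rw [lintegral_const_mul _ hN]
    -- exhaustion of `G` by truncations
    set H : ℕ → α → ℝ≥0∞ := fun n => (spanningSets μ n).indicator fun x => min (G x) n with hHdef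
    have hHm : ∀ n, Measurable (H n) := fun n =>
      (hGm.min measurable_const).indicator (measurableSet_spanningSets μ n)
    have hHG : ∀ n x, H n x ≤ G x := fun n x => by
      simp only [hHdef]
      refine (Set.indicator_le_self _ _ _).trans (min_le_left _ _)
    have hfin : ∀ n, (∫⁻ x, H n x ^ q ∂μ) ≠ ⊤ := by
      intro n
      have : ∫⁻ x, H n x ^ q ∂μ
          ≤ ∫⁻ x, (spanningSets μ n).indicator (fun _ => (n : ℝ≥0∞) ^ q) x ∂μ := by
        refine lintegral_mono fun x => ?_
        by_cases hx : x ∈ spanningSets μ n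
        · simp only [hHdef, Set.indicator_of_mem hx]
          gcongr; exact min_le_right _ _
        · simp [hHdef, Set.indicator_of_notMem hx, hq0]
      refine ne_top_of_le_ne_top ?_ this
      rw [lintegral_indicator (measurableSet_spanningSets μ n), setLIntegral_const]
      exact ENNReal.mul_ne_top (ENNReal.rpow_ne_top_of_nonneg hq0.le (by simp))
        (measure_spanningSets_lt_top μ n).ne
    have hlim : Tendsto (fun n => ∫⁻ x, H n x ^ q ∂μ) atTop (𝓝 (∫⁻ x, G x ^ q ∂μ)) := by
      refine lintegral_tendsto_of_tendsto_of_monotone (fun n => ((hHm n).pow_const _).aemeasurable)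
        (Eventually.of_forall fun x => ?_) (Eventually.of_forall fun x => ?_)
      · intro n k hnk
        refine ENNReal.rpow_le_rpow ?_ hq0.le
        simp only [hHdef]
        by_cases hx : x ∈ spanningSets μ n
        · rw [Set.indicator_of_mem hx, Set.indicator_of_mem (monotone_spanningSets μ hnk hx)]
          exact min_le_min le_rfl (by exact_mod_cast hnk)
        · simp [Set.indicator_of_notMem hx]
      · refine (ENNReal.continuous_rpow_const.tendsto _).comp ?_
        have hev : ∀ᶠ n in atTop, H n x = min (G x) n := by
          filter_upwards [eventually_ge_atTop (spanningSetsIndex μ x)] with n hn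
          simp only [hHdef]
          rw [Set.indicator_of_mem (mem_spanningSets_of_index_le μ x hn)]
        refine Tendsto.congr' (EventuallyEq.symm hev) ?_
        have : Tendsto (fun n : ℕ => min (G x) (n : ℝ≥0∞)) atTop (𝓝 (min (G x) ∞)) :=
          tendsto_const_nhds.min ENNReal.tendsto_nat_nhds_top
        simpa using this
    rw [eLpNorm_eq_lintegral_rpow_enorm_toReal hp0 hptop]
    simp only [enorm_eq_self, ← hq]
    refine le_of_tendsto ((ENNReal.continuous_rpow_const.tendsto _).comp hlim)
      (Eventually.of_forall fun n => ?_)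
    exact key (H n) (hHm n) (hHG n) (hfin n)

/-- The triangle inequality for series in `L^p`. -/
theorem eLpNorm_tsum_le {μ : Measure α} [SigmaFinite μ] {ι : Type*} [Countable ι]
    {f : ι → α → ℝ≥0∞} (hf : ∀ i, Measurable (f i)) {p : ℝ≥0∞} (hp : 1 ≤ p) :
    eLpNorm (fun x => ∑' i, f i x) p μ ≤ ∑' i, eLpNorm (f i) p μ := by
  let _ : MeasurableSpace ι := ⊤
  have := eLpNorm_lintegral_le (μ := μ) (ν := (Measure.count : Measure ι))
    (f := fun x i => f i x) ?_ hp
  · simpa only [lintegral_count] using this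
  · exact measurable_from_prod_countable_left hf

/-- Multiplication by a constant; the constant and the norm may be infinite. -/
theorem eLpNorm_const_mul_ennreal {μ : Measure α} {c : ℝ≥0∞} {f : α → ℝ≥0∞} (hf : Measurable f)
    (p : ℝ≥0∞) (hp : 1 ≤ p) : eLpNorm (fun x => c * f x) p μ = c * eLpNorm f p μ := by
  have hp0 : p ≠ 0 := (zero_lt_one.trans_le hp).ne'
  rcases eq_or_ne p ∞ with rfl | hptop
  · simp only [eLpNorm_exponent_top, eLpNormEssSup, enorm_eq_self]
    exact ENNReal.essSup_const_mul
  · have hq : 0 < p.toReal := ENNReal.toReal_pos hp0 hptop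
    simp only [eLpNorm_eq_lintegral_rpow_enorm_toReal hp0 hptop, enorm_eq_self]
    simp_rw [ENNReal.mul_rpow_of_nonneg _ _ hq.le]
    rw [lintegral_const_mul _ (hf.pow_const _), ENNReal.mul_rpow_of_nonneg _ _ (by positivity),
      ← ENNReal.rpow_mul, mul_one_div_cancel hq.ne', ENNReal.rpow_one]

/-- **Young's convolution inequality** `L^1 * L^p ⊆ L^p`, for nonnegative functions. -/
theorem eLpNorm_lconvolution_le {E : Type*} [NormedAddCommGroup E] [MeasurableSpace E]
    [BorelSpace E] [SecondCountableTopology E] (μ : Measure E) [SigmaFinite μ]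
    [μ.IsAddLeftInvariant] [μ.IsNegInvariant]
    {w f : E → ℝ≥0∞} (hw : Measurable w) (hf : Measurable f) {p : ℝ≥0∞} (hp : 1 ≤ p) :
    eLpNorm (fun x => ∫⁻ y, w (x - y) * f y ∂μ) p μ ≤ (∫⁻ z, w z ∂μ) * eLpNorm f p μ := by
  have h1 : ∀ x, ∫⁻ y, w (x - y) * f y ∂μ = ∫⁻ z, w z * f (x - z) ∂μ := by
    intro x
    rw [← lintegral_sub_left_eq_self (μ := μ) (fun z => w z * f (x - z)) x]
    simp
  simp_rw [h1]
  refine (eLpNorm_lintegral_le (f := fun x z => w z * f (x - z)) ?_ hp).trans ?_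
  · exact (hw.comp measurable_snd).mul (hf.comp (measurable_fst.sub measurable_snd))
  · rw [← lintegral_mul_const _ hw]
    refine lintegral_mono fun z => ?_
    rw [eLpNorm_const_mul_ennreal (f := fun x => f (x - z))
      (hf.comp (measurable_id.sub_const z)) p hp]
    gcongr
    refine le_of_eq ?_
    exact eLpNorm_comp_measurePreserving (g := f) hf.aestronglyMeasurable
      (measurePreserving_sub_right μ z)

end LebesgueNorms

/-! ### Convolution kernels of smooth symbols -/

namespace LittlewoodPaley

/-- The symbols of interest: smooth, compactly supported, even. -/
structure IsSymbol {d : ℕ} (m : Rd d → ℝ) : Prop where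
  contDiff : ContDiff ℝ ∞ m
  hasCompactSupport : HasCompactSupport m
  even : ∀ ξ, m (-ξ) = m ξ

variable {d : ℕ} {m m₁ m₂ m₃ : Rd d → ℝ}

theorem IsSymbol.comp_smul (hm : IsSymbol m) {c : ℝ} (hc : c ≠ 0) :
    IsSymbol fun ξ => m (c • ξ) where
  contDiff := hm.contDiff.comp (contDiff_const_smul c)
  hasCompactSupport := hm.hasCompactSupport.comp_homeomorph (Homeomorph.smulOfNeZero c hc)
  even ξ := by rw [smul_neg, hm.even]

theorem IsSymbol.sub (h₁ : IsSymbol m₁) (h₂ : IsSymbol m₂) : IsSymbol fun ξ => m₁ ξ - m₂ ξ where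
  contDiff := h₁.contDiff.sub h₂.contDiff
  hasCompactSupport := h₁.hasCompactSupport.sub h₂.hasCompactSupport
  even ξ := by rw [h₁.even, h₂.even]

/-- The symbol, dilated by `2π`, as a complex Schwartz function. -/
noncomputable def IsSymbol.toSchwartz (hm : IsSymbol m) : SchwartzMap (Rd d) ℂ :=
  HasCompactSupport.toSchwartzMap (f := fun ξ : Rd d => ((m ((2 * Real.pi) • ξ) : ℝ) : ℂ))
    ((hm.comp_smul (c := 2 * Real.pi) (by positivity)).hasCompactSupport.comp_left
      (g := Complex.ofReal) Complex.ofReal_zero)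
    (Complex.ofRealCLM.contDiff.comp
      (hm.comp_smul (c := 2 * Real.pi) (by positivity)).contDiff)

theorem IsSymbol.toSchwartz_apply (hm : IsSymbol m) (ξ : Rd d) :
    hm.toSchwartz ξ = ((m ((2 * Real.pi) • ξ) : ℝ) : ℂ) := rfl

theorem IsSymbol.coe_toSchwartz (hm : IsSymbol m) :
    (hm.toSchwartz : Rd d → ℂ) = fun ξ => ((m ((2 * Real.pi) • ξ) : ℝ) : ℂ) := rfl

/-- Since the symbol is even, its inverse Fourier transform is real. -/
theorem IsSymbol.ofReal_kernel (hm : IsSymbol m) (x : Rd d) :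
    ((kernel m x : ℝ) : ℂ) = 𝓕⁻ (hm.toSchwartz : Rd d → ℂ) x := by
  rw [hm.coe_toSchwartz]
  unfold kernel
  rw [← Complex.conj_eq_iff_re, Real.fourierInv_eq', ← integral_conj,
    ← integral_neg_eq_self]
  refine integral_congr_ae (Eventually.of_forall fun ξ => ?_)
  simp only [smul_eq_mul, map_mul, ← Complex.exp_conj, Complex.conj_ofReal, Complex.conj_I,
    smul_neg, hm.even, inner_neg_left]
  congr 2
  push_cast
  ring

theorem IsSymbol.kernel_eq_fourier (hm : IsSymbol m) (x : Rd d) :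
    ((kernel m x : ℝ) : ℂ) = 𝓕 (hm.toSchwartz : Rd d → ℂ) x := by
  rw [hm.ofReal_kernel, Real.fourierInv_eq_fourier_neg, Real.fourier_eq', Real.fourier_eq',
    ← integral_neg_eq_self]
  refine integral_congr_ae (Eventually.of_forall fun ξ => ?_)
  simp only [hm.toSchwartz_apply, smul_neg, hm.even, inner_neg_left, inner_neg_right, neg_neg]

theorem IsSymbol.kernel_neg (hm : IsSymbol m) (x : Rd d) : kernel m (-x) = kernel m x := by
  have : ((kernel m (-x) : ℝ) : ℂ) = (kernel m x : ℝ) := by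
    rw [hm.ofReal_kernel, hm.kernel_eq_fourier, Real.fourierInv_eq_fourier_neg, neg_neg]
  exact_mod_cast this

theorem IsSymbol.kernel_sub_comm (hm : IsSymbol m) (x y : Rd d) :
    kernel m (x - y) = kernel m (y - x) := by rw [← hm.kernel_neg, neg_sub]

/-- The kernel as a Schwartz function. -/
noncomputable def IsSymbol.kernelSchwartz (hm : IsSymbol m) : SchwartzMap (Rd d) ℝ :=
  SchwartzMap.postcompCLM (𝕜 := ℝ) Complex.reCLM (𝓕⁻ hm.toSchwartz)

theorem IsSymbol.kernelSchwartz_apply (hm : IsSymbol m) (x : Rd d) :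
    hm.kernelSchwartz x = kernel m x := by
  rw [kernelSchwartz, SchwartzMap.postcompCLM_apply, SchwartzMap.fourierInv_coe]
  rfl

theorem IsSymbol.continuous_kernel (hm : IsSymbol m) : Continuous (kernel m) := by
  have : kernel m = hm.kernelSchwartz := funext fun x => (hm.kernelSchwartz_apply x).symm
  rw [this]
  exact hm.kernelSchwartz.continuous

theorem kernel_sub (h₁ : IsSymbol m₁) (h₂ : IsSymbol m₂) (x : Rd d) :
    kernel (fun ξ => m₁ ξ - m₂ ξ) x = kernel m₁ x - kernel m₂ x := by
  have h : (h₁.sub h₂).toSchwartz = h₁.toSchwartz - h₂.toSchwartz := by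
    ext ξ
    simp [IsSymbol.toSchwartz_apply]
  have : ((kernel (fun ξ => m₁ ξ - m₂ ξ) x : ℝ) : ℂ) = kernel m₁ x - kernel m₂ x := by
    rw [(h₁.sub h₂).ofReal_kernel, h₁.ofReal_kernel, h₂.ofReal_kernel, h,
      ← SchwartzMap.fourierInv_coe, ← SchwartzMap.fourierInv_coe, ← SchwartzMap.fourierInv_coe,
      sub_eq_add_neg, FourierTransform.fourierInv_add,
      FourierTransform.fourierInv_neg]
    simp [sub_eq_add_neg]
  exact_mod_cast this

theorem kernel_zero (x : Rd d) : kernel (fun _ => (0 : ℝ)) x = 0 := by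
  simp [kernel, Real.fourierInv_eq']

/-- Dilating the symbol dilates the kernel. -/
theorem kernel_comp_inv_smul (m : Rd d → ℝ) {c : ℝ} (hc : 0 < c) (x : Rd d) :
    kernel (fun ξ => m (c⁻¹ • ξ)) x = c ^ d * kernel m (c • x) := by
  unfold kernel
  rw [Real.fourierInv_eq', Real.fourierInv_eq', ← Complex.re_ofReal_mul]
  congr 1
  have := Measure.integral_comp_inv_smul_of_nonneg (volume : Measure (Rd d))
    (fun ξ : Rd d => Complex.exp (((2 * Real.pi * inner ℝ ξ (c • x) : ℝ) : ℂ) * Complex.I)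
      • ((m ((2 * Real.pi) • ξ) : ℝ) : ℂ)) hc.le
  rw [finrank_euclideanSpace_fin, Complex.real_smul] at this
  rw [← this]
  refine integral_congr_ae (Eventually.of_forall fun ξ => ?_)
  have h1 : inner ℝ (c⁻¹ • ξ) (c • x) = inner ℝ ξ x := by
    rw [real_inner_smul_left, real_inner_smul_right, ← mul_assoc, inv_mul_cancel₀ hc.ne', one_mul]
  simp only [h1, smul_comm c⁻¹ (2 * Real.pi) ξ]

theorem IsSymbol.integral_kernel (hm : IsSymbol m) : ∫ x, kernel m x = m 0 := by
  have h : ((∫ x, kernel m x : ℝ) : ℂ) = m 0 := by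
    rw [← integral_complex_ofReal]
    simp_rw [hm.ofReal_kernel, ← SchwartzMap.fourierInv_coe]
    have := congrArg (fun f : SchwartzMap (Rd d) ℂ => f 0)
      (FourierTransform.fourier_fourierInv_eq (F := SchwartzMap (Rd d) ℂ) hm.toSchwartz)
    simp only [SchwartzMap.fourier_coe, Real.fourier_eq', inner_zero_right, mul_zero,
      Complex.ofReal_zero, zero_mul, Complex.exp_zero, one_smul] at this
    rw [this, hm.toSchwartz_apply, smul_zero]
  exact_mod_cast h

/-! ### Orthogonality of kernels with disjoint spectra -/

theorem integral_fourier_mul_fourier_eq_zero {a c : Rd d → ℂ} (ha : Integrable a)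
    (hc : Integrable c) (hcont : Continuous c) (hFc : Integrable (𝓕 c))
    (h : ∀ ξ, a ξ * c (-ξ) = 0) : ∫ y, 𝓕 a y * 𝓕 c y = 0 := by
  have h1 : ∫ y, 𝓕 a y * 𝓕 c y = ∫ ξ, a ξ * 𝓕 (𝓕 c) ξ :=
    VectorFourier.integral_fourierIntegral_smul_eq_flip (L := innerₗ (Rd d))
      Real.continuous_fourierChar continuous_inner ha hFc |>.trans (by
        simp only [flip_innerₗ, smul_eq_mul]; rfl)
  rw [h1]
  have h2 : ∀ ξ, 𝓕 (𝓕 c) ξ = c (-ξ) := by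
    intro ξ
    have := congrFun (hcont.fourierInv_fourier_eq hc hFc) (-ξ)
    rw [Real.fourierInv_eq_fourier_neg, neg_neg] at this
    exact this
  simp [h2, h]

/-- The modulated symbol whose Fourier transform is the translated kernel. -/
noncomputable def IsSymbol.modulated (hm : IsSymbol m) (x : Rd d) (ξ : Rd d) : ℂ :=
  Real.fourierChar (inner ℝ ξ x) • hm.toSchwartz ξ

theorem IsSymbol.continuous_modulated (hm : IsSymbol m) (x : Rd d) :
    Continuous (hm.modulated x) := by
  unfold IsSymbol.modulated
  exact (Real.continuous_fourierChar.comp (by fun_prop)).smul hm.toSchwartz.continuous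

theorem IsSymbol.hasCompactSupport_modulated (hm : IsSymbol m) (x : Rd d) :
    HasCompactSupport (hm.modulated x) := by
  have : HasCompactSupport (hm.toSchwartz : Rd d → ℂ) :=
    ((hm.comp_smul (c := 2 * Real.pi) (by positivity)).hasCompactSupport.comp_left
      (g := Complex.ofReal) Complex.ofReal_zero)
  refine this.mono fun ξ hξ => ?_
  contrapose! hξ
  simp only [Function.mem_support, ne_eq, not_not] at hξ ⊢
  simp [IsSymbol.modulated, hξ]

theorem IsSymbol.integrable_modulated (hm : IsSymbol m) (x : Rd d) :
    Integrable (hm.modulated x) :=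
  (hm.continuous_modulated x).integrable_of_hasCompactSupport (hm.hasCompactSupport_modulated x)

theorem IsSymbol.fourier_modulated (hm : IsSymbol m) (x y : Rd d) :
    𝓕 (hm.modulated x) y = (kernel m (x - y) : ℝ) := by
  rw [hm.ofReal_kernel, Real.fourier_eq, Real.fourierInv_eq]
  refine integral_congr_ae (Eventually.of_forall fun ξ => ?_)
  simp only [IsSymbol.modulated]
  rw [← mul_smul, ← AddChar.map_add_eq_mul, inner_sub_right]
  congr 2
  ring

theorem IsSymbol.modulated_eq_zero (hm : IsSymbol m) {x ξ : Rd d}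
    (h : m ((2 * Real.pi) • ξ) = 0) : hm.modulated x ξ = 0 := by
  simp [IsSymbol.modulated, hm.toSchwartz_apply, h]

theorem IsSymbol.integrable_fourier_modulated (hm : IsSymbol m) (x : Rd d) :
    Integrable (𝓕 (hm.modulated x)) := by
  have h : 𝓕 (hm.modulated x) = fun y => ((hm.kernelSchwartz (x - y) : ℝ) : ℂ) := by
    ext y
    rw [hm.fourier_modulated, hm.kernelSchwartz_apply]
  rw [h]
  exact (hm.kernelSchwartz.integrable.comp_sub_left x).ofReal

theorem integral_kernel_mul_kernel_eq_zero (h₁ : IsSymbol m₁) (h₂ : IsSymbol m₂)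
    (h : ∀ ξ, m₁ ξ * m₂ ξ = 0) (x w : Rd d) :
    ∫ y, kernel m₁ (x - y) * kernel m₂ (y - w) = 0 := by
  have : ((∫ y, kernel m₁ (x - y) * kernel m₂ (y - w) : ℝ) : ℂ) = 0 := by
    rw [← integral_complex_ofReal, ← integral_fourier_mul_fourier_eq_zero
      (h₁.integrable_modulated x) (h₂.integrable_modulated w) (h₂.continuous_modulated w)
      (h₂.integrable_fourier_modulated w)]
    · refine integral_congr_ae (Eventually.of_forall fun y => ?_)
      simp only [h₁.fourier_modulated, h₂.fourier_modulated, h₂.kernel_sub_comm w y,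
        Complex.ofReal_mul]
    · intro ξ
      rcases mul_eq_zero.1 (h ((2 * Real.pi) • ξ)) with h0 | h0
      · rw [h₁.modulated_eq_zero h0, zero_mul]
      · rw [h₂.modulated_eq_zero (by rw [smul_neg, h₂.even, h0]), mul_zero]
  exact_mod_cast this

/-- The spectrum of a product lies in the sum of the spectra. -/
theorem integral_kernel_mul_kernel_mul_kernel_eq_zero (h₁ : IsSymbol m₁) (h₂ : IsSymbol m₂)
    (h₃ : IsSymbol m₃) (h : ∀ ξ η, m₁ (ξ + η) * (m₂ ξ * m₃ η) = 0) (x w z : Rd d) :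
    ∫ y, kernel m₁ (x - y) * (kernel m₂ (y - w) * kernel m₃ (y - z)) = 0 := by
  have h2i := h₂.integrable_modulated w
  have h3i := h₃.integrable_modulated z
  have hF : 𝓕 (convolution (h₂.modulated w) (h₃.modulated z) (.mul ℂ ℂ) volume)
      = fun y => 𝓕 (h₂.modulated w) y * 𝓕 (h₃.modulated z) y := by
    ext y
    exact Real.fourier_mul_convolution_eq h2i h3i y
  have : ((∫ y, kernel m₁ (x - y) * (kernel m₂ (y - w) * kernel m₃ (y - z)) : ℝ) : ℂ) = 0 := by
    rw [← integral_complex_ofReal, ← integral_fourier_mul_fourier_eq_zero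
      (h₁.integrable_modulated x) (h2i.integrable_convolution (.mul ℂ ℂ) h3i)
      ((h₃.hasCompactSupport_modulated z).continuous_convolution_right _ h2i.locallyIntegrable
        (h₃.continuous_modulated z))]
    · refine integral_congr_ae (Eventually.of_forall fun y => ?_)
      simp only [hF, h₁.fourier_modulated, h₂.fourier_modulated, h₃.fourier_modulated,
        h₂.kernel_sub_comm w y, h₃.kernel_sub_comm z y, Complex.ofReal_mul]
    · rw [hF]
      have hb : ∃ C, ∀ y, ‖𝓕 (h₂.modulated w) y‖ ≤ C :=
        ⟨_, fun y => VectorFourier.norm_fourierIntegral_le_integral_norm _ _ _ _ _⟩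
      obtain ⟨C, hC⟩ := hb
      refine (h₃.integrable_fourier_modulated z).bdd_mul (c := C)
        (h₂.integrable_fourier_modulated w).aestronglyMeasurable (Eventually.of_forall hC)
    · intro ξ
      by_cases h0 : m₁ ((2 * Real.pi) • ξ) = 0
      · rw [h₁.modulated_eq_zero h0, zero_mul]
      · rw [convolution_def, integral_eq_zero_of_ae, mul_zero]
        refine Eventually.of_forall fun η => ?_
        have := h ((2 * Real.pi) • η) ((2 * Real.pi) • (-ξ - η))
        rw [← smul_add, add_sub_cancel, smul_neg, h₁.even] at this
        rcases mul_eq_zero.1 ((mul_eq_zero.1 this).resolve_left h0) with h0 | h0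
        · simp [h₂.modulated_eq_zero h0]
        · simp [h₃.modulated_eq_zero h0]
  exact_mod_cast this

end LittlewoodPaley

/-! ### Rapidly decaying kernels at a given scale -/

namespace LittlewoodPaley

variable {d : ℕ}

/-- The weight `l^d (1 + l|z|)^{-N}`, concentrated in the ball of radius `1/l`. -/
noncomputable def decayWeight (l : ℝ) (N : ℕ) (z : Rd d) : ℝ :=
  l ^ d / (1 + l * ‖z‖) ^ N

theorem decayWeight_nonneg {l : ℝ} (hl : 0 < l) (N : ℕ) (z : Rd d) : 0 ≤ decayWeight l N z := by
  unfold decayWeight; positivity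

theorem continuous_decayWeight {l : ℝ} (hl : 0 < l) (N : ℕ) :
    Continuous (decayWeight l N : Rd d → ℝ) := by
  unfold decayWeight
  refine continuous_const.div (by fun_prop) fun z => ?_
  positivity

/-- One power of decay absorbs a factor `1 + l|z|`. -/
theorem decayWeight_succ {l : ℝ} (hl : 0 < l) (N : ℕ) (z : Rd d) :
    decayWeight l (N + 1) z * (1 + l * ‖z‖) = decayWeight l N z := by
  unfold decayWeight
  have : (1 + l * ‖z‖) ≠ 0 := by positivity
  rw [pow_succ]
  field_simp

theorem decayWeight_succ_le {l : ℝ} (hl : 0 < l) (N : ℕ) (z : Rd d) :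
    decayWeight l (N + 1) z ≤ decayWeight l N z := by
  rw [← decayWeight_succ hl N z]
  exact le_mul_of_one_le_right (decayWeight_nonneg hl _ _) (by simp; positivity)

theorem decayWeight_eq_scale {l : ℝ} (hl : 0 < l) (N : ℕ) (z : Rd d) :
    decayWeight l N z = l ^ d * decayWeight 1 N (l • z) := by
  simp [decayWeight, norm_smul, abs_of_pos hl, div_eq_mul_inv]

theorem integrable_decayWeight {l : ℝ} (hl : 0 < l) {N : ℕ} (hN : d + 1 ≤ N) :
    Integrable (decayWeight l N : Rd d → ℝ) := by
  have h1 : Integrable (decayWeight 1 N : Rd d → ℝ) := by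
    have : (Module.finrank ℝ (Rd d) : ℝ) < (N : ℝ) := by
      rw [finrank_euclideanSpace_fin]; exact_mod_cast hN
    refine (integrable_one_add_norm (μ := volume) this).congr (Eventually.of_forall fun z => ?_)
    simp only [decayWeight, one_pow, one_mul, one_div]
    rw [Real.rpow_neg (by positivity), Real.rpow_natCast]
  have h2 : (decayWeight l N : Rd d → ℝ) = fun z => l ^ d * decayWeight 1 N (l • z) :=
    funext (decayWeight_eq_scale hl N)
  rw [h2]
  exact (h1.comp_smul hl.ne').const_mul _

theorem integral_decayWeight {l : ℝ} (hl : 0 < l) (N : ℕ) :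
    ∫ z : Rd d, decayWeight l N z = ∫ z : Rd d, decayWeight 1 N z := by
  simp_rw [decayWeight_eq_scale hl N]
  rw [integral_const_mul, Measure.integral_comp_smul_of_nonneg volume _ _ (hR := hl.le),
    finrank_euclideanSpace_fin, smul_eq_mul, ← mul_assoc, mul_inv_cancel₀ (by positivity), one_mul]

theorem lintegral_decayWeight {l : ℝ} (hl : 0 < l) {N : ℕ} (hN : d + 1 ≤ N) :
    ∫⁻ z : Rd d, ENNReal.ofReal (decayWeight l N z)
      = ENNReal.ofReal (∫ z : Rd d, decayWeight 1 N z) := by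
  rw [← integral_decayWeight hl N, ofReal_integral_eq_lintegral_ofReal
    (integrable_decayWeight hl hN) (Eventually.of_forall (decayWeight_nonneg hl N))]

/-- A kernel living at scale `1/l`: it is bounded by `M` times the decay weight, and its first and
second order differences gain a factor `l‖a‖` for each increment `a` with `l‖a‖ ≤ 1`. Differences
rather than derivatives are recorded, since these are what is used. -/
structure KernelBound (K : Rd d → ℝ) (M l : ℝ) (N : ℕ) : Prop where
  nonneg : 0 ≤ M
  scale_pos : 0 < l
  continuous : Continuous K
  norm_le : ∀ z, |K z| ≤ M * decayWeight l N z
  diff_le : ∀ z a, l * ‖a‖ ≤ 1 → |K (z + a) - K z| ≤ M * (l * ‖a‖) * decayWeight l N z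
  diff_diff_le : ∀ z a b, l * ‖a‖ ≤ 1 → l * ‖b‖ ≤ 1 →
    |K (z + a + b) - K (z + a) - (K (z + b) - K z)|
      ≤ M * (l * ‖a‖) * (l * ‖b‖) * decayWeight l N z

theorem KernelBound.scale {K : Rd d → ℝ} {M : ℝ} {N : ℕ} (h : KernelBound K M 1 N) {l : ℝ}
    (hl : 0 < l) : KernelBound (fun z => l ^ d * K (l • z)) M l N where
  nonneg := h.nonneg
  scale_pos := hl
  continuous := continuous_const.mul (h.continuous.comp (continuous_const_smul l))
  norm_le z := by
    rw [decayWeight_eq_scale hl, abs_mul, abs_of_pos (pow_pos hl d)]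
    have := mul_le_mul_of_nonneg_left (h.norm_le (l • z)) (pow_pos hl d).le
    linarith
  diff_le z a ha := by
    have hn : ‖l • a‖ = l * ‖a‖ := by rw [norm_smul, Real.norm_of_nonneg hl.le]
    rw [decayWeight_eq_scale hl, ← mul_sub, abs_mul, abs_of_pos (pow_pos hl d), smul_add]
    have := mul_le_mul_of_nonneg_left (h.diff_le (l • z) (l • a) (by rw [hn]; linarith))
      (pow_pos hl d).le
    rw [hn] at this
    linarith
  diff_diff_le z a b ha hb := by
    have hn : ‖l • a‖ = l * ‖a‖ := by rw [norm_smul, Real.norm_of_nonneg hl.le]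
    have hn' : ‖l • b‖ = l * ‖b‖ := by rw [norm_smul, Real.norm_of_nonneg hl.le]
    rw [decayWeight_eq_scale hl, ← mul_sub, ← mul_sub, ← mul_sub, abs_mul,
      abs_of_pos (pow_pos hl d), smul_add, smul_add, smul_add]
    have := mul_le_mul_of_nonneg_left (h.diff_diff_le (l • z) (l • a) (l • b)
      (by rw [hn]; linarith) (by rw [hn']; linarith)) (pow_pos hl d).le
    rw [hn, hn'] at this
    linarith

/-- A Schwartz function is a kernel at scale one. -/
theorem exists_kernelBound_schwartz (K : SchwartzMap (Rd d) ℝ) (N : ℕ) :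
    ∃ M, KernelBound K M 1 N := by
  -- decay of the derivatives up to order two
  obtain ⟨C, hC0, hC⟩ : ∃ C : ℝ, 0 ≤ C ∧ ∀ n ≤ 2, ∀ z, ‖iteratedFDeriv ℝ n K z‖
      ≤ C * decayWeight 1 N z := by
    refine ⟨2 ^ N * ((Finset.Iic (N, 2)).sup fun m => SchwartzMap.seminorm ℝ m.1 m.2) K,
      by positivity, fun n hn z => ?_⟩
    have := SchwartzMap.one_add_le_sup_seminorm_apply (𝕜 := ℝ) (m := (N, 2)) (k := N) (n := n)
      le_rfl hn K z
    simp only [decayWeight, one_pow, one_mul]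
    rw [mul_one_div, le_div_iff₀ (by positivity)]
    linarith
  have hC0' : ∀ z, |K z| ≤ C * decayWeight 1 N z := fun z => by
    simpa using hC 0 (by norm_num) z
  have hC1 : ∀ z, ‖fderiv ℝ K z‖ ≤ C * decayWeight 1 N z := fun z => by
    have := hC 1 (by norm_num) z
    rwa [norm_iteratedFDeriv_one] at this
  have hC2 : ∀ z, ‖fderiv ℝ (fderiv ℝ K) z‖ ≤ C * decayWeight 1 N z := fun z => by
    have := hC 2 (by norm_num) z
    rwa [← norm_iteratedFDeriv_fderiv, norm_iteratedFDeriv_one] at this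
  -- the weight varies by a bounded factor over bounded distances
  have hw : ∀ z e : Rd d, ‖e‖ ≤ 2 → decayWeight 1 N (z + e) ≤ 3 ^ N * decayWeight 1 N z := by
    intro z e he
    simp only [decayWeight, one_pow, one_mul]
    rw [mul_one_div, div_le_div_iff₀ (by positivity) (by positivity), one_mul, ← mul_pow]
    gcongr
    have : ‖z‖ ≤ ‖z + e‖ + ‖e‖ := by simpa using norm_sub_le (z + e) e
    nlinarith [norm_nonneg (z + e)]
  have hK : Differentiable ℝ K := K.differentiable
  have hK' : Differentiable ℝ (fderiv ℝ K) := by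
    have : ContDiff ℝ (1 + 1) K := K.smooth 2
    exact ((contDiff_succ_iff_fderiv.1 this).2.2).differentiable one_ne_zero
  have hseg : ∀ a : Rd d, ∀ e ∈ segment ℝ 0 a, ‖e‖ ≤ ‖a‖ := by
    rintro a e ⟨s, t, hs, ht, hst, rfl⟩
    rw [smul_zero, zero_add, norm_smul, Real.norm_of_nonneg ht]
    exact mul_le_of_le_one_left (norm_nonneg _) (by linarith)
  -- mean value inequality for `K`
  have hd : ∀ {F : Type} [NormedAddCommGroup F] [NormedSpace ℝ F] (f : Rd d → F) (B : ℝ)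
      (z a : Rd d), Differentiable ℝ f → (∀ e, ‖e‖ ≤ ‖a‖ → ‖fderiv ℝ f (z + e)‖ ≤ B) →
      ‖f (z + a) - f z‖ ≤ B * ‖a‖ := by
    intro F _ _ f B z a hf hB
    have := (convex_segment (𝕜 := ℝ) z (z + a)).norm_image_sub_le_of_norm_fderiv_le (C := B)
      (fun x _ => hf x) (fun x hx => ?_) (left_mem_segment ℝ z (z + a))
      (right_mem_segment ℝ z (z + a))
    · simpa using this
    · have : x - z ∈ segment ℝ 0 a := by
        obtain ⟨s, t, hs, ht, hst, rfl⟩ := hx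
        refine ⟨s, t, hs, ht, hst, ?_⟩
        have : s = 1 - t := by linarith
        subst this
        module
      have h2 := hB (x - z) (hseg a _ this)
      rwa [add_sub_cancel] at h2
  refine ⟨3 ^ N * C, by positivity, one_pos, K.continuous, fun z => ?_, fun z a ha => ?_,
    fun z a b ha hb => ?_⟩
  · refine (hC0' z).trans ?_
    have := decayWeight_nonneg one_pos N z
    have h3 : (1 : ℝ) ≤ 3 ^ N := one_le_pow₀ (by norm_num)
    gcongr
    nlinarith
  · rw [one_mul] at ha ⊢
    refine (hd K (C * (3 ^ N * decayWeight 1 N z)) z a hK fun e he => ?_).trans (le_of_eq ?_)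
    · refine (hC1 _).trans ?_
      gcongr
      exact hw z e (by linarith)
    · ring
  · rw [one_mul] at ha hb ⊢
    have h1 := hd (fun y => K (y + a) - K y) (‖a‖ * (C * (3 ^ N * decayWeight 1 N z))) z b
      (((hK.comp (differentiable_id.add_const a))).sub hK) fun e he => ?_
    · simp only [Real.norm_eq_abs] at h1
      refine (le_of_eq ?_).trans (h1.trans (le_of_eq ?_))
      · congr 1
        rw [add_right_comm]
        ring
      · ring
    · have h2 : fderiv ℝ (fun y => K (y + a) - K y) (z + e)
          = fderiv ℝ K (z + e + a) - fderiv ℝ K (z + e) := by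
        have hKa : DifferentiableAt ℝ (fun y => K (y + a)) (z + e) :=
          (hK.comp (differentiable_id.add_const a)) _
        rw [fderiv_fun_sub hKa (hK _), fderiv_comp_add_right a]
      rw [h2]
      refine (hd (fderiv ℝ K) (C * (3 ^ N * decayWeight 1 N z)) (z + e) a hK'
        fun e' he' => ?_).trans (le_of_eq (by ring))
      refine (hC2 _).trans ?_
      gcongr
      rw [add_assoc]
      exact hw z _ ((norm_add_le _ _).trans (by linarith))

/-- The kernels of the dilates of a symbol are kernels at the corresponding scales, with a common
constant. -/
theorem IsSymbol.exists_kernelBound {m : Rd d → ℝ} (hm : IsSymbol m) (N : ℕ) :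
    ∃ M, ∀ l : ℝ, 0 < l → KernelBound (kernel fun ξ => m (l⁻¹ • ξ)) M l N := by
  obtain ⟨M, hM⟩ := exists_kernelBound_schwartz hm.kernelSchwartz N
  refine ⟨M, fun l hl => ?_⟩
  convert hM.scale hl using 1
  ext z
  rw [kernel_comp_inv_smul m hl, hm.kernelSchwartz_apply]

end LittlewoodPaley

/-! ### Convolution of rapidly decaying kernels with functions of polynomial growth -/

namespace LittlewoodPaley

variable {d : ℕ} {F : Type*} [NormedAddCommGroup F]

/-- The average of `‖u‖` against the decay weight at scale `1/l` centred at `x`. -/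
noncomputable def weightedAverage (l : ℝ) (u : Rd d → F) (x : Rd d) : ℝ≥0∞ :=
  ∫⁻ y, ENNReal.ofReal (decayWeight l (d + 3) (x - y)) * ‖u y‖ₑ

/-- The total mass of the decay weight, which does not depend on the scale. -/
noncomputable def weightMass (d : ℕ) : ℝ := ∫ z : Rd d, decayWeight 1 (d + 3) z

theorem weightMass_nonneg (d : ℕ) : 0 ≤ weightMass d :=
  integral_nonneg (decayWeight_nonneg one_pos _)

theorem measurable_weightedAverage {l : ℝ} (hl : 0 < l) {u : Rd d → F}
    (hu : Measurable fun y => ‖u y‖ₑ) : Measurable (weightedAverage l u) := by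
  refine Measurable.lintegral_prod_right'
    (f := fun z : Rd d × Rd d => ENNReal.ofReal (decayWeight l (d + 3) (z.1 - z.2)) * ‖u z.2‖ₑ) ?_
  exact (((continuous_decayWeight hl _).measurable.comp
    (measurable_fst.sub measurable_snd)).ennreal_ofReal).mul (hu.comp measurable_snd)

theorem eLpNorm_weightedAverage_le {l : ℝ} (hl : 0 < l) {u : Rd d → F}
    (hu : Measurable fun y => ‖u y‖ₑ) {p : ℝ≥0∞} (hp : 1 ≤ p) :
    eLpNorm (weightedAverage l u) p volume
      ≤ ENNReal.ofReal (weightMass d) * eLpNorm u p volume := by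
  have := eLpNorm_lconvolution_le (volume : Measure (Rd d))
    (continuous_decayWeight hl (d + 3)).measurable.ennreal_ofReal hu hp
  rw [lintegral_decayWeight hl (by omega)] at this
  refine this.trans (le_of_eq ?_)
  rw [weightMass]
  congr 1

theorem _root_.LipschitzWith.exists_norm_le_mul_one_add {L : ℝ≥0} {f : Rd d → F}
    (hf : LipschitzWith L f) : ∃ C, 0 ≤ C ∧ ∀ y, ‖f y‖ ≤ C * (1 + ‖y‖) := by
  refine ⟨‖f 0‖ + L, by positivity, fun y => ?_⟩
  have h1 : ‖f y - f 0‖ ≤ L * ‖y‖ := by simpa using hf.norm_sub_le y 0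
  have h2 : ‖f y‖ ≤ ‖f 0‖ + ‖f y - f 0‖ := by
    simpa using norm_add_le (f 0) (f y - f 0)
  nlinarith [norm_nonneg (f 0), norm_nonneg y, L.coe_nonneg]

variable [NormedSpace ℝ F]

/-- The convolution `K * u`. -/
noncomputable def convolve (K : Rd d → ℝ) (u : Rd d → F) (x : Rd d) : F := ∫ y, K (x - y) • u y

theorem convolve_eq (K : Rd d → ℝ) (u : Rd d → F) (x : Rd d) :
    convolve K u x = ∫ z, K z • u (x - z) := by
  unfold convolve
  rw [← integral_sub_left_eq_self (fun z => K z • u (x - z)) volume x]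
  simp

theorem convolve_congr_ae (K : Rd d → ℝ) {u v : Rd d → F} (h : u =ᵐ[volume] v) :
    convolve K u = convolve K v := by
  ext x
  refine integral_congr_ae ?_
  filter_upwards [h] with y hy
  rw [hy]

section

variable {K : Rd d → ℝ} {M l : ℝ} (hK : KernelBound K M l (d + 4))
include hK

theorem KernelBound.abs_le_succ (z : Rd d) : |K z| ≤ M * decayWeight l (d + 3) z :=
  (hK.norm_le z).trans (mul_le_mul_of_nonneg_left (decayWeight_succ_le hK.scale_pos _ z) hK.nonneg)

theorem KernelBound.abs_mul_norm_le (z : Rd d) :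
    |K z| * ‖z‖ ≤ M / l * decayWeight l (d + 3) z := by
  have hl := hK.scale_pos
  calc |K z| * ‖z‖ ≤ M * decayWeight l (d + 4) z * ((1 + l * ‖z‖) / l) := by
        have := decayWeight_nonneg hl (d + 4) z
        have := hK.nonneg
        gcongr
        · exact hK.norm_le z
        · rw [le_div_iff₀ hl]; nlinarith [norm_nonneg z]
    _ = M / l * decayWeight l (d + 3) z := by
        rw [← decayWeight_succ hl (d + 3) z]; ring

theorem KernelBound.integrable : Integrable K :=
  ((integrable_decayWeight hK.scale_pos (by omega)).const_mul M).mono'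
    hK.continuous.aestronglyMeasurable (Eventually.of_forall hK.norm_le)

/-- The exponent `d + 4` leaves room for a function of quadratic growth: `d + 2` powers of decay
remain, which are integrable. -/
theorem KernelBound.integrable_smul {u : Rd d → F} (hu : AEStronglyMeasurable u volume) {C : ℝ}
    (hC : ∀ᵐ y, ‖u y‖ ≤ C * (1 + ‖y‖) ^ 2) (x : Rd d) :
    Integrable fun y => K (x - y) • u y := by
  have hl := hK.scale_pos
  have hM := hK.nonneg
  set c := max 1 l⁻¹
  have hc : ∀ z : Rd d, 1 + ‖z‖ ≤ c * (1 + l * ‖z‖) := fun z => by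
    have h1 : 1 ≤ c := le_max_left _ _
    have h2 : l⁻¹ * l ≤ c * l := by gcongr; exact le_max_right _ _
    rw [inv_mul_cancel₀ hl.ne'] at h2
    nlinarith [norm_nonneg z]
  have hint := ((integrable_decayWeight hl (d := d) (N := d + 2) (by omega)).comp_sub_left x
    ).const_mul (M * |C| * ((1 + ‖x‖) * c) ^ 2)
  refine hint.mono' ((hK.continuous.comp (by fun_prop)).aestronglyMeasurable.smul hu) ?_
  filter_upwards [hC] with y hy
  have h1 : 1 + ‖y‖ ≤ (1 + ‖x‖) * c * (1 + l * ‖x - y‖) := by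
    have h2 : ‖y‖ ≤ ‖x‖ + ‖x - y‖ := by simpa using norm_sub_le x (x - y)
    have h3 := hc (x - y)
    nlinarith [norm_nonneg x, norm_nonneg (x - y)]
  rw [norm_smul, Real.norm_eq_abs]
  calc |K (x - y)| * ‖u y‖
      ≤ M * decayWeight l (d + 4) (x - y) * (|C| * ((1 + ‖x‖) * c * (1 + l * ‖x - y‖)) ^ 2) := by
        have := decayWeight_nonneg hl (d + 4) (x - y)
        gcongr
        · exact hK.norm_le _
        · refine hy.trans ?_
          gcongr
          exact le_abs_self C
    _ = M * |C| * ((1 + ‖x‖) * c) ^ 2 * decayWeight l (d + 2) (x - y) := by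
        rw [← decayWeight_succ hl (d + 2), ← decayWeight_succ hl (d + 3)]; ring

theorem KernelBound.integrable_smul_of_norm_le {u : Rd d → F} (hu : AEStronglyMeasurable u volume)
    {C : ℝ} (hC : ∀ᵐ y, ‖u y‖ ≤ C) (x : Rd d) : Integrable fun y => K (x - y) • u y := by
  refine hK.integrable_smul hu (C := |C|) ?_ x
  filter_upwards [hC] with y hy
  have : (1 : ℝ) ≤ (1 + ‖y‖) ^ 2 := one_le_pow₀ (by simp)
  nlinarith [le_abs_self C, abs_nonneg C]

theorem KernelBound.integrable_smul_of_lipschitz {L : ℝ≥0} {u : Rd d → F}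
    (hu : LipschitzWith L u) (x : Rd d) : Integrable fun y => K (x - y) • u y := by
  obtain ⟨C, hC0, hC⟩ := hu.exists_norm_le_mul_one_add
  refine hK.integrable_smul hu.continuous.aestronglyMeasurable (C := C)
    (Eventually.of_forall fun y => (hC y).trans ?_) x
  have : (1 : ℝ) ≤ 1 + ‖y‖ := by simp
  gcongr
  nlinarith

theorem KernelBound.enorm_convolve_le (u : Rd d → F) (x : Rd d) :
    ‖convolve K u x‖ₑ ≤ ENNReal.ofReal M * weightedAverage l u x := by
  refine (enorm_integral_le_lintegral_enorm _).trans ?_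
  rw [weightedAverage, ← lintegral_const_mul' _ _ ENNReal.ofReal_ne_top]
  refine lintegral_mono fun y => ?_
  rw [enorm_smul, ← mul_assoc, ← ENNReal.ofReal_mul hK.nonneg, ← ofReal_norm (K (x - y)),
    Real.norm_eq_abs]
  gcongr
  exact hK.abs_le_succ _

theorem KernelBound.enorm_convolve_sub_le {u : Rd d → F}
    (hu : ∀ x, Integrable fun y => K (x - y) • u y) {x x' : Rd d} (hx : l * ‖x' - x‖ ≤ 1) :
    ‖convolve K u x' - convolve K u x‖ₑ
      ≤ ENNReal.ofReal (M * (l * ‖x' - x‖)) * weightedAverage l u x := by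
  unfold convolve
  rw [← integral_sub (hu x') (hu x)]
  refine (enorm_integral_le_lintegral_enorm _).trans ?_
  rw [weightedAverage, ← lintegral_const_mul' _ _ ENNReal.ofReal_ne_top]
  refine lintegral_mono fun y => ?_
  have h0 : 0 ≤ M * (l * ‖x' - x‖) := by
    have := hK.nonneg; have := hK.scale_pos; positivity
  rw [← sub_smul, enorm_smul, ← mul_assoc, ← ENNReal.ofReal_mul h0,
    ← ofReal_norm (K _ - _), Real.norm_eq_abs]
  gcongr
  have := hK.diff_le (x - y) (x' - x) hx
  rw [show x - y + (x' - x) = x' - y by abel] at this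
  refine this.trans ?_
  gcongr
  exact decayWeight_succ_le hK.scale_pos _ _

theorem KernelBound.integral_abs_le : ∫ z, |K z| ≤ M * weightMass d := by
  have hl := hK.scale_pos
  rw [weightMass, ← integral_decayWeight hl, ← integral_const_mul]
  exact integral_mono hK.integrable.norm ((integrable_decayWeight hl (by omega)).const_mul _)
    hK.abs_le_succ

theorem KernelBound.integrable_abs_mul_norm : Integrable fun z => |K z| * ‖z‖ :=
  ((integrable_decayWeight hK.scale_pos (N := d + 3) (by omega)).const_mul (M / l)).mono'
    (hK.continuous.abs.mul continuous_norm).aestronglyMeasurable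
    (Eventually.of_forall fun z => by
      rw [Real.norm_of_nonneg (by positivity)]; exact hK.abs_mul_norm_le z)

theorem KernelBound.integral_abs_mul_norm_le : ∫ z, |K z| * ‖z‖ ≤ M / l * weightMass d := by
  have hl := hK.scale_pos
  rw [weightMass, ← integral_decayWeight hl, ← integral_const_mul]
  exact integral_mono hK.integrable_abs_mul_norm
    ((integrable_decayWeight hl (by omega)).const_mul _) hK.abs_mul_norm_le

theorem KernelBound.norm_convolve_le {u : Rd d → F} {B : ℝ} (hB : 0 ≤ B)
    (h : ∀ᵐ y, ‖u y‖ ≤ B) (x : Rd d) : ‖convolve K u x‖ ≤ M * weightMass d * B := by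
  calc ‖convolve K u x‖ ≤ ∫ y, |K (x - y)| * B := by
        refine norm_integral_le_of_norm_le ((hK.integrable.comp_sub_left x).norm.mul_const B) ?_
        filter_upwards [h] with y hy
        rw [norm_smul, Real.norm_eq_abs]
        gcongr
    _ = (∫ z, |K z|) * B := by
        rw [integral_mul_const, integral_sub_left_eq_self (fun z => |K z|) volume x]
    _ ≤ _ := by gcongr; exact hK.integral_abs_le

theorem KernelBound.integrable_smul_comp_sub {L : ℝ≥0} {u : Rd d → F}
    (hu : LipschitzWith L u) (x : Rd d) : Integrable fun z => K z • u (x - z) := by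
  have := (hK.integrable_smul_of_lipschitz hu x).comp_sub_left x
  simpa using this

theorem KernelBound.lipschitzWith_convolve {L : ℝ≥0} {u : Rd d → F} (hu : LipschitzWith L u) :
    LipschitzWith (Real.toNNReal (M * weightMass d) * L) (convolve K u) := by
  refine LipschitzWith.of_dist_le_mul fun x x' => ?_
  rw [dist_eq_norm, dist_eq_norm, convolve_eq, convolve_eq,
    ← integral_sub (hK.integrable_smul_comp_sub hu x) (hK.integrable_smul_comp_sub hu x')]
  have h0 := mul_nonneg hK.nonneg (weightMass_nonneg d)
  calc ‖∫ z, K z • u (x - z) - K z • u (x' - z)‖ ≤ ∫ z, |K z| * (L * ‖x - x'‖) := by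
        refine norm_integral_le_of_norm_le (hK.integrable.norm.mul_const _)
          (Eventually.of_forall fun z => ?_)
        rw [← smul_sub, norm_smul, Real.norm_eq_abs]
        gcongr
        simpa using hu.norm_sub_le (x - z) (x' - z)
    _ = (∫ z, |K z|) * (L * ‖x - x'‖) := integral_mul_const _ _
    _ ≤ M * weightMass d * (L * ‖x - x'‖) := by gcongr; exact hK.integral_abs_le
    _ = _ := by rw [NNReal.coe_mul, Real.coe_toNNReal _ h0]; ring

/-- A kernel of mass one at scale `1/l` is an approximate identity on Lipschitz functions. -/
theorem KernelBound.norm_convolve_sub_le [CompleteSpace F] (h1 : ∫ z, K z = 1) {L : ℝ≥0}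
    {u : Rd d → F} (hu : LipschitzWith L u) (x : Rd d) :
    ‖convolve K u x - u x‖ ≤ M / l * weightMass d * L := by
  have h2 : u x = ∫ z, K z • u x := by rw [integral_smul_const, h1, one_smul]
  rw [convolve_eq, h2, ← integral_sub (hK.integrable_smul_comp_sub hu x)
    (hK.integrable.smul_const _)]
  calc ‖∫ z, K z • u (x - z) - K z • u x‖ ≤ ∫ z, |K z| * ‖z‖ * L := by
        refine norm_integral_le_of_norm_le (hK.integrable_abs_mul_norm.mul_const _)
          (Eventually.of_forall fun z => ?_)
        rw [← smul_sub, norm_smul, Real.norm_eq_abs, mul_assoc]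
        gcongr
        have := hu.norm_sub_le (x - z) x
        rw [sub_sub_cancel_left, norm_neg] at this
        linarith
    _ = (∫ z, |K z| * ‖z‖) * L := integral_mul_const _ _
    _ ≤ _ := by gcongr; exact hK.integral_abs_mul_norm_le

end

/-! ### Gradients of Lipschitz functions -/

theorem measurable_gradient (f : Rd d → ℝ) : Measurable (gradient f) := by
  unfold gradient
  exact (LinearIsometryEquiv.continuous _).measurable.comp (measurable_fderiv ℝ f)

theorem norm_gradient_le {L : ℝ≥0} {f : Rd d → ℝ} (hf : LipschitzWith L f) (x : Rd d) :
    ‖gradient f x‖ ≤ L := by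
  unfold gradient
  rw [LinearIsometryEquiv.norm_map]
  exact norm_fderiv_le_of_lipschitz ℝ hf

/-- For a Lipschitz function, convolution commutes with the gradient. -/
theorem KernelBound.hasGradientAt_convolve {K : Rd d → ℝ} {M l : ℝ}
    (hK : KernelBound K M l (d + 4)) {L : ℝ≥0} {u : Rd d → ℝ} (hu : LipschitzWith L u) (x : Rd d) :
    HasGradientAt (convolve K u) (convolve K (gradient u) x) x := by
  have hae : ∀ᵐ z, DifferentiableAt ℝ u (x - z) := by
    have := (Measure.measurePreserving_sub_left (volume : Measure (Rd d)) x
      ).quasiMeasurePreserving.ae hu.ae_differentiableAt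
    exact this
  have hint := hasFDerivAt_integral_of_dominated_loc_of_lip' (𝕜 := ℝ) (μ := volume) (x₀ := x)
    (F := fun x z => K z • u (x - z)) (F' := fun z => K z • fderiv ℝ u (x - z))
    (bound := fun z => |K z| * L) (s := Set.univ) univ_mem
    (fun x' _ => (hK.integrable_smul_comp_sub hu x').aestronglyMeasurable)
    (hK.integrable_smul_comp_sub hu x)
    (hK.continuous.aestronglyMeasurable.smul
      ((measurable_fderiv ℝ u).comp (measurable_id.const_sub x)).aestronglyMeasurable)
    (Eventually.of_forall fun z x' _ => by
      rw [← smul_sub, norm_smul, Real.norm_eq_abs, mul_assoc]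
      gcongr
      simpa using hu.norm_sub_le (x' - z) (x - z))
    (hK.integrable.norm.mul_const _) ?_
  · have h1 : (fun x => ∫ z, K z • u (x - z)) = convolve K u :=
      funext fun x => (convolve_eq K u x).symm
    rw [h1] at hint
    rw [hasGradientAt_iff_hasFDerivAt]
    have h2 : InnerProductSpace.toDual ℝ (Rd d) (convolve K (gradient u) x)
        = ∫ z, K z • fderiv ℝ u (x - z) := ?_
    · rw [h2]; exact hint.2
    rw [convolve_eq]
    have := (InnerProductSpace.toDual ℝ (Rd d)).toContinuousLinearEquiv.integral_comp_comm
      (μ := volume) (fun z => K z • gradient u (x - z))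
    refine Eq.trans this.symm ?_
    refine integral_congr_ae (Eventually.of_forall fun z => ?_)
    simp [gradient]
  · filter_upwards [hae] with z hz
    have := hz.hasFDerivAt.comp x ((hasFDerivAt_id x).sub_const z)
    exact (this.const_smul (K z))

/-- Integration by parts for a Lipschitz function `g`, in the form of an inequality: the
derivatives fall on the weight `κ`, whose difference quotients are bounded by `q`. -/
theorem enorm_integral_smul_gradient_le {κ q g : Rd d → ℝ} {L : ℝ≥0} (hg : LipschitzWith L g)
    (hκ : Integrable κ) (hgκ : Integrable fun y => g y * κ y) {δ : ℝ} (hδ : 0 < δ)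
    (hq : ∀ y a, ‖a‖ ≤ δ → |κ (y + a) - κ y| ≤ ‖a‖ * q y) :
    ‖∫ y, κ y • gradient g y‖ₑ ≤ ∫⁻ y, ENNReal.ofReal (q y) * ‖g y‖ₑ := by
  set B := ∫⁻ y, ENNReal.ofReal (q y) * ‖g y‖ₑ with hB
  rcases eq_or_ne B ∞ with hBtop | hBtop
  · rw [hBtop]; exact le_top
  have hint : Integrable fun y => κ y • gradient g y := by
    refine (hκ.norm.mul_const (L : ℝ)).mono' (hκ.aestronglyMeasurable.smul
      (measurable_gradient g).aestronglyMeasurable) (Eventually.of_forall fun y => ?_)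
    rw [norm_smul]
    gcongr
    exact norm_gradient_le hg y
  set I := ∫ y, κ y • gradient g y with hI
  have key : ∀ v : Rd d, ‖(inner ℝ I v : ℝ)‖ ≤ ‖v‖ * B.toReal := by
    intro v
    have h1 : (inner ℝ I v : ℝ) = ∫ y, lineDeriv ℝ g y v * κ y := by
      rw [real_inner_comm, hI, ← integral_inner hint]
      refine integral_congr_ae ?_
      filter_upwards [hg.ae_differentiableAt] with y hy
      rw [hy.lineDeriv_eq_fderiv, real_inner_smul_right, real_inner_comm, mul_comm]
      congr 1
      simp [gradient]
    rw [h1]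
    have hlim := (hg.integral_inv_smul_sub_mul_tendsto_integral_lineDeriv_mul hκ v).norm
    refine le_of_tendsto hlim ?_
    have hsmall : ∀ᶠ t : ℝ in 𝓝[>] 0, t * ‖v‖ ≤ δ := by
      have : Tendsto (fun t : ℝ => t * ‖v‖) (𝓝[>] 0) (𝓝 (0 * ‖v‖)) :=
        (tendsto_id.mul_const _).mono_left nhdsWithin_le_nhds
      rw [zero_mul] at this
      exact this.eventually (ge_mem_nhds hδ)
    filter_upwards [hsmall, self_mem_nhdsWithin] with t ht (ht0 : 0 < t)
    have hn : ‖-(t • v)‖ = t * ‖v‖ := by rw [norm_neg, norm_smul, Real.norm_of_nonneg ht0.le]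
    -- move the increment from `g` to `κ`
    have i1 : Integrable fun y => g (y + t • v) * κ y := by
      have : Integrable fun y => (g (y + t • v) - g y) * κ y := by
        refine hκ.bdd_mul (c := L * ‖t • v‖) (((hg.continuous.comp (by fun_prop)).sub
          hg.continuous).aestronglyMeasurable) (Eventually.of_forall fun y => ?_)
        simpa using hg.norm_sub_le (y + t • v) y
      refine (this.add hgκ).congr (Eventually.of_forall fun y => ?_)
      simp only [Pi.add_apply]
      ring
    have i2 : Integrable fun y => g y * κ (y + -(t • v)) := by
      have := i1.comp_add_right (-(t • v))
      simpa using this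
    have e1 : ∫ y, g (y + t • v) * κ y = ∫ y, g y * κ (y + -(t • v)) := by
      rw [← integral_add_right_eq_self _ (-(t • v))]
      simp
    have e2 : ∫ y, (t⁻¹ • (g (y + t • v) - g y)) * κ y
        = t⁻¹ * ∫ y, g y * (κ (y + -(t • v)) - κ y) := by
      simp only [smul_eq_mul, mul_assoc, sub_mul, mul_sub]
      rw [integral_sub (i1.const_mul _) (hgκ.const_mul _), integral_sub i2 hgκ, integral_const_mul,
        integral_const_mul, e1]
      ring
    rw [e2, norm_mul, norm_inv, Real.norm_of_nonneg ht0.le]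
    have e3 : ‖∫ y, g y * (κ (y + -(t • v)) - κ y)‖ₑ ≤ ENNReal.ofReal (t * ‖v‖) * B := by
      refine (enorm_integral_le_lintegral_enorm _).trans ?_
      rw [hB, ← lintegral_const_mul' _ _ ENNReal.ofReal_ne_top]
      refine lintegral_mono fun y => ?_
      rw [enorm_mul, mul_comm, ← mul_assoc, ← ENNReal.ofReal_mul (by positivity),
        ← ofReal_norm (κ _ - _), Real.norm_eq_abs]
      gcongr
      have := hq y (-(t • v)) (by rw [hn]; exact ht)
      rwa [hn] at this
    have e4 := ENNReal.toReal_mono (ENNReal.mul_ne_top ENNReal.ofReal_ne_top hBtop) e3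
    rw [toReal_enorm, ENNReal.toReal_mul, ENNReal.toReal_ofReal (by positivity)] at e4
    rw [inv_mul_le_iff₀ ht0]
    linarith
  have h2 : ‖I‖ ≤ B.toReal := by
    have := key I
    rw [real_inner_self_eq_norm_sq, Real.norm_of_nonneg (by positivity), sq] at this
    rcases eq_or_lt_of_le (norm_nonneg I) with h0 | h0
    · rw [← h0]; exact ENNReal.toReal_nonneg
    · exact le_of_mul_le_mul_left this h0
  rw [← ofReal_norm, ← ENNReal.ofReal_toReal hBtop]
  exact ENNReal.ofReal_le_ofReal h2

end LittlewoodPaley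

/-! ### Spectral localization of products -/

namespace LittlewoodPaley

variable {d : ℕ} {F : Type*} [NormedAddCommGroup F] [NormedSpace ℝ F]

/-- Fubini's theorem for the pairing of a weight with a convolution. -/
theorem KernelBound.integral_smul_convolve [CompleteSpace F] {h : Rd d → ℝ} {M l : ℝ}
    (hh : KernelBound h M l (d + 4)) {Φ : Rd d → ℝ} (hΦm : AEStronglyMeasurable Φ volume)
    (hΦ : Integrable fun y => Φ y * (1 + ‖y‖)) {u : Rd d → F}
    (hu : AEStronglyMeasurable u volume) {C : ℝ} (hC : ∀ᵐ y, ‖u y‖ ≤ C * (1 + ‖y‖)) :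
    ∫ y, Φ y • convolve h u y = ∫ w, (∫ y, Φ y * h (y - w)) • u w := by
  have hg : Integrable fun z => |h (-z)| * (1 + ‖z‖) := by
    have := (hh.integrable.norm.add hh.integrable_abs_mul_norm).comp_neg
    refine this.congr (Eventually.of_forall fun z => ?_)
    simp only [Pi.add_apply, Real.norm_eq_abs, norm_neg]
    ring
  have hprod : Integrable (fun q : Rd d × Rd d => (Φ q.2 * h (q.2 - q.1)) • u q.1)
      (volume.prod volume) := by
    have hdom := (hΦ.norm.convolution_integrand (.mul ℝ ℝ) hg).const_mul |C|
    refine hdom.mono' ?_ ?_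
    · refine AEStronglyMeasurable.smul (hΦm.comp_snd.mul ?_) hu.comp_fst
      exact (hh.continuous.comp (by fun_prop)).aestronglyMeasurable
    · have hC' : ∀ᵐ q ∂(volume : Measure (Rd d)).prod (volume : Measure (Rd d)),
          ‖u q.1‖ ≤ C * (1 + ‖q.1‖) :=
        Measure.quasiMeasurePreserving_fst.ae hC
      filter_upwards [hC'] with q hq
      rw [norm_smul, norm_mul, ContinuousLinearMap.mul_apply', neg_sub, Real.norm_eq_abs,
        Real.norm_eq_abs, norm_mul, Real.norm_eq_abs, Real.norm_of_nonneg (by positivity)]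
      have h1 : ‖u q.1‖ ≤ |C| * ((1 + ‖q.2‖) * (1 + ‖q.1 - q.2‖)) := by
        have h2 : ‖q.1‖ ≤ ‖q.2‖ + ‖q.1 - q.2‖ := by simpa using norm_add_le q.2 (q.1 - q.2)
        refine hq.trans (mul_le_mul (le_abs_self C) ?_ (by positivity) (abs_nonneg C))
        nlinarith [norm_nonneg q.2, norm_nonneg (q.1 - q.2)]
      calc |Φ q.2| * |h (q.2 - q.1)| * ‖u q.1‖
          ≤ |Φ q.2| * |h (q.2 - q.1)| * (|C| * ((1 + ‖q.2‖) * (1 + ‖q.1 - q.2‖))) := by gcongr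
        _ = _ := by ring
  calc ∫ y, Φ y • convolve h u y = ∫ y, ∫ w, (Φ y * h (y - w)) • u w := by
        refine integral_congr_ae (Eventually.of_forall fun y => ?_)
        simp only [convolve, mul_smul, integral_smul]
    _ = ∫ w, ∫ y, (Φ y * h (y - w)) • u w := (integral_integral_swap hprod).symm
    _ = _ := by
        refine integral_congr_ae (Eventually.of_forall fun w => ?_)
        exact integral_smul_const _ _

variable {m₁ m₂ : Rd d → ℝ} {M₁ M₂ l₁ l₂ : ℝ}

/-- Multipliers with disjoint supports compose to zero. -/
theorem convolve_convolve_eq_zero [CompleteSpace F] (hm₁ : IsSymbol m₁) (hm₂ : IsSymbol m₂)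
    (h₁ : KernelBound (kernel m₁) M₁ l₁ (d + 4)) (h₂ : KernelBound (kernel m₂) M₂ l₂ (d + 4))
    (h : ∀ ξ, m₁ ξ * m₂ ξ = 0) {u : Rd d → F} (hu : AEStronglyMeasurable u volume) {C : ℝ}
    (hC : ∀ᵐ y, ‖u y‖ ≤ C * (1 + ‖y‖)) (x : Rd d) :
    convolve (kernel m₁) (convolve (kernel m₂) u) x = 0 := by
  unfold convolve
  have := h₂.integral_smul_convolve (Φ := fun y => kernel m₁ (x - y))
    (h₁.continuous.comp (by fun_prop)).aestronglyMeasurable ?_ hu hC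
  · refine this.trans ?_
    simp [integral_kernel_mul_kernel_eq_zero hm₁ hm₂ h x]
  · refine h₁.integrable_smul (u := fun y : Rd d => 1 + ‖y‖) (C := 1)
      (by fun_prop) (Eventually.of_forall fun y => ?_) x
    rw [Real.norm_of_nonneg (by positivity)]
    nlinarith [norm_nonneg y]

/-- A product of two low frequency functions is annihilated by a high frequency multiplier. -/
theorem convolve_mul_convolve_eq_zero [CompleteSpace F] (hm₁ : IsSymbol m₁) (hm₂ : IsSymbol m₂)
    (h₁ : KernelBound (kernel m₁) M₁ l₁ (d + 4)) (h₂ : KernelBound (kernel m₂) M₂ l₂ (d + 4))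
    (h : ∀ ξ η, m₁ (ξ + η) * (m₂ ξ * m₂ η) = 0) {L : ℝ≥0} {φ : Rd d → ℝ}
    (hφ : LipschitzWith L φ) {u : Rd d → F} (hu : AEStronglyMeasurable u volume) {C : ℝ}
    (hC0 : 0 ≤ C) (hC : ∀ᵐ y, ‖u y‖ ≤ C) (x : Rd d) :
    convolve (kernel m₁) (fun y => convolve (kernel m₂) φ y • convolve (kernel m₂) u y) x = 0 := by
  have hf := h₂.lipschitzWith_convolve hφ
  set f := convolve (kernel m₂) φ with hfdef
  obtain ⟨Cf, hCf0, hCf⟩ := hf.exists_norm_le_mul_one_add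
  obtain ⟨Cφ, hCφ0, hCφ⟩ := hφ.exists_norm_le_mul_one_add
  have hcK : Continuous fun y => kernel m₁ (x - y) := h₁.continuous.comp (by fun_prop)
  have hΦ : Integrable fun y => kernel m₁ (x - y) * f y * (1 + ‖y‖) := by
    have := h₁.integrable_smul (u := fun y : Rd d => f y * (1 + ‖y‖)) (C := Cf)
      (hf.continuous.mul (by fun_prop)).aestronglyMeasurable (Eventually.of_forall fun y => ?_) x
    · simpa only [smul_eq_mul, mul_assoc] using this
    · rw [norm_mul, Real.norm_of_nonneg (by positivity : 0 ≤ 1 + ‖y‖), sq, ← mul_assoc]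
      gcongr
      exact hCf y
  have hinner : ∀ w, ∫ y, kernel m₁ (x - y) * f y * kernel m₂ (y - w) = 0 := by
    intro w
    have hc2 : Continuous fun y => kernel m₂ (y - w) := h₂.continuous.comp (by fun_prop)
    have hi : Integrable fun y => kernel m₁ (x - y) * kernel m₂ (y - w) * (1 + ‖y‖) := by
      have := h₁.integrable_smul (u := fun y : Rd d => kernel m₂ (y - w) * (1 + ‖y‖))
        (C := M₂ * l₂ ^ d) (hc2.mul (by fun_prop)).aestronglyMeasurable
        (Eventually.of_forall fun y => ?_) x
      · simpa only [smul_eq_mul, mul_assoc] using this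
      · have hb : |kernel m₂ (y - w)| ≤ M₂ * l₂ ^ d := by
          refine (h₂.norm_le _).trans ?_
          have := h₂.nonneg
          have := h₂.scale_pos
          gcongr
          unfold decayWeight
          refine div_le_self (by positivity) (one_le_pow₀ ?_)
          simp only [le_add_iff_nonneg_right]
          positivity
        rw [norm_mul, Real.norm_of_nonneg (by positivity : 0 ≤ 1 + ‖y‖), sq, ← mul_assoc]
        gcongr
        refine hb.trans (le_mul_of_one_le_right ((abs_nonneg _).trans hb) (by simp))
    have := h₂.integral_smul_convolve (Φ := fun y => kernel m₁ (x - y) * kernel m₂ (y - w))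
      (hcK.mul hc2).aestronglyMeasurable hi hφ.continuous.aestronglyMeasurable
      (Eventually.of_forall hCφ)
    rw [← hfdef] at this
    have h3 : ∀ z, ∫ y, kernel m₁ (x - y) * kernel m₂ (y - w) * kernel m₂ (y - z) = 0 := by
      intro z
      simpa only [mul_assoc] using
        integral_kernel_mul_kernel_mul_kernel_eq_zero hm₁ hm₂ hm₂ h x w z
    simp only [h3, smul_eq_mul, zero_mul, integral_zero] at this
    rw [← this]
    refine integral_congr_ae (Eventually.of_forall fun y => ?_)
    ring
  have := h₂.integral_smul_convolve (Φ := fun y => kernel m₁ (x - y) * f y)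
    (hcK.mul hf.continuous).aestronglyMeasurable hΦ hu (C := C) ?_
  · simp only [hinner, zero_smul, integral_zero] at this
    rw [← this]
    unfold convolve
    simp only [mul_smul]
  · filter_upwards [hC] with y hy
    exact hy.trans (le_mul_of_one_le_right hC0 (by simp))

/-! ### Bernstein's inequality -/

theorem enorm_sub_comp_sub_le {f : Rd d → ℝ} {L : ℝ≥0} (hf : LipschitzWith L f)
    (hd : Differentiable ℝ f) (x z : Rd d) :
    ‖f x - f (x - z)‖ₑ ≤ ∫⁻ t in Set.Ioc (0 : ℝ) 1, ‖z‖ₑ * ‖gradient f (x - t • z)‖ₑ := by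
  have hderiv : ∀ t : ℝ,
      HasDerivAt (fun t : ℝ => f (x - t • z)) (fderiv ℝ f (x - t • z) (-z)) t := by
    intro t
    have h1 : HasDerivAt (fun t : ℝ => x - t • z) (-z) t := by
      simpa using ((hasDerivAt_id t).smul_const z).const_sub x
    exact (hd (x - t • z)).hasFDerivAt.comp_hasDerivAt t h1
  have hbound : ∀ t : ℝ, ‖fderiv ℝ f (x - t • z) (-z)‖ ≤ ‖z‖ * ‖gradient f (x - t • z)‖ := by
    intro t
    refine (ContinuousLinearMap.le_opNorm _ _).trans (le_of_eq ?_)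
    simp [gradient, mul_comm]
  have hmeas : Measurable fun t : ℝ => fderiv ℝ f (x - t • z) (-z) :=
    ((measurable_fderiv ℝ f).comp
      (by fun_prop : Measurable fun t : ℝ => x - t • z)).apply_continuousLinearMap _
  have hint : IntervalIntegrable (fun t : ℝ => fderiv ℝ f (x - t • z) (-z)) volume 0 1 := by
    rw [intervalIntegrable_iff_integrableOn_Ioc_of_le zero_le_one]
    refine Measure.integrableOn_of_bounded (M := ‖z‖ * L) (by simp) hmeas.aestronglyMeasurable
      (Eventually.of_forall fun t => (hbound t).trans ?_)
    gcongr
    exact norm_gradient_le hf _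
  have hftc := intervalIntegral.integral_eq_sub_of_hasDerivAt (fun t _ => hderiv t) hint
  have h2 : ‖f x - f (x - z)‖ₑ = ‖∫ t in (0 : ℝ)..1, fderiv ℝ f (x - t • z) (-z)‖ₑ := by
    rw [hftc, one_smul, zero_smul, sub_zero, ← enorm_neg, neg_sub]
  rw [h2, intervalIntegral.integral_of_le zero_le_one]
  refine (enorm_integral_le_lintegral_enorm _).trans (lintegral_mono fun t => ?_)
  rw [← ofReal_norm, ← ofReal_norm, ← ofReal_norm, ← ENNReal.ofReal_mul (norm_nonneg _)]
  exact ENNReal.ofReal_le_ofReal (hbound t)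

theorem eLpNorm_sub_comp_sub_le {f : Rd d → ℝ} {L : ℝ≥0} (hf : LipschitzWith L f)
    (hd : Differentiable ℝ f) {p : ℝ≥0∞} (hp : 1 ≤ p) (z : Rd d) :
    eLpNorm (fun x => f x - f (x - z)) p volume ≤ ‖z‖ₑ * eLpNorm (gradient f) p volume := by
  have hG : Measurable fun x => ‖gradient f x‖ₑ := (measurable_gradient f).enorm
  calc eLpNorm (fun x => f x - f (x - z)) p volume
      ≤ eLpNorm (fun x => ∫⁻ t in Set.Ioc (0 : ℝ) 1, ‖z‖ₑ * ‖gradient f (x - t • z)‖ₑ) p volume :=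
        eLpNorm_mono_enorm fun x => by simpa using enorm_sub_comp_sub_le hf hd x z
    _ ≤ ∫⁻ t in Set.Ioc (0 : ℝ) 1,
          eLpNorm (fun x => ‖z‖ₑ * ‖gradient f (x - t • z)‖ₑ) p volume := by
        refine eLpNorm_lintegral_le (ν := volume.restrict (Set.Ioc (0 : ℝ) 1))
          (f := fun x t => ‖z‖ₑ * ‖gradient f (x - t • z)‖ₑ) ?_ hp
        exact (hG.comp (by fun_prop : Measurable fun q : Rd d × ℝ => q.1 - q.2 • z)).const_mul _
    _ = ∫⁻ t in Set.Ioc (0 : ℝ) 1, ‖z‖ₑ * eLpNorm (gradient f) p volume := by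
        refine lintegral_congr fun t => ?_
        rw [eLpNorm_const_mul_ennreal (f := fun x => ‖gradient f (x - t • z)‖ₑ)
          (hG.comp (measurable_id.sub_const _)) p hp]
        congr 1
        have := eLpNorm_comp_measurePreserving (p := p) (g := fun x => ‖gradient f x‖ₑ)
          hG.aestronglyMeasurable (measurePreserving_sub_right volume (t • z))
        refine Eq.trans this ?_
        exact eLpNorm_congr_enorm_ae (Eventually.of_forall fun y => by simp)
    _ = _ := by simp

/-- **Bernstein's inequality** for a function without low frequencies: if `h` has mass one, lives at
scale `1/l` and annihilates `f`, then `f(x) = ∫ h(z) (f(x) - f(x - z)) dz`, so that `f` is bounded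
by `l⁻¹` times its gradient. -/
theorem KernelBound.eLpNorm_le_gradient {h : Rd d → ℝ} {M l : ℝ}
    (hh : KernelBound h M l (d + 4)) (h1 : ∫ z, h z = 1) {f : Rd d → ℝ} {L : ℝ≥0}
    (hf : LipschitzWith L f) (hd : Differentiable ℝ f) (h0 : ∀ x, convolve h f x = 0)
    {p : ℝ≥0∞} (hp : 1 ≤ p) :
    eLpNorm f p volume
      ≤ ENNReal.ofReal (M / l * weightMass d) * eLpNorm (gradient f) p volume := by
  have hfm : Measurable f := hf.continuous.measurable
  have hpt : ∀ x, ‖f x‖ₑ ≤ ∫⁻ z, ‖h z‖ₑ * ‖f x - f (x - z)‖ₑ := by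
    intro x
    have h2 : f x = ∫ z, h z * (f x - f (x - z)) := by
      have e1 : ∫ z, h z * f x = f x := by rw [integral_mul_const, h1, one_mul]
      have e2 : ∫ z, h z * f (x - z) = 0 := by
        have := h0 x
        rwa [convolve_eq] at this
      simp only [mul_sub]
      have i2 : Integrable fun z => h z * f (x - z) := hh.integrable_smul_comp_sub hf x
      rw [integral_sub (hh.integrable.mul_const _) i2, e1, e2, sub_zero]
    calc ‖f x‖ₑ = ‖∫ z, h z * (f x - f (x - z))‖ₑ := by rw [← h2]
      _ ≤ _ := by
        refine (enorm_integral_le_lintegral_enorm _).trans (lintegral_mono fun z => ?_)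
        rw [enorm_mul]
  have hm2 : Measurable fun q : Rd d × Rd d => f q.1 - f (q.1 - q.2) :=
    (hfm.comp measurable_fst).sub (hfm.comp (measurable_fst.sub measurable_snd))
  calc eLpNorm f p volume
      ≤ eLpNorm (fun x => ∫⁻ z, ‖h z‖ₑ * ‖f x - f (x - z)‖ₑ) p volume :=
        eLpNorm_mono_enorm fun x => by simpa using hpt x
    _ ≤ ∫⁻ z, eLpNorm (fun x => ‖h z‖ₑ * ‖f x - f (x - z)‖ₑ) p volume := by
        refine eLpNorm_lintegral_le (f := fun x z => ‖h z‖ₑ * ‖f x - f (x - z)‖ₑ) ?_ hp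
        exact (hh.continuous.measurable.comp measurable_snd).enorm.mul hm2.enorm
    _ ≤ ∫⁻ z, ‖h z‖ₑ * ‖z‖ₑ * eLpNorm (gradient f) p volume := by
        refine lintegral_mono fun z => ?_
        rw [eLpNorm_const_mul_ennreal (f := fun x => ‖f x - f (x - z)‖ₑ)
          (hm2.comp measurable_prodMk_right).enorm p hp, mul_assoc]
        gcongr
        refine le_trans (le_of_eq ?_) (eLpNorm_sub_comp_sub_le hf hd hp z)
        exact eLpNorm_congr_enorm_ae (Eventually.of_forall fun y => by simp)
    _ = (∫⁻ z, ‖h z‖ₑ * ‖z‖ₑ) * eLpNorm (gradient f) p volume :=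
        lintegral_mul_const _ (hh.continuous.measurable.enorm.mul measurable_enorm)
    _ ≤ _ := by
        gcongr
        have : ∫⁻ z, ‖h z‖ₑ * ‖z‖ₑ = ENNReal.ofReal (∫ z, |h z| * ‖z‖) := by
          rw [ofReal_integral_eq_lintegral_ofReal hh.integrable_abs_mul_norm
            (Eventually.of_forall fun z => by positivity)]
          refine lintegral_congr fun z => ?_
          rw [ENNReal.ofReal_mul (abs_nonneg _), ofReal_norm, ← Real.norm_eq_abs, ofReal_norm]
        rw [this]
        exact ENNReal.ofReal_le_ofReal hh.integral_abs_mul_norm_le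

end LittlewoodPaley

/-! ### The commutator with a Lipschitz function at a fixed frequency -/

namespace LittlewoodPaley

variable {d : ℕ}

section

variable {K : Rd d → ℝ} {M l : ℝ} (hK : KernelBound K M l (d + 4)) {L L' : ℝ≥0}
  {φ g : Rd d → ℝ} (hφ : LipschitzWith L φ) (hg : LipschitzWith L' g)
include hK hφ

theorem KernelBound.abs_commutator_weight_diff_le (x y a : Rd d) (ha : l * ‖a‖ ≤ 1) :
    |K (x - (y + a)) * (φ x - φ (y + a)) - K (x - y) * (φ x - φ y)|
      ≤ ‖a‖ * (2 * (M * L) * decayWeight l (d + 3) (x - y)) := by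
  have hl := hK.scale_pos
  have hM := hK.nonneg
  have hw := decayWeight_nonneg hl (d + 4) (x - y)
  have h1 : |K (x - (y + a)) - K (x - y)| ≤ M * (l * ‖a‖) * decayWeight l (d + 4) (x - y) := by
    have := hK.diff_le (x - y) (-a) (by rwa [norm_neg])
    rwa [norm_neg, show x - y + -a = x - (y + a) by abel] at this
  have h2 : |φ x - φ (y + a)| ≤ L * (‖x - y‖ + ‖a‖) := by
    refine (hφ.norm_sub_le x (y + a)).trans ?_
    gcongr
    rw [← sub_sub]
    exact norm_sub_le _ _
  have h3 : |φ y - φ (y + a)| ≤ L * ‖a‖ := by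
    simpa using hφ.norm_sub_le y (y + a)
  have h4 := hK.norm_le (x - y)
  calc |K (x - (y + a)) * (φ x - φ (y + a)) - K (x - y) * (φ x - φ y)|
      = |(K (x - (y + a)) - K (x - y)) * (φ x - φ (y + a))
          + K (x - y) * (φ y - φ (y + a))| := by congr 1; ring
    _ ≤ |K (x - (y + a)) - K (x - y)| * |φ x - φ (y + a)|
          + |K (x - y)| * |φ y - φ (y + a)| := by
        rw [← abs_mul, ← abs_mul]; exact abs_add_le _ _
    _ ≤ M * (l * ‖a‖) * decayWeight l (d + 4) (x - y) * (L * (‖x - y‖ + ‖a‖))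
          + M * decayWeight l (d + 4) (x - y) * (L * ‖a‖) := by gcongr
    _ = ‖a‖ * ((M * L) * decayWeight l (d + 4) (x - y) * (1 + l * ‖x - y‖ + l * ‖a‖)) := by ring
    _ ≤ ‖a‖ * ((M * L) * decayWeight l (d + 4) (x - y) * (2 * (1 + l * ‖x - y‖))) := by
        gcongr
        have : 0 ≤ l * ‖x - y‖ := by positivity
        linarith
    _ = _ := by rw [← decayWeight_succ hl (d + 3)]; ring

theorem KernelBound.abs_commutator_weight_diff_diff_le (x y a e : Rd d) (ha : l * ‖a‖ ≤ 1)
    (he : l * ‖e‖ ≤ 1) :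
    |(K (x + e - (y + a)) * (φ (x + e) - φ (y + a)) - K (x - (y + a)) * (φ x - φ (y + a)))
      - (K (x + e - y) * (φ (x + e) - φ y) - K (x - y) * (φ x - φ y))|
      ≤ ‖a‖ * (4 * (M * L) * (l * ‖e‖) * decayWeight l (d + 3) (x - y)) := by
  have hl := hK.scale_pos
  have hM := hK.nonneg
  set z := x - y with hz
  have hw := decayWeight_nonneg hl (d + 4) z
  have ha' : l * ‖-a‖ ≤ 1 := by rwa [norm_neg]
  rw [show x + e - (y + a) = z + -a + e by rw [hz]; abel,
    show x - (y + a) = z + -a by rw [hz]; abel, show x + e - y = z + e by rw [hz]; abel]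
  have h1 : |K (z + -a + e) - K (z + -a) - (K (z + e) - K z)|
      ≤ M * (l * ‖a‖) * (l * ‖e‖) * decayWeight l (d + 4) z := by
    simpa using hK.diff_diff_le z (-a) e ha' he
  have h2 : |φ x - φ (y + a)| ≤ L * (‖z‖ + ‖a‖) := by
    refine (hφ.norm_sub_le x (y + a)).trans ?_
    gcongr
    rw [← sub_sub]
    exact norm_sub_le _ _
  have h3 : |K (z + e) - K z| ≤ M * (l * ‖e‖) * decayWeight l (d + 4) z := hK.diff_le z e he
  have h4 : |φ y - φ (y + a)| ≤ L * ‖a‖ := by simpa using hφ.norm_sub_le y (y + a)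
  have h5 : |K (z + -a) - K z| ≤ M * (l * ‖a‖) * decayWeight l (d + 4) z := by
    simpa using hK.diff_le z (-a) ha'
  have h6 : |φ (x + e) - φ x| ≤ L * ‖e‖ := by simpa using hφ.norm_sub_le (x + e) x
  have h7 : |K (z + -a + e) - K (z + e)| ≤ M * (l * ‖a‖) * 2 * decayWeight l (d + 4) z := by
    have : K (z + -a + e) - K (z + e)
        = (K (z + -a + e) - K (z + -a) - (K (z + e) - K z)) + (K (z + -a) - K z) := by ring
    rw [this]
    refine (abs_add_le _ _).trans ((add_le_add h1 h5).trans ?_)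
    have : M * (l * ‖a‖) * (l * ‖e‖) * decayWeight l (d + 4) z
        ≤ M * (l * ‖a‖) * 1 * decayWeight l (d + 4) z := by gcongr
    linarith
  calc |(K (z + -a + e) * (φ (x + e) - φ (y + a)) - K (z + -a) * (φ x - φ (y + a)))
      - (K (z + e) * (φ (x + e) - φ y) - K z * (φ x - φ y))|
      = |(K (z + -a + e) - K (z + -a) - (K (z + e) - K z)) * (φ x - φ (y + a))
          + (K (z + e) - K z) * (φ y - φ (y + a))
          + (K (z + -a + e) - K (z + e)) * (φ (x + e) - φ x)| := by congr 1; ring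
    _ ≤ |K (z + -a + e) - K (z + -a) - (K (z + e) - K z)| * |φ x - φ (y + a)|
          + |K (z + e) - K z| * |φ y - φ (y + a)|
          + |K (z + -a + e) - K (z + e)| * |φ (x + e) - φ x| := by
        rw [← abs_mul, ← abs_mul, ← abs_mul]; exact abs_add_three _ _ _
    _ ≤ M * (l * ‖a‖) * (l * ‖e‖) * decayWeight l (d + 4) z * (L * (‖z‖ + ‖a‖))
          + M * (l * ‖e‖) * decayWeight l (d + 4) z * (L * ‖a‖)
          + M * (l * ‖a‖) * 2 * decayWeight l (d + 4) z * (L * ‖e‖) := by gcongr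
    _ = ‖a‖ * ((M * L) * (l * ‖e‖) * decayWeight l (d + 4) z * (l * ‖z‖ + l * ‖a‖ + 3)) := by ring
    _ ≤ ‖a‖ * ((M * L) * (l * ‖e‖) * decayWeight l (d + 4) z * (4 * (1 + l * ‖z‖))) := by
        gcongr
        have : 0 ≤ l * ‖z‖ := by positivity
        linarith
    _ = _ := by rw [← decayWeight_succ hl (d + 3)]; ring

theorem KernelBound.integrable_commutator_weight (x : Rd d) :
    Integrable fun y => K (x - y) * (φ x - φ y) := by
  have h1 := (hK.integrable.comp_sub_left x).mul_const (φ x)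
  have h2 := hK.integrable_smul_of_lipschitz hφ x
  refine (h1.sub h2).congr (Eventually.of_forall fun y => ?_)
  simp only [Pi.sub_apply, smul_eq_mul]
  ring

include hg

theorem KernelBound.integrable_mul_commutator_weight (x : Rd d) :
    Integrable fun y => g y * (K (x - y) * (φ x - φ y)) := by
  obtain ⟨C, hC0, hC⟩ := hg.exists_norm_le_mul_one_add
  obtain ⟨C', hC0', hC'⟩ := (LipschitzWith.const (φ x)).sub hφ |>.exists_norm_le_mul_one_add
  have := hK.integrable_smul (u := fun y => g y * (φ x - φ y)) (C := C * C')
    (hg.continuous.mul (continuous_const.sub hφ.continuous)).aestronglyMeasurable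
    (Eventually.of_forall fun y => ?_) x
  · refine this.congr (Eventually.of_forall fun y => ?_)
    simp only [smul_eq_mul]
    ring
  · rw [norm_mul]
    calc ‖g y‖ * ‖φ x - φ y‖ ≤ (C * (1 + ‖y‖)) * (C' * (1 + ‖y‖)) :=
          mul_le_mul (hC y) (hC' y) (norm_nonneg _) (by positivity)
      _ = _ := by ring

/-- The commutator kernel applied to the gradient of a Lipschitz function: no derivative of `g`
is lost, since the derivatives of `K` are compensated by the increments of `φ`. -/
theorem KernelBound.enorm_commutator_gradient_le (x : Rd d) :
    ‖∫ y, (K (x - y) * (φ x - φ y)) • gradient g y‖ₑ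
      ≤ ENNReal.ofReal (2 * (M * L)) * weightedAverage l g x := by
  have hl := hK.scale_pos
  have hM := hK.nonneg
  refine (enorm_integral_smul_gradient_le hg (hK.integrable_commutator_weight hφ x)
    (hK.integrable_mul_commutator_weight hφ hg x) (inv_pos.2 hl) fun y a ha =>
      hK.abs_commutator_weight_diff_le hφ x y a ?_).trans (le_of_eq ?_)
  · rwa [← le_inv_mul_iff₀ hl, mul_one]
  · rw [weightedAverage, ← lintegral_const_mul' _ _ ENNReal.ofReal_ne_top]
    refine lintegral_congr fun y => ?_
    rw [ENNReal.ofReal_mul (by positivity), mul_assoc]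

theorem KernelBound.enorm_commutator_gradient_sub_le (x e : Rd d) (he : l * ‖e‖ ≤ 1) :
    ‖(∫ y, (K (x + e - y) * (φ (x + e) - φ y)) • gradient g y)
      - ∫ y, (K (x - y) * (φ x - φ y)) • gradient g y‖ₑ
      ≤ ENNReal.ofReal (4 * (M * L) * (l * ‖e‖)) * weightedAverage l g x := by
  have hl := hK.scale_pos
  have hM := hK.nonneg
  have hint : ∀ x, Integrable fun y => (K (x - y) * (φ x - φ y)) • gradient g y := fun x => by
    refine ((hK.integrable_commutator_weight hφ x).norm.mul_const (L' : ℝ)).mono'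
      ((hK.integrable_commutator_weight hφ x).aestronglyMeasurable.smul
      (measurable_gradient g).aestronglyMeasurable) (Eventually.of_forall fun y => ?_)
    rw [norm_smul]
    gcongr
    exact norm_gradient_le hg y
  rw [← integral_sub (hint _) (hint _)]
  simp only [← sub_smul]
  refine (enorm_integral_smul_gradient_le hg ((hK.integrable_commutator_weight hφ (x + e)).sub
    (hK.integrable_commutator_weight hφ x)) ?_ (inv_pos.2 hl) fun y a ha =>
      hK.abs_commutator_weight_diff_diff_le hφ x y a e ?_ he).trans (le_of_eq ?_)
  · refine ((hK.integrable_mul_commutator_weight hφ hg (x + e)).sub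
      (hK.integrable_mul_commutator_weight hφ hg x)).congr (Eventually.of_forall fun y => ?_)
    simp only [Pi.sub_apply]
    ring
  · rwa [← le_inv_mul_iff₀ hl, mul_one]
  · rw [weightedAverage, ← lintegral_const_mul' _ _ ENNReal.ofReal_ne_top]
    refine lintegral_congr fun y => ?_
    rw [ENNReal.ofReal_mul (by positivity), mul_assoc]

end

/-- A map with `‖c x' - c x‖ ≤ l ‖x' - x‖ R` near `x` has derivative bounded by `l R`. -/
theorem enorm_fderiv_le_of_enorm_sub_le {c : Rd d → Rd d} {l : ℝ} (hl : 0 < l) {R : ℝ≥0∞}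
    {x : Rd d} (h : ∀ e, l * ‖e‖ ≤ 1 → ‖c (x + e) - c x‖ₑ ≤ ENNReal.ofReal (l * ‖e‖) * R) :
    ‖fderiv ℝ c x‖ₑ ≤ ENNReal.ofReal l * R := by
  rcases eq_or_ne R ∞ with rfl | hR
  · rw [ENNReal.mul_top (by simpa using hl)]; exact le_top
  have : ‖fderiv ℝ c x‖ ≤ l * R.toReal := by
    refine norm_fderiv_le_of_lip' ℝ (by positivity) ?_
    filter_upwards [Metric.closedBall_mem_nhds x (inv_pos.2 hl)] with x' hx'
    rw [mem_closedBall, dist_eq_norm] at hx'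
    have h1 := h (x' - x) (by
      have := mul_le_mul_of_nonneg_left hx' hl.le
      rwa [mul_inv_cancel₀ hl.ne'] at this)
    rw [add_sub_cancel] at h1
    have h2 := ENNReal.toReal_mono (ENNReal.mul_ne_top ENNReal.ofReal_ne_top hR) h1
    rw [toReal_enorm, ENNReal.toReal_mul, ENNReal.toReal_ofReal (by positivity)] at h2
    linarith
  rw [← ofReal_norm, ← ENNReal.ofReal_toReal hR, ← ENNReal.ofReal_mul hl.le]
  exact ENNReal.ofReal_le_ofReal this

/-- If `c` is the commutator kernel applied to `∇g`, up to the convolution of `K` with a product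
`f b`, then both `c` and `l⁻¹ ∇c` are controlled by `g` and `f`. -/
theorem KernelBound.eLpNorm_le_of_eq_commutator_sub {K : Rd d → ℝ} {M l : ℝ}
    (hK : KernelBound K M l (d + 4)) {L L' L'' B : ℝ≥0} {φ g f : Rd d → ℝ} {b c : Rd d → Rd d}
    (hφ : LipschitzWith L φ) (hg : LipschitzWith L' g) (hf : LipschitzWith L'' f)
    (hb : AEStronglyMeasurable b volume) (hB : ∀ y, ‖b y‖ ≤ B)
    (hc : ∀ x, c x = (∫ y, (K (x - y) * (φ x - φ y)) • gradient g y)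
      - convolve K (fun y => f y • b y) x) {p : ℝ≥0∞} (hp : 1 ≤ p) :
    eLpNorm c p volume ≤ ENNReal.ofReal (4 * (M * weightMass d))
        * (L * eLpNorm g p volume + B * eLpNorm f p volume) ∧
    eLpNorm (fderiv ℝ c) p volume ≤ ENNReal.ofReal (4 * (M * weightMass d)) * (ENNReal.ofReal l
        * (L * eLpNorm g p volume + B * eLpNorm f p volume)) := by
  have hl := hK.scale_pos
  have hM := hK.nonneg
  set R : Rd d → ℝ≥0∞ := fun x =>
    ENNReal.ofReal (4 * M) * (L * weightedAverage l g x + B * weightedAverage l f x) with hR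
  have hgm := measurable_weightedAverage hl hg.continuous.measurable.enorm
  have hfm := measurable_weightedAverage hl hf.continuous.measurable.enorm
  have hRm : Measurable R := ((hgm.const_mul _).add (hfm.const_mul _)).const_mul _
  have hRle : eLpNorm R p volume ≤ ENNReal.ofReal (4 * (M * weightMass d))
      * (L * eLpNorm g p volume + B * eLpNorm f p volume) := by
    rw [hR, eLpNorm_const_mul_ennreal
      (f := fun x => L * weightedAverage l g x + B * weightedAverage l f x)
      ((hgm.const_mul _).add (hfm.const_mul _)) p hp]
    have hadd : eLpNorm (fun x => L * weightedAverage l g x + B * weightedAverage l f x) p volume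
        ≤ eLpNorm (fun x => L * weightedAverage l g x) p volume
          + eLpNorm (fun x => B * weightedAverage l f x) p volume :=
      eLpNorm_add_le (hgm.const_mul _).aestronglyMeasurable
        (hfm.const_mul _).aestronglyMeasurable hp
    rw [eLpNorm_const_mul_ennreal hgm p hp, eLpNorm_const_mul_ennreal hfm p hp] at hadd
    have h1 := eLpNorm_weightedAverage_le hl (u := g) hg.continuous.measurable.enorm hp
    have h2 := eLpNorm_weightedAverage_le hl (u := f) hf.continuous.measurable.enorm hp
    calc _ ≤ ENNReal.ofReal (4 * M) * (L * (ENNReal.ofReal (weightMass d) * eLpNorm g p volume)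
            + B * (ENNReal.ofReal (weightMass d) * eLpNorm f p volume)) := by
          gcongr
          exact hadd.trans (by gcongr)
      _ = _ := by
          rw [← mul_assoc 4, ENNReal.ofReal_mul (by positivity : 0 ≤ 4 * M)]; ring
  have hfb : ∀ x, weightedAverage l (fun y => f y • b y) x ≤ B * weightedAverage l f x := by
    intro x
    rw [weightedAverage, weightedAverage, ← lintegral_const_mul' _ _ ENNReal.coe_ne_top]
    refine lintegral_mono fun y => ?_
    have h1 : ‖b y‖ₑ ≤ B := by
      rw [enorm_le_coe]; exact_mod_cast hB y
    rw [enorm_smul, ← mul_assoc, mul_comm (B : ℝ≥0∞)]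
    gcongr
  have hint : ∀ x, Integrable fun y => K (x - y) • f y • b y := fun x => by
    obtain ⟨C, hC0, hC⟩ := hf.exists_norm_le_mul_one_add
    refine hK.integrable_smul (u := fun y => f y • b y)
      (hf.continuous.aestronglyMeasurable.smul hb) (C := C * B)
      (Eventually.of_forall fun y => ?_) x
    rw [norm_smul]
    calc ‖f y‖ * ‖b y‖ ≤ (C * (1 + ‖y‖)) * B :=
          mul_le_mul (hC y) (hB y) (norm_nonneg _) (by positivity)
      _ ≤ (C * (1 + ‖y‖) ^ 2) * B := by
        gcongr
        exact le_self_pow₀ (by simp) two_ne_zero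
      _ = _ := by ring
  have hsplit : ∀ k : ℝ, 0 ≤ k → ∀ j : ℝ, 0 ≤ j → j ≤ 4 → ∀ x,
      ENNReal.ofReal (j * (M * L) * k) * weightedAverage l g x
        + ENNReal.ofReal (M * k) * weightedAverage l (fun y => f y • b y) x
        ≤ ENNReal.ofReal k * R x := by
    intro k hk j hj hj4 x
    have e1 : ENNReal.ofReal (j * (M * L) * k)
        ≤ ENNReal.ofReal k * (ENNReal.ofReal (4 * M) * L) := by
      rw [← ENNReal.ofReal_coe_nnreal (p := L), ← ENNReal.ofReal_mul (by positivity),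
        ← ENNReal.ofReal_mul hk]
      refine ENNReal.ofReal_le_ofReal ?_
      have : j * (M * L * k) ≤ 4 * (M * L * k) := by gcongr
      linarith
    have e2 : ENNReal.ofReal (M * k) ≤ ENNReal.ofReal k * ENNReal.ofReal (4 * M) := by
      rw [← ENNReal.ofReal_mul hk]
      refine ENNReal.ofReal_le_ofReal ?_
      nlinarith [mul_nonneg hM hk]
    calc _ ≤ ENNReal.ofReal k * (ENNReal.ofReal (4 * M) * L) * weightedAverage l g x
          + ENNReal.ofReal k * ENNReal.ofReal (4 * M) * (B * weightedAverage l f x) := by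
          gcongr
          exact hfb x
      _ = _ := by rw [hR]; ring
  constructor
  · refine le_trans (eLpNorm_mono_enorm fun x => ?_) hRle
    rw [enorm_eq_self, hc x]
    refine (enorm_sub_le).trans ((add_le_add (hK.enorm_commutator_gradient_le hφ hg x)
      (hK.enorm_convolve_le _ x)).trans ?_)
    simpa using hsplit 1 zero_le_one 2 (by norm_num) (by norm_num) x
  · have hle : eLpNorm (fderiv ℝ c) p volume
        ≤ eLpNorm (fun x => ENNReal.ofReal l * R x) p volume := by
      refine eLpNorm_mono_enorm fun x => ?_
      rw [enorm_eq_self]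
      refine enorm_fderiv_le_of_enorm_sub_le hl fun e he => ?_
      rw [hc, hc, sub_sub_sub_comm]
      refine (enorm_sub_le).trans ((add_le_add (hK.enorm_commutator_gradient_sub_le hφ hg x e he)
        (hK.enorm_convolve_sub_le hint (x := x) (x' := x + e) (by simpa using he))).trans ?_)
      rw [add_sub_cancel_left]
      exact hsplit (l * ‖e‖) (by positivity) 4 (by norm_num) le_rfl x
    rw [eLpNorm_const_mul_ennreal hRm p hp] at hle
    refine hle.trans ?_
    rw [mul_left_comm]
    gcongr

end LittlewoodPaley

/-! ### The Littlewood-Paley decomposition of Lipschitz functions -/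

namespace LittlewoodPaley

variable {d : ℕ} {χ : Rd d → ℝ}

theorem IsCutoff.isSymbol (hχ : IsCutoff χ) : IsSymbol χ where
  contDiff := hχ.smooth
  hasCompactSupport :=
    (isCompact_closedBall _ _).of_isClosed_subset (isClosed_tsupport χ) hχ.support_subset
  even ξ := hχ.radial _ _ (norm_neg ξ)

theorem IsCutoff.eq_zero (hχ : IsCutoff χ) {ξ : Rd d} (h : 4 / 3 < ‖ξ‖) : χ ξ = 0 := by
  by_contra h0
  have := hχ.support_subset (subset_tsupport _ h0)
  rw [mem_closedBall_zero_iff] at this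
  linarith

theorem IsCutoff.apply_eq_one (hχ : IsCutoff χ) {ξ : Rd d} (h : ‖ξ‖ < 3 / 4) : χ ξ = 1 :=
  hχ.eq_one.self_of_nhdsSet ξ (by simpa using h)

/-- The symbol `χ(2^{-n}ξ)` of the low frequency cut-off `S_n`. -/
noncomputable def lowPass (χ : Rd d → ℝ) (n : ℤ) (ξ : Rd d) : ℝ := χ (((2 : ℝ) ^ n)⁻¹ • ξ)

theorem IsCutoff.isSymbol_lowPass (hχ : IsCutoff χ) (n : ℤ) : IsSymbol (lowPass χ n) :=
  hχ.isSymbol.comp_smul (inv_ne_zero (zpow_ne_zero n two_ne_zero))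

theorem dyadicSymbol_of_le (χ : Rd d → ℝ) {j : ℤ} (hj : j ≤ -2) :
    dyadicSymbol χ j = fun _ => 0 := by
  ext ξ; simp [dyadicSymbol, hj]

theorem dyadicSymbol_neg_one (χ : Rd d → ℝ) : dyadicSymbol χ (-1) = lowPass χ 0 := by
  ext ξ; simp [dyadicSymbol, lowPass]

theorem dyadicSymbol_of_nonneg (χ : Rd d → ℝ) {j : ℤ} (hj : 0 ≤ j) :
    dyadicSymbol χ j = fun ξ => lowPass χ (j + 1) ξ - lowPass χ j ξ := by
  ext ξ
  have h1 : ¬ j ≤ -2 := by omega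
  have h2 : j ≠ -1 := by omega
  simp only [dyadicSymbol, h1, h2, if_false, lowPass]
  rw [smul_smul, zpow_neg, zpow_add_one₀ two_ne_zero, mul_inv, mul_comm (2 : ℝ)⁻¹]

theorem IsCutoff.isSymbol_dyadicSymbol (hχ : IsCutoff χ) {j : ℤ} (hj : -1 ≤ j) :
    IsSymbol (dyadicSymbol χ j) := by
  rcases eq_or_lt_of_le hj with rfl | hj
  · rw [dyadicSymbol_neg_one]; exact hχ.isSymbol_lowPass 0
  · rw [dyadicSymbol_of_nonneg χ (by omega)]
    exact (hχ.isSymbol_lowPass _).sub (hχ.isSymbol_lowPass _)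

theorem IsCutoff.lowPass_eq_zero (hχ : IsCutoff χ) {n : ℤ} {ξ : Rd d}
    (h : 4 / 3 * (2 : ℝ) ^ n < ‖ξ‖) : lowPass χ n ξ = 0 := by
  refine hχ.eq_zero ?_
  have h2 : (0 : ℝ) < 2 ^ n := by positivity
  rw [norm_smul, norm_inv, Real.norm_of_nonneg h2.le, inv_mul_eq_div, lt_div_iff₀ h2]
  exact h

theorem IsCutoff.dyadicSymbol_eq_zero (hχ : IsCutoff χ) {j : ℤ} (hj : 0 ≤ j) {ξ : Rd d}
    (h : ‖ξ‖ < 3 / 4 * (2 : ℝ) ^ j) : dyadicSymbol χ j ξ = 0 := by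
  have h2 : (0 : ℝ) < 2 ^ j := by positivity
  have h3 : (2 : ℝ) ^ (j + 1) = 2 ^ j * 2 := zpow_add_one₀ two_ne_zero j
  simp only [dyadicSymbol_of_nonneg χ hj, lowPass]
  rw [hχ.apply_eq_one, hχ.apply_eq_one, sub_self]
  · rw [norm_smul, norm_inv, Real.norm_of_nonneg h2.le, inv_mul_eq_div, div_lt_iff₀ h2]
    exact h
  · rw [h3, norm_smul, norm_inv, Real.norm_of_nonneg (by positivity), inv_mul_eq_div,
      div_lt_iff₀ (by positivity)]
    linarith

theorem IsCutoff.lowPass_mul_dyadicSymbol (hχ : IsCutoff χ) {j : ℤ} (hj : 0 ≤ j) (ξ : Rd d) :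
    lowPass χ (j - 1) ξ * dyadicSymbol χ j ξ = 0 := by
  have h2 : (0 : ℝ) < 2 ^ j := by positivity
  have h3 : (2 : ℝ) ^ (j - 1) = 2 ^ j / 2 := by rw [zpow_sub_one₀ two_ne_zero, div_eq_mul_inv]
  by_cases h : ‖ξ‖ < 3 / 4 * (2 : ℝ) ^ j
  · rw [hχ.dyadicSymbol_eq_zero hj h, mul_zero]
  · rw [hχ.lowPass_eq_zero, zero_mul]
    rw [h3]; linarith

theorem zpow_two_sub_two (j : ℤ) : (2 : ℝ) ^ (j - 2) = 2 ^ j / 4 := by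
  rw [zpow_sub₀ two_ne_zero]; norm_num

theorem IsCutoff.dyadicSymbol_mul_lowPass (hχ : IsCutoff χ) {j : ℤ} (hj : 0 ≤ j) (ξ : Rd d) :
    dyadicSymbol χ j ξ * lowPass χ (j - 2) ξ = 0 := by
  have h2 : (0 : ℝ) < 2 ^ j := by positivity
  by_cases h : ‖ξ‖ < 3 / 4 * (2 : ℝ) ^ j
  · rw [hχ.dyadicSymbol_eq_zero hj h, zero_mul]
  · rw [hχ.lowPass_eq_zero, mul_zero]
    rw [zpow_two_sub_two]; linarith

theorem IsCutoff.dyadicSymbol_add_mul_lowPass_mul (hχ : IsCutoff χ) {j : ℤ} (hj : 0 ≤ j)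
    (ξ η : Rd d) :
    dyadicSymbol χ j (ξ + η) * (lowPass χ (j - 2) ξ * lowPass χ (j - 2) η) = 0 := by
  have h2 : (0 : ℝ) < 2 ^ j := by positivity
  by_cases hξ : 4 / 3 * (2 : ℝ) ^ (j - 2) < ‖ξ‖
  · rw [hχ.lowPass_eq_zero hξ, zero_mul, mul_zero]
  by_cases hη : 4 / 3 * (2 : ℝ) ^ (j - 2) < ‖η‖
  · rw [hχ.lowPass_eq_zero hη, mul_zero, mul_zero]
  rw [hχ.dyadicSymbol_eq_zero hj, zero_mul]
  rw [zpow_two_sub_two] at hξ hη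
  linarith [norm_add_le ξ η]

theorem KernelBound.mono {K : Rd d → ℝ} {M M' l : ℝ} {N : ℕ} (h : KernelBound K M l N)
    (hM : M ≤ M') : KernelBound K M' l N where
  nonneg := h.nonneg.trans hM
  scale_pos := h.scale_pos
  continuous := h.continuous
  norm_le z := (h.norm_le z).trans (by have := decayWeight_nonneg h.scale_pos N z; gcongr)
  diff_le z a ha := (h.diff_le z a ha).trans (by
    have := decayWeight_nonneg h.scale_pos N z
    have := h.scale_pos
    gcongr)
  diff_diff_le z a b ha hb := (h.diff_diff_le z a b ha hb).trans (by
    have := decayWeight_nonneg h.scale_pos N z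
    have := h.scale_pos
    gcongr)

/-- Uniform bounds for all kernels of the decomposition. -/
structure LittlewoodPaleyBound (χ : Rd d → ℝ) (M : ℝ) : Prop where
  pos : 0 < M
  kernel_lowPass : ∀ n : ℤ, KernelBound (kernel (lowPass χ n)) M (2 ^ n) (d + 4)
  kernel_block : ∀ j : ℤ, -1 ≤ j → KernelBound (kernel (dyadicSymbol χ j)) M (2 ^ j) (d + 4)

theorem IsCutoff.exists_littlewoodPaleyBound (hχ : IsCutoff χ) :
    ∃ M, LittlewoodPaleyBound χ M := by
  have hhalf := hχ.isSymbol.comp_smul (c := 2⁻¹) (by norm_num)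
  obtain ⟨M₁, h₁⟩ := hχ.isSymbol.exists_kernelBound (d + 4)
  obtain ⟨M₂, h₂⟩ := (hhalf.sub hχ.isSymbol).exists_kernelBound (d + 4)
  obtain ⟨M₃, h₃⟩ := hhalf.exists_kernelBound (d + 4)
  refine ⟨max 1 (max M₁ (max M₂ M₃)), lt_max_of_lt_left one_pos, fun n => ?_, fun j hj => ?_⟩
  · exact (h₁ (2 ^ n) (by positivity)).mono (by simp)
  · rcases eq_or_lt_of_le hj with rfl | hj
    · refine KernelBound.mono (M := M₃) ?_ (by simp)
      have := h₃ (2 ^ (-1 : ℤ)) (by positivity)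
      have e : dyadicSymbol χ (-1) = fun ξ => χ ((2 : ℝ)⁻¹ • ((2 : ℝ) ^ (-1 : ℤ))⁻¹ • ξ) := by
        rw [dyadicSymbol_neg_one]
        ext ξ
        simp [lowPass, smul_smul]
      rwa [e]
    · refine KernelBound.mono (M := M₂) ?_ (by simp)
      have := h₂ (2 ^ j) (by positivity)
      have e : dyadicSymbol χ j = fun ξ => χ ((2 : ℝ)⁻¹ • ((2 : ℝ) ^ j)⁻¹ • ξ)
          - χ (((2 : ℝ) ^ j)⁻¹ • ξ) := by
        have h1 : ¬ j ≤ -2 := by omega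
        have h2 : j ≠ -1 := by omega
        ext ξ
        simp only [dyadicSymbol, h1, h2, if_false, zpow_neg]
      rwa [e]

theorem dyadicBlock_eq_convolve {F : Type*} [NormedAddCommGroup F] [NormedSpace ℝ F]
    (χ : Rd d → ℝ) (j : ℤ) (u : Rd d → F) :
    dyadicBlock χ j u = convolve (kernel (dyadicSymbol χ j)) u := rfl

theorem dyadicBlock_of_le {F : Type*} [NormedAddCommGroup F] [NormedSpace ℝ F]
    (χ : Rd d → ℝ) {j : ℤ} (hj : j ≤ -2) (u : Rd d → F) : dyadicBlock χ j u = 0 := by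
  ext x
  simp [dyadicBlock_eq_convolve, dyadicSymbol_of_le χ hj, convolve, kernel_zero]

theorem LittlewoodPaleyBound.continuous_dyadicBlock {M : ℝ} (hM : LittlewoodPaleyBound χ M)
    {L : ℝ≥0} {u : Rd d → ℝ} (hu : LipschitzWith L u) (j : ℤ) :
    Continuous (dyadicBlock χ j u) := by
  rcases le_or_gt j (-2) with hj | hj
  · rw [dyadicBlock_of_le χ hj]; exact continuous_zero
  · exact ((hM.kernel_block j (by omega)).lipschitzWith_convolve hu).continuous

theorem LittlewoodPaleyBound.gradient_dyadicBlock {M : ℝ} (hM : LittlewoodPaleyBound χ M)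
    {L : ℝ≥0} {u : Rd d → ℝ} (hu : LipschitzWith L u) {j : ℤ} (hj : -1 ≤ j) :
    gradient (dyadicBlock χ j u) = dyadicBlock χ j (gradient u) :=
  funext fun x => ((hM.kernel_block j hj).hasGradientAt_convolve hu x).gradient

theorem IsCutoff.integral_kernel_lowPass (hχ : IsCutoff χ) (n : ℤ) :
    ∫ z, kernel (lowPass χ n) z = 1 := by
  rw [(hχ.isSymbol_lowPass n).integral_kernel, lowPass, smul_zero, hχ.apply_eq_one (by simp)]

section

variable {M : ℝ} (hχ : IsCutoff χ) (hM : LittlewoodPaleyBound χ M)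
include hχ hM

theorem tendsto_convolve_lowPass {L : ℝ≥0} {u : Rd d → ℝ} (hu : LipschitzWith L u) (x : Rd d)
    (m : ℤ) : Tendsto (fun n : ℕ => convolve (kernel (lowPass χ (m + n))) u x) atTop (𝓝 (u x)) := by
  rw [tendsto_iff_norm_sub_tendsto_zero]
  refine squeeze_zero (fun _ => norm_nonneg _)
    (fun n => (hM.kernel_lowPass (m + n)).norm_convolve_sub_le
      (hχ.integral_kernel_lowPass _) hu x) ?_
  have h1 : Tendsto (fun n : ℕ => ((1 : ℝ) / 2) ^ n) atTop (𝓝 0) :=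
    tendsto_pow_atTop_nhds_zero_of_lt_one (by norm_num) (by norm_num)
  have h2 := h1.const_mul (M / 2 ^ m * weightMass d * L)
  rw [mul_zero] at h2
  refine h2.congr fun n => ?_
  rw [zpow_add₀ two_ne_zero, zpow_natCast, one_div, inv_pow]
  field_simp

theorem convolve_lowPass_succ {L : ℝ≥0} {u : Rd d → ℝ} (hu : LipschitzWith L u) (x : Rd d)
    {j : ℤ} (hj : 0 ≤ j) : convolve (kernel (lowPass χ (j + 1))) u x
      - convolve (kernel (lowPass χ j)) u x = dyadicBlock χ j u x := by
  rw [dyadicBlock_eq_convolve]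
  unfold convolve
  rw [← integral_sub ((hM.kernel_lowPass _).integrable_smul_of_lipschitz hu x)
    ((hM.kernel_lowPass _).integrable_smul_of_lipschitz hu x)]
  refine integral_congr_ae (Eventually.of_forall fun y => ?_)
  simp only [dyadicSymbol_of_nonneg χ hj]
  rw [kernel_sub (hχ.isSymbol_lowPass _) (hχ.isSymbol_lowPass _), sub_smul]

/-- The high frequency part is bounded by the sum of the dyadic blocks. As `u` is only Lipschitz,
the telescoping sum converges pointwise, and Fatou's lemma gives the bound. -/
theorem eLpNorm_sub_convolve_lowPass_le {L : ℝ≥0} {u : Rd d → ℝ} (hu : LipschitzWith L u)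
    {m : ℤ} (hm : 0 ≤ m) {p : ℝ≥0∞} (hp : 1 ≤ p) :
    eLpNorm (fun x => u x - convolve (kernel (lowPass χ m)) u x) p volume
      ≤ ∑' i : ℕ, eLpNorm (dyadicBlock χ (m + i) u) p volume := by
  have hsum : ∀ n : ℕ, ∀ x, ∑ i ∈ Finset.range n, dyadicBlock χ (m + i) u x
      = convolve (kernel (lowPass χ (m + n))) u x - convolve (kernel (lowPass χ m)) u x := by
    intro n x
    induction n with
    | zero => simp
    | succ n ih =>
      rw [Finset.sum_range_succ, ih, ← convolve_lowPass_succ hχ hM hu x (by omega), Nat.cast_succ,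
        ← add_assoc]
      ring
  have hc := hM.continuous_dyadicBlock hu
  refine (Lp.eLpNorm_lim_le_liminf_eLpNorm
    (f := fun n x => ∑ i ∈ Finset.range n, dyadicBlock χ (m + i) u x)
    (fun n => (continuous_finsetSum _ fun i _ => hc _).aestronglyMeasurable) _
    (Eventually.of_forall fun x => ?_)).trans ?_
  · simp only [hsum]
    exact (tendsto_convolve_lowPass hχ hM hu x m).sub_const _
  · refine (liminf_le_liminf (v := fun _ => ∑' i : ℕ, eLpNorm (dyadicBlock χ (m + i) u) p volume)
      (Eventually.of_forall fun n => ?_)).trans (by simp)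
    have := eLpNorm_sum_le (p := p) (μ := (volume : Measure (Rd d))) (s := Finset.range n)
      (f := fun i : ℕ => dyadicBlock χ (m + i) u) (fun i _ => (hc _).aestronglyMeasurable) hp
    refine le_trans (le_of_eq ?_) (this.trans (ENNReal.sum_le_tsum _))
    congr 1
    ext x
    simp

theorem eLpNorm_le_tsum_dyadicBlock {L : ℝ≥0} {u : Rd d → ℝ} (hu : LipschitzWith L u)
    {j : ℤ} (hj : j ≤ 1) {p : ℝ≥0∞} (hp : 1 ≤ p) :
    eLpNorm u p volume ≤ ∑' i : ℕ, eLpNorm (dyadicBlock χ (j - 2 + i) u) p volume := by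
  have hc := hM.continuous_dyadicBlock hu
  have h0 : (fun x => convolve (kernel (lowPass χ 0)) u x) = dyadicBlock χ (-1) u := by
    rw [dyadicBlock_eq_convolve, dyadicSymbol_neg_one]
  have h1 : eLpNorm u p volume ≤ ∑' i : ℕ, eLpNorm (dyadicBlock χ (-1 + i) u) p volume := by
    have hdec : u = dyadicBlock χ (-1) u
        + fun x => u x - convolve (kernel (lowPass χ 0)) u x := by
      ext x
      simp [← h0]
    calc eLpNorm u p volume ≤ eLpNorm (dyadicBlock χ (-1) u) p volume
          + eLpNorm (fun x => u x - convolve (kernel (lowPass χ 0)) u x) p volume := by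
          conv_lhs => rw [hdec]
          refine eLpNorm_add_le (hc _).aestronglyMeasurable ?_ hp
          refine (hu.continuous.sub ?_).aestronglyMeasurable
          exact ((hM.kernel_lowPass 0).lipschitzWith_convolve hu).continuous
      _ ≤ eLpNorm (dyadicBlock χ (-1) u) p volume
          + ∑' i : ℕ, eLpNorm (dyadicBlock χ (0 + i) u) p volume := by
          gcongr
          exact eLpNorm_sub_convolve_lowPass_le hχ hM hu le_rfl hp
      _ = _ := by
          rw [tsum_eq_zero_add' (f := fun i : ℕ => eLpNorm (dyadicBlock χ (-1 + i) u) p volume)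
            ENNReal.summable]
          simp
  obtain ⟨n, hn⟩ := Int.eq_ofNat_of_zero_le (show 0 ≤ 1 - j by omega)
  refine h1.trans (le_trans (le_of_eq (tsum_congr fun i => ?_))
    (ENNReal.tsum_comp_le_tsum_of_injective (add_left_injective n)
      (fun i : ℕ => eLpNorm (dyadicBlock χ (j - 2 + i) u) p volume)))
  congr 2
  omega

/-- A Lipschitz function has a Lipschitz constant comparable to the sup norm of its gradient. The
low frequency cut-offs turn the almost everywhere bound into one at every point. -/
theorem lipschitzWith_of_ae_norm_gradient_le {L X : ℝ≥0} {u : Rd d → ℝ} (hu : LipschitzWith L u)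
    (hX : ∀ᵐ y, ‖gradient u y‖ ≤ X) :
    LipschitzWith (Real.toNNReal (M * weightMass d) * X) u := by
  have h0 : 0 ≤ M * weightMass d := mul_nonneg hM.pos.le (weightMass_nonneg d)
  have hn : ∀ n : ℕ, LipschitzWith (Real.toNNReal (M * weightMass d) * X)
      (convolve (kernel (lowPass χ (0 + n))) u) := fun n => by
    have hgrad := fun x => (hM.kernel_lowPass (0 + n)).hasGradientAt_convolve hu x
    refine lipschitzWith_of_nnnorm_fderiv_le (𝕜 := ℝ)
      (fun x => (hgrad x).differentiableAt) fun x => ?_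
    rw [(hgrad x).hasFDerivAt.fderiv, ← NNReal.coe_le_coe, coe_nnnorm, LinearIsometryEquiv.norm_map,
      NNReal.coe_mul, Real.coe_toNNReal _ h0]
    exact (hM.kernel_lowPass (0 + n)).norm_convolve_le X.coe_nonneg hX x
  refine LipschitzWith.of_dist_le_mul fun x y => ?_
  exact le_of_tendsto ((tendsto_convolve_lowPass hχ hM hu x 0).dist
    (tendsto_convolve_lowPass hχ hM hu y 0)) (Eventually.of_forall fun n => (hn n).dist_le_mul x y)

/-- Dyadic blocks of nonnegative index gain one power of the frequency over those of the
gradient. -/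
theorem eLpNorm_dyadicBlock_le {L : ℝ≥0} {u : Rd d → ℝ} (hu : LipschitzWith L u) {j : ℤ}
    (hj : 0 ≤ j) {p : ℝ≥0∞} (hp : 1 ≤ p) :
    eLpNorm (dyadicBlock χ j u) p volume ≤ ENNReal.ofReal (2 * (M * weightMass d))
      * (ENNReal.ofReal (2 ^ (-j)) * eLpNorm (dyadicBlock χ j (gradient u)) p volume) := by
  have hb := hM.kernel_block j (by omega)
  obtain ⟨C, -, hC⟩ := hu.exists_norm_le_mul_one_add
  have := (hM.kernel_lowPass (j - 1)).eLpNorm_le_gradient (hχ.integral_kernel_lowPass _)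
    (hb.lipschitzWith_convolve hu) (fun x => (hb.hasGradientAt_convolve hu x).differentiableAt)
    (fun x => convolve_convolve_eq_zero (hχ.isSymbol_lowPass _)
      (hχ.isSymbol_dyadicSymbol (by omega)) (hM.kernel_lowPass _) hb
      (hχ.lowPass_mul_dyadicSymbol hj)
      hu.continuous.aestronglyMeasurable (Eventually.of_forall hC) x) hp
  rw [← dyadicBlock_eq_convolve, hM.gradient_dyadicBlock hu (by omega)] at this
  refine this.trans (le_of_eq ?_)
  have h0 : 0 ≤ M * weightMass d := mul_nonneg hM.pos.le (weightMass_nonneg d)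
  rw [← mul_assoc, ← ENNReal.ofReal_mul (by positivity)]
  congr 2
  rw [zpow_sub_one₀ two_ne_zero, zpow_neg]
  field_simp

end

end LittlewoodPaley

/-! ### The commutator estimate at a fixed time -/

namespace LittlewoodPaley

variable {d : ℕ} {χ : Rd d → ℝ}

theorem eLpNorm_gradient_top_ne_top {L : ℝ≥0} {u : Rd d → ℝ} (hu : LipschitzWith L u) :
    eLpNorm (gradient u) ∞ volume ≠ ⊤ := by
  rw [eLpNorm_exponent_top]
  refine ne_top_of_le_ne_top ENNReal.coe_ne_top (eLpNormEssSup_le_of_ae_nnnorm_bound (C := L)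
    (Eventually.of_forall fun x => ?_))
  exact_mod_cast norm_gradient_le hu x

theorem ae_norm_gradient_le {L : ℝ≥0} {u : Rd d → ℝ} (hu : LipschitzWith L u) :
    ∀ᵐ y, ‖gradient u y‖ ≤ (eLpNorm (gradient u) ∞ volume).toNNReal := by
  filter_upwards [ae_le_eLpNormEssSup (f := gradient u) (μ := volume)] with y hy
  rw [← eLpNorm_exponent_top, ← ENNReal.coe_toNNReal (eLpNorm_gradient_top_ne_top hu),
    enorm_le_coe] at hy
  exact_mod_cast hy

theorem LittlewoodPaleyBound.commutator_eq {M : ℝ} (hM : LittlewoodPaleyBound χ M) {j : ℤ}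
    (hj : -1 ≤ j) {L : ℝ≥0} {φ : Rd d → ℝ} (hφ : LipschitzWith L φ) {u : Rd d → Rd d}
    (hu : AEStronglyMeasurable u volume) {C : ℝ} (hC0 : 0 ≤ C) (hC : ∀ᵐ y, ‖u y‖ ≤ C) (x : Rd d) :
    (Integrable fun y => (kernel (dyadicSymbol χ j) (x - y) * (φ x - φ y)) • u y) ∧
    commutator χ φ j u x
      = ∫ y, (kernel (dyadicSymbol χ j) (x - y) * (φ x - φ y)) • u y := by
  have hK := hM.kernel_block j hj
  have i1 : Integrable fun y => φ x • kernel (dyadicSymbol χ j) (x - y) • u y :=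
    (hK.integrable_smul_of_norm_le hu hC x).smul (φ x)
  have i2 : Integrable fun y => kernel (dyadicSymbol χ j) (x - y) • φ y • u y := by
    obtain ⟨C', hC0', hC'⟩ := hφ.exists_norm_le_mul_one_add
    refine hK.integrable_smul (u := fun y => φ y • u y)
      (hφ.continuous.aestronglyMeasurable.smul hu) (C := C' * C) ?_ x
    filter_upwards [hC] with y hy
    rw [norm_smul]
    calc ‖φ y‖ * ‖u y‖ ≤ (C' * (1 + ‖y‖)) * C :=
          mul_le_mul (hC' y) hy (norm_nonneg _) (by positivity)
      _ ≤ (C' * (1 + ‖y‖) ^ 2) * C := by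
        gcongr
        exact le_self_pow₀ (by simp) two_ne_zero
      _ = _ := by ring
  have e : (fun y => (kernel (dyadicSymbol χ j) (x - y) * (φ x - φ y)) • u y)
      = fun y => φ x • kernel (dyadicSymbol χ j) (x - y) • u y
        - kernel (dyadicSymbol χ j) (x - y) • φ y • u y := by
    ext1 y
    module
  rw [e]
  refine ⟨i1.sub i2, ?_⟩
  rw [integral_sub i1 i2, integral_smul]
  rfl

theorem commutator_of_le (χ φ : Rd d → ℝ) {j : ℤ} (hj : j ≤ -2) (u : Rd d → Rd d) :
    commutator χ φ j u = 0 := by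
  ext1 x
  simp [commutator, dyadicBlock_of_le χ hj]

/-- The contribution of the frequencies of size `2^k` to the commutator estimate. -/
noncomputable def blockBound (χ : Rd d → ℝ) (p : ℝ≥0∞) (φ ψ : Rd d → ℝ) (k : ℤ) : ℝ≥0∞ :=
  eLpNorm (gradient φ) ∞ volume * eLpNorm (dyadicBlock χ k ψ) p volume
    + ENNReal.ofReal (2 ^ (-k)) * (eLpNorm (dyadicBlock χ k (gradient φ)) p volume
      * eLpNorm (gradient ψ) ∞ volume)

/-- For `j ≥ 0`, removing from `φ` and `ψ` their frequencies below `2^{j-2}` does not change the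
commutator with `Δ_j`, except for one term where `Δ_j` acts on a product. -/
theorem LittlewoodPaleyBound.commutator_eq_sub {M : ℝ} (hχ : IsCutoff χ)
    (hM : LittlewoodPaleyBound χ M) {j : ℤ} (hj : 0 ≤ j) {L L' : ℝ≥0} {φ ψ : Rd d → ℝ}
    (hφ : LipschitzWith L φ) (hψ : LipschitzWith L' ψ) (x : Rd d) :
    commutator χ φ j (gradient ψ) x
      = (∫ y, (kernel (dyadicSymbol χ j) (x - y) * (φ x - φ y)) •
          gradient (fun y => ψ y - convolve (kernel (lowPass χ (j - 2))) ψ y) y)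
        - convolve (kernel (dyadicSymbol χ j)) (fun y =>
          (φ y - convolve (kernel (lowPass χ (j - 2))) φ y)
            • convolve (kernel (lowPass χ (j - 2))) (gradient ψ) y) x := by
  have hj1 : -1 ≤ j := by omega
  have hK := hM.kernel_block j hj1
  have hH := hM.kernel_lowPass (j - 2)
  set K := kernel (dyadicSymbol χ j) with hKdef
  set H := kernel (lowPass χ (j - 2)) with hHdef
  set κ := M * weightMass d with hκ
  have hκ0 : 0 ≤ κ := mul_nonneg hM.pos.le (weightMass_nonneg d)
  set b := convolve H (gradient ψ) with hb
  have hgm : AEStronglyMeasurable (gradient ψ) volume :=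
    (measurable_gradient ψ).aestronglyMeasurable
  have hgb : ∀ᵐ y, ‖gradient ψ y‖ ≤ L' := Eventually.of_forall (norm_gradient_le hψ)
  have hSψ := hH.lipschitzWith_convolve hψ
  have hSφ := hH.lipschitzWith_convolve hφ
  have hbgrad : b = gradient (convolve H ψ) :=
    funext fun y => (hH.hasGradientAt_convolve hψ y).gradient.symm
  have hbm : AEStronglyMeasurable b volume := by
    rw [hbgrad]; exact (measurable_gradient _).aestronglyMeasurable
  have hbB : ∀ᵐ y, ‖b y‖ ≤ κ * L' :=
    Eventually.of_forall (hH.norm_convolve_le L'.coe_nonneg hgb)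
  have hκL : 0 ≤ κ * L' := by positivity
  set g := fun y => ψ y - convolve H ψ y with hg
  have hgL : LipschitzWith _ g := hψ.sub hSψ
  have hgg : AEStronglyMeasurable (gradient g) volume :=
    (measurable_gradient g).aestronglyMeasurable
  have hae : gradient ψ =ᵐ[volume] fun y => gradient g y + b y := by
    filter_upwards [hψ.ae_differentiableAt] with y hy
    have h1 := hy.hasGradientAt
    have h2 := hH.hasGradientAt_convolve hψ y
    have h3 : HasGradientAt g (gradient ψ y - b y) y := by
      rw [hasGradientAt_iff_hasFDerivAt] at h1 h2 ⊢
      rw [map_sub]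
      exact h1.sub h2
    rw [h3.gradient, sub_add_cancel]
  have hg1 := hM.commutator_eq hj1 hφ hgg (NNReal.coe_nonneg _)
    (Eventually.of_forall (norm_gradient_le hgL)) x
  have hb1 := hM.commutator_eq hj1 hφ hbm hκL hbB x
  have e1 : commutator χ φ j (gradient ψ) x
      = (∫ y, (K (x - y) * (φ x - φ y)) • gradient g y) + commutator χ φ j b x := by
    rw [(hM.commutator_eq hj1 hφ hgm L'.coe_nonneg hgb x).2, hb1.2, ← integral_add hg1.1 hb1.1]
    refine integral_congr_ae ?_
    filter_upwards [hae] with y hy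
    rw [hy, smul_add]
  -- both `Δ_j b` and `Δ_j (S φ b)` vanish
  have v1 : convolve K b x = 0 :=
    convolve_convolve_eq_zero (hχ.isSymbol_dyadicSymbol hj1) (hχ.isSymbol_lowPass _) hK hH
      (hχ.dyadicSymbol_mul_lowPass hj) hgm (C := L')
      (hgb.mono fun y hy => hy.trans (le_mul_of_one_le_right L'.coe_nonneg (by simp))) x
  have v2 : convolve K (fun y => convolve H φ y • b y) x = 0 :=
    convolve_mul_convolve_eq_zero (hχ.isSymbol_dyadicSymbol hj1) (hχ.isSymbol_lowPass _) hK hH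
      (hχ.dyadicSymbol_add_mul_lowPass_mul hj) hφ hgm L'.coe_nonneg hgb x
  have i1 : ∀ {C : ℝ≥0} {f : Rd d → ℝ}, LipschitzWith C f →
      Integrable fun y => K (x - y) • f y • b y := by
    intro C f hf
    obtain ⟨C', hC0', hC'⟩ := hf.exists_norm_le_mul_one_add
    refine hK.integrable_smul (u := fun y => f y • b y)
      (hf.continuous.aestronglyMeasurable.smul hbm) (C := C' * (κ * L')) ?_ x
    filter_upwards [hbB] with y hy
    rw [norm_smul]
    calc ‖f y‖ * ‖b y‖ ≤ (C' * (1 + ‖y‖)) * (κ * L') :=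
          mul_le_mul (hC' y) hy (norm_nonneg _) (by positivity)
      _ ≤ (C' * (1 + ‖y‖) ^ 2) * (κ * L') := by
        gcongr
        exact le_self_pow₀ (by simp) two_ne_zero
      _ = _ := by ring
  have e2 : commutator χ φ j b x
      = - convolve K (fun y => (φ y - convolve H φ y) • b y) x := by
    have e3 : commutator χ φ j b x = φ x • convolve K b x - convolve K (fun y => φ y • b y) x := rfl
    have e4 : convolve K (fun y => φ y • b y) x
        = convolve K (fun y => (φ y - convolve H φ y) • b y) x
          + convolve K (fun y => convolve H φ y • b y) x := by
      refine Eq.trans ?_ (integral_add (i1 (hφ.sub hSφ)) (i1 hSφ))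
      refine integral_congr_ae (Eventually.of_forall fun y => ?_)
      change K (x - y) • φ y • b y = K (x - y) • (φ y - convolve H φ y) • b y
        + K (x - y) • convolve H φ y • b y
      module
    rw [e3, e4, v1, v2]
    simp
  rw [e1, e2, sub_eq_add_neg]

/-- The commutator with `Δ_j`, and `2^{-j}` times its gradient, are controlled by the blocks of
index at least `j - 2`. -/
theorem exists_eLpNorm_commutator_le (hχ : IsCutoff χ) {p : ℝ≥0∞} (hp : 1 ≤ p) :
    ∃ C : ℝ, 0 < C ∧ ∀ (φ ψ : Rd d → ℝ) (L L' : ℝ≥0), LipschitzWith L φ → LipschitzWith L' ψ →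
      ∀ j : ℤ,
      eLpNorm (commutator χ φ j (gradient ψ)) p volume
        ≤ ENNReal.ofReal C * ∑' i : ℕ, blockBound χ p φ ψ (j - 2 + i) ∧
      eLpNorm (fderiv ℝ (commutator χ φ j (gradient ψ))) p volume
        ≤ ENNReal.ofReal C * (ENNReal.ofReal (2 ^ j)
          * ∑' i : ℕ, blockBound χ p φ ψ (j - 2 + i)) := by
  obtain ⟨M, hM⟩ := hχ.exists_littlewoodPaleyBound
  set κ := M * weightMass d with hκ
  have hκ0 : 0 ≤ κ := mul_nonneg hM.pos.le (weightMass_nonneg d)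
  refine ⟨4 * κ * (κ * (1 + 2 * κ)) + 1, by positivity, fun φ ψ L L' hφ hψ j => ?_⟩
  rcases le_or_gt j (-2) with hj2 | hj2
  · rw [commutator_of_le χ φ hj2]
    constructor
    · simp
    · refine (eLpNorm_mono_enorm (g := fun _ => (0 : ℝ)) fun x => ?_).trans (by simp)
      exact (enorm_fderiv_le_of_enorm_sub_le one_pos (R := 0) fun e _ => by simp).trans (by simp)
  have hj1 : -1 ≤ j := by omega
  set X := (eLpNorm (gradient φ) ∞ volume).toNNReal with hX
  set Y := (eLpNorm (gradient ψ) ∞ volume).toNNReal with hY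
  have hXe : (X : ℝ≥0∞) = eLpNorm (gradient φ) ∞ volume :=
    ENNReal.coe_toNNReal (eLpNorm_gradient_top_ne_top hφ)
  have hYe : (Y : ℝ≥0∞) = eLpNorm (gradient ψ) ∞ volume :=
    ENNReal.coe_toNNReal (eLpNorm_gradient_top_ne_top hψ)
  have hφX := lipschitzWith_of_ae_norm_gradient_le hχ hM hφ (ae_norm_gradient_le hφ)
  rw [← hκ, ← hX] at hφX
  have hcoe : ((Real.toNNReal κ : ℝ≥0) : ℝ≥0∞) = ENNReal.ofReal κ := rfl
  -- it suffices to bound the two halves of the commutator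
  suffices h : ∃ A : ℝ≥0∞, A ≤ ENNReal.ofReal (κ * (1 + 2 * κ))
      * ∑' i : ℕ, blockBound χ p φ ψ (j - 2 + i) ∧
      eLpNorm (commutator χ φ j (gradient ψ)) p volume ≤ ENNReal.ofReal (4 * κ) * A ∧
      eLpNorm (fderiv ℝ (commutator χ φ j (gradient ψ))) p volume
        ≤ ENNReal.ofReal (4 * κ) * (ENNReal.ofReal (2 ^ j) * A) by
    obtain ⟨A, hA, h1, h2⟩ := h
    have hC : ENNReal.ofReal (4 * κ) * ENNReal.ofReal (κ * (1 + 2 * κ))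
        ≤ ENNReal.ofReal (4 * κ * (κ * (1 + 2 * κ)) + 1) := by
      rw [← ENNReal.ofReal_mul (by positivity)]
      exact ENNReal.ofReal_le_ofReal (by linarith)
    constructor
    · refine h1.trans ?_
      calc _ ≤ ENNReal.ofReal (4 * κ) * (ENNReal.ofReal (κ * (1 + 2 * κ))
            * ∑' i : ℕ, blockBound χ p φ ψ (j - 2 + i)) := by gcongr
        _ = ENNReal.ofReal (4 * κ) * ENNReal.ofReal (κ * (1 + 2 * κ))
            * ∑' i : ℕ, blockBound χ p φ ψ (j - 2 + i) := by ring
        _ ≤ _ := by gcongr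
    · refine h2.trans ?_
      calc _ ≤ ENNReal.ofReal (4 * κ) * (ENNReal.ofReal (2 ^ j)
            * (ENNReal.ofReal (κ * (1 + 2 * κ))
            * ∑' i : ℕ, blockBound χ p φ ψ (j - 2 + i))) := by gcongr
        _ = ENNReal.ofReal (4 * κ) * ENNReal.ofReal (κ * (1 + 2 * κ)) * (ENNReal.ofReal (2 ^ j)
            * ∑' i : ℕ, blockBound χ p φ ψ (j - 2 + i)) := by ring
        _ ≤ _ := by gcongr
  have hsum1 : X * ∑' i : ℕ, eLpNorm (dyadicBlock χ (j - 2 + i) ψ) p volume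
      ≤ ∑' i : ℕ, blockBound χ p φ ψ (j - 2 + i) := by
    rw [← ENNReal.tsum_mul_left]
    refine ENNReal.tsum_le_tsum fun i => ?_
    rw [hXe]
    exact le_self_add
  rcases lt_or_ge j 2 with hj | hj
  · -- no low frequencies to remove
    refine ⟨ENNReal.ofReal κ * X * eLpNorm ψ p volume, ?_, ?_⟩
    · calc ENNReal.ofReal κ * X * eLpNorm ψ p volume
          ≤ ENNReal.ofReal κ
            * (X * ∑' i : ℕ, eLpNorm (dyadicBlock χ (j - 2 + i) ψ) p volume) := by
            rw [mul_assoc]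
            gcongr
            exact eLpNorm_le_tsum_dyadicBlock hχ hM hψ (by omega) hp
        _ ≤ _ := by
            gcongr
            nlinarith
    · have := (hM.kernel_block j hj1).eLpNorm_le_of_eq_commutator_sub (L'' := 0) (B := 0) (b := 0)
        (f := fun _ => 0) (c := commutator χ φ j (gradient ψ)) hφX hψ (LipschitzWith.const 0)
        aestronglyMeasurable_zero (by simp) (fun x => ?_) hp
      · simpa only [← hκ, ENNReal.coe_zero, zero_mul, add_zero, ENNReal.coe_mul, hcoe] using this
      · rw [(hM.commutator_eq hj1 hφ (measurable_gradient ψ).aestronglyMeasurable L'.coe_nonneg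
          (Eventually.of_forall (norm_gradient_le hψ)) x).2]
        simp [convolve]
  · have hH := hM.kernel_lowPass (j - 2)
    set H := kernel (lowPass χ (j - 2)) with hHdef
    set g := fun y => ψ y - convolve H ψ y with hg
    set f := fun y => φ y - convolve H φ y with hf
    have hB : ∀ y, ‖convolve H (gradient ψ) y‖ ≤ (Real.toNNReal κ * Y : ℝ≥0) := fun y => by
      rw [NNReal.coe_mul, Real.coe_toNNReal _ hκ0]
      exact hH.norm_convolve_le Y.coe_nonneg (ae_norm_gradient_le hψ) y
    have hbm : AEStronglyMeasurable (convolve H (gradient ψ)) volume := by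
      have : convolve H (gradient ψ) = gradient (convolve H ψ) :=
        funext fun y => (hH.hasGradientAt_convolve hψ y).gradient.symm
      rw [this]; exact (measurable_gradient _).aestronglyMeasurable
    refine ⟨ENNReal.ofReal κ * X * eLpNorm g p volume
      + ENNReal.ofReal κ * Y * eLpNorm f p volume, ?_, ?_⟩
    · have hgle := eLpNorm_sub_convolve_lowPass_le hχ hM hψ (show 0 ≤ j - 2 by omega) hp
      have hfle := eLpNorm_sub_convolve_lowPass_le hχ hM hφ (show 0 ≤ j - 2 by omega) hp
      have hfle' : Y * eLpNorm f p volume ≤ ENNReal.ofReal (2 * κ)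
          * ∑' i : ℕ, ENNReal.ofReal (2 ^ (-(j - 2 + i)))
            * (eLpNorm (dyadicBlock χ (j - 2 + i) (gradient φ)) p volume * Y) := by
        calc Y * eLpNorm f p volume
            ≤ Y * ∑' i : ℕ, ENNReal.ofReal (2 * κ) * (ENNReal.ofReal (2 ^ (-(j - 2 + i)))
              * eLpNorm (dyadicBlock χ (j - 2 + i) (gradient φ)) p volume) := by
              gcongr
              exact hfle.trans (ENNReal.tsum_le_tsum fun i =>
                eLpNorm_dyadicBlock_le hχ hM hφ (by omega) hp)
          _ = _ := by
              rw [← ENNReal.tsum_mul_left, ← ENNReal.tsum_mul_left]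
              refine tsum_congr fun i => ?_
              ring
      have h2κ : ENNReal.ofReal (κ * (1 + 2 * κ))
          = ENNReal.ofReal κ * (1 + ENNReal.ofReal (2 * κ)) := by
        rw [ENNReal.ofReal_mul hκ0, ENNReal.ofReal_add zero_le_one (by positivity),
          ENNReal.ofReal_one]
      have hle1 : X * ∑' i : ℕ, eLpNorm (dyadicBlock χ (j - 2 + i) ψ) p volume
          ≤ (1 + ENNReal.ofReal (2 * κ))
            * ∑' i : ℕ, X * eLpNorm (dyadicBlock χ (j - 2 + i) ψ) p volume := by
        rw [← ENNReal.tsum_mul_left, add_mul, one_mul]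
        exact le_self_add
      calc _ = ENNReal.ofReal κ * (X * eLpNorm g p volume + Y * eLpNorm f p volume) := by ring
        _ ≤ ENNReal.ofReal κ * ((1 + ENNReal.ofReal (2 * κ))
            * ∑' i : ℕ, X * eLpNorm (dyadicBlock χ (j - 2 + i) ψ) p volume
            + (1 + ENNReal.ofReal (2 * κ)) * ∑' i : ℕ, ENNReal.ofReal (2 ^ (-(j - 2 + i)))
            * (eLpNorm (dyadicBlock χ (j - 2 + i) (gradient φ)) p volume * Y)) := by
            refine mul_le_mul_right (add_le_add ((mul_le_mul_right hgle _).trans hle1)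
              (hfle'.trans (mul_le_mul_left le_add_self _))) _
        _ = _ := by
            rw [h2κ, ← mul_add, ← ENNReal.tsum_add, mul_assoc, hXe, hYe]
            rfl
    · have := (hM.kernel_block j hj1).eLpNorm_le_of_eq_commutator_sub (f := f) (g := g)
        (b := convolve H (gradient ψ)) (c := commutator χ φ j (gradient ψ)) hφX
        (hψ.sub (hH.lipschitzWith_convolve hψ)) (hφ.sub (hH.lipschitzWith_convolve hφ)) hbm hB
        (fun x => hM.commutator_eq_sub hχ (by omega) hφ hψ x) hp
      simpa only [← hκ, ENNReal.coe_mul, hcoe] using this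

end LittlewoodPaley

/-! ### Weighted sequence norms -/

namespace LittlewoodPaley

theorem weightedNorm_mono {s : ℝ} {r : ℝ≥0∞} {a b : ℤ → ℝ≥0∞} (h : ∀ j, a j ≤ b j) :
    weightedNorm s r a ≤ weightedNorm s r b :=
  eLpNorm_mono_enorm fun j => by simpa using mul_le_mul_right (h j) _

theorem weightedNorm_add_le {s : ℝ} {r : ℝ≥0∞} (hr : 1 ≤ r) (a b : ℤ → ℝ≥0∞) :
    weightedNorm s r (fun j => a j + b j) ≤ weightedNorm s r a + weightedNorm s r b := by
  unfold weightedNorm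
  simp only [mul_add]
  exact eLpNorm_add_le (Measurable.of_discrete).aestronglyMeasurable
    (Measurable.of_discrete).aestronglyMeasurable hr

theorem weightedNorm_const_mul {s : ℝ} {r : ℝ≥0∞} (hr : 1 ≤ r) (c : ℝ≥0∞) (a : ℤ → ℝ≥0∞) :
    weightedNorm s r (fun j => c * a j) = c * weightedNorm s r a := by
  unfold weightedNorm
  rw [← eLpNorm_const_mul_ennreal Measurable.of_discrete r hr]
  congr 1
  ext1 j
  ring

theorem ofReal_two_zpow (k : ℤ) : ENNReal.ofReal ((2 : ℝ) ^ k) = (2 : ℝ≥0∞) ^ (k : ℝ) := by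
  rw [← Real.rpow_intCast, ← ENNReal.ofReal_rpow_of_pos two_pos, ENNReal.ofReal_ofNat]

theorem weightedNorm_zpow_mul (s : ℝ) (r : ℝ≥0∞) (a : ℤ → ℝ≥0∞) :
    weightedNorm s r (fun j => ENNReal.ofReal (2 ^ j) * a j) = weightedNorm (s + 1) r a := by
  unfold weightedNorm
  congr 1
  ext1 j
  beta_reduce
  rw [ofReal_two_zpow, ← mul_assoc, ← ENNReal.rpow_add _ _ two_ne_zero ENNReal.ofNat_ne_top]
  ring_nf

theorem weightedNorm_zpow_neg_mul (s : ℝ) (r : ℝ≥0∞) (a : ℤ → ℝ≥0∞) :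
    weightedNorm s r (fun j => ENNReal.ofReal (2 ^ (-j)) * a j) = weightedNorm (s - 1) r a := by
  unfold weightedNorm
  congr 1
  ext1 j
  beta_reduce
  rw [ofReal_two_zpow, ← mul_assoc, ← ENNReal.rpow_add _ _ two_ne_zero ENNReal.ofNat_ne_top]
  push_cast
  ring_nf

/-- For `s > 0` the sums over the frequencies above `2^{j-2}` are bounded on the weighted space:
this is where the positivity of the regularity index enters. -/
theorem exists_weightedNorm_tsum_le {s : ℝ} (hs : 0 < s) {r : ℝ≥0∞} (hr : 1 ≤ r) :
    ∃ c : ℝ, 0 < c ∧ ∀ a : ℤ → ℝ≥0∞,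
      weightedNorm s r (fun j => ∑' i : ℕ, a (j - 2 + i))
        ≤ ENNReal.ofReal c * weightedNorm s r a := by
  have hq : (2 : ℝ) ^ (-s) < 1 := Real.rpow_lt_one_of_one_lt_of_neg one_lt_two (by linarith)
  have hq0 : (0 : ℝ) < 2 ^ (-s) := by positivity
  refine ⟨2 ^ (2 * s) * (1 - 2 ^ (-s))⁻¹, mul_pos (by positivity) (inv_pos.2 (by linarith)),
    fun a => ?_⟩
  have hw : ∀ (j : ℤ) (i : ℕ), (2 : ℝ≥0∞) ^ ((j : ℝ) * s)
      = (2 : ℝ≥0∞) ^ ((2 - (i : ℝ)) * s) * (2 : ℝ≥0∞) ^ (((j - 2 + i : ℤ) : ℝ) * s) := by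
    intro j i
    rw [← ENNReal.rpow_add _ _ two_ne_zero ENNReal.ofNat_ne_top]
    push_cast
    ring_nf
  have h1 : weightedNorm s r (fun j => ∑' i : ℕ, a (j - 2 + i))
      = eLpNorm (fun j : ℤ => ∑' i : ℕ, (2 : ℝ≥0∞) ^ ((2 - (i : ℝ)) * s)
        * ((2 : ℝ≥0∞) ^ (((j - 2 + i : ℤ) : ℝ) * s) * a (j - 2 + i))) r Measure.count := by
    unfold weightedNorm
    congr 1
    ext1 j
    rw [← ENNReal.tsum_mul_left]
    refine tsum_congr fun i => ?_
    rw [hw j i, mul_assoc]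
  rw [h1]
  refine (eLpNorm_tsum_le (fun _ => Measurable.of_discrete) hr).trans ?_
  have h2 : ∀ i : ℕ, eLpNorm (fun j : ℤ => (2 : ℝ≥0∞) ^ ((2 - (i : ℝ)) * s)
        * ((2 : ℝ≥0∞) ^ (((j - 2 + i : ℤ) : ℝ) * s) * a (j - 2 + i))) r Measure.count
      = (2 : ℝ≥0∞) ^ ((2 - (i : ℝ)) * s) * weightedNorm s r a := by
    intro i
    rw [eLpNorm_const_mul_ennreal Measurable.of_discrete r hr]
    congr 1
    have := eLpNorm_comp_measurePreserving (p := r)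
      (g := fun j : ℤ => (2 : ℝ≥0∞) ^ ((j : ℝ) * s) * a j)
      (Measurable.of_discrete).aestronglyMeasurable
      (measurePreserving_add_right (Measure.count : Measure ℤ) (-2 + i))
    rw [weightedNorm, ← this]
    congr 1
    ext1 j
    simp only [Function.comp_apply, sub_eq_add_neg, add_assoc]
  simp only [h2]
  rw [ENNReal.tsum_mul_right]
  gcongr
  have h3 : ∀ i : ℕ, (2 : ℝ≥0∞) ^ ((2 - (i : ℝ)) * s)
      = ENNReal.ofReal (2 ^ (2 * s) * (2 ^ (-s)) ^ i) := by
    intro i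
    have e : (2 : ℝ) ^ (2 * s) * (2 ^ (-s)) ^ i = 2 ^ ((2 - (i : ℝ)) * s) := by
      rw [← Real.rpow_natCast, ← Real.rpow_mul two_pos.le, ← Real.rpow_add two_pos]
      ring_nf
    rw [e, ← ENNReal.ofReal_rpow_of_pos two_pos, ENNReal.ofReal_ofNat]
  simp only [h3]
  rw [← ENNReal.ofReal_tsum_of_nonneg (fun i => by positivity)
    ((summable_geometric_of_lt_one hq0.le hq).mul_left _), tsum_mul_left,
    tsum_geometric_of_lt_one hq0.le hq]

/-- Minkowski's inequality between the time integral and the sequence norm. -/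
theorem weightedNorm_lintegral_le {α : Type*} [MeasurableSpace α] {μ : Measure α} [SFinite μ]
    {s : ℝ} {r : ℝ≥0∞} (hr : 1 ≤ r) {a : ℤ → α → ℝ≥0∞} (ha : ∀ j, AEMeasurable (a j) μ) :
    weightedNorm s r (fun j => ∫⁻ τ, a j τ ∂μ) ≤ ∫⁻ τ, weightedNorm s r (fun j => a j τ) ∂μ := by
  set b : ℤ → α → ℝ≥0∞ := fun j => (ha j).mk (a j) with hb
  have hbm : ∀ j, Measurable (b j) := fun j => (ha j).measurable_mk
  have hab : ∀ᵐ τ ∂μ, ∀ j, a j τ = b j τ := ae_all_iff.2 fun j => (ha j).ae_eq_mk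
  have e1 : ∀ j, ∫⁻ τ, a j τ ∂μ = ∫⁻ τ, b j τ ∂μ := fun j => lintegral_congr_ae (ha j).ae_eq_mk
  have e2 : ∫⁻ τ, weightedNorm s r (fun j => a j τ) ∂μ
      = ∫⁻ τ, weightedNorm s r (fun j => b j τ) ∂μ := by
    refine lintegral_congr_ae ?_
    filter_upwards [hab] with τ hτ
    simp only [hτ]
  rw [e2]
  simp only [e1]
  unfold weightedNorm
  simp only [← lintegral_const_mul _ (hbm _)]
  refine eLpNorm_lintegral_le (f := fun (j : ℤ) τ => (2 : ℝ≥0∞) ^ ((j : ℝ) * s) * b j τ) ?_ hr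
  exact measurable_from_prod_countable_right fun j =>
    show Measurable fun τ => (2 : ℝ≥0∞) ^ ((j : ℝ) * s) * b j τ from (hbm j).const_mul _

/-! ### Interpolation in time -/

/-- Young's inequality behind the interpolation of the weights: it is applied to
`C^{1/θ} x^{1/θ} w₁ ε^{-(1-θ)/θ}` and `ε w₂`, with the exponents `1/θ` and `1/(1-θ)`. -/
theorem mul_rpow_interpolation_le {θ : ℝ} (hθ : θ ∈ Set.Ioc (0 : ℝ) 1) {C x w₁ w₂ ε : ℝ}
    (hC : 0 < C) (hx : 0 ≤ x) (hw₁ : 0 < w₁) (hw₂ : 0 < w₂) (hε : 0 < ε) :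
    C * (x * (w₁ ^ θ * w₂ ^ (1 - θ)))
      ≤ C ^ (1 / θ) * θ / ε ^ ((1 - θ) / θ) * (x ^ (1 / θ) * w₁) + (1 - θ) * ε * w₂ := by
  obtain ⟨h0, h1⟩ := hθ
  have hp : ∀ y : ℝ, 0 ≤ y → (y ^ (1 / θ)) ^ θ = y := fun y hy => by
    rw [← Real.rpow_mul hy, one_div, inv_mul_cancel₀ h0.ne', Real.rpow_one]
  have hε' : (ε ^ ((1 - θ) / θ)) ^ θ = ε ^ (1 - θ) := by
    rw [← Real.rpow_mul hε.le, div_mul_cancel₀ _ h0.ne']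
  have hεp : (0 : ℝ) < ε ^ ((1 - θ) / θ) := by positivity
  have := Real.geom_mean_le_arith_mean2_weighted (w₁ := θ) (w₂ := 1 - θ)
    (p₁ := C ^ (1 / θ) * x ^ (1 / θ) * w₁ / ε ^ ((1 - θ) / θ)) (p₂ := ε * w₂) h0.le (by linarith)
    (by positivity) (by positivity) (by ring)
  rw [Real.div_rpow (by positivity) hεp.le, Real.mul_rpow (by positivity) hw₁.le,
    Real.mul_rpow (by positivity) (by positivity), hp C hC.le, hp x hx, hε',
    Real.mul_rpow hε.le hw₂.le] at this
  have hεθ : (0 : ℝ) < ε ^ (1 - θ) := by positivity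
  have e1 : C * x * w₁ ^ θ / ε ^ (1 - θ) * (ε ^ (1 - θ) * w₂ ^ (1 - θ))
      = C * (x * (w₁ ^ θ * w₂ ^ (1 - θ))) := by
    field_simp
  rw [e1] at this
  refine this.trans (le_of_eq ?_)
  ring

/-- Interpolation in time: for every index `j` the factor `X` is absorbed into the weights by
Young's inequality. In the term of index `s₁` the norm then moves inside the time integral, while the term
of index `s₂` keeps the norm of the integrals. -/
theorem weightedNorm_lintegral_mul_le {α : Type*} [MeasurableSpace α] {μ : Measure α} [SFinite μ]
    {θ : ℝ} (hθ : θ ∈ Set.Ioc (0 : ℝ) 1) {C ε s s₁ s₂ : ℝ} (hC : 0 < C) (hε : 0 < ε)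
    (hs : s = θ * s₁ + (1 - θ) * s₂) {r : ℝ≥0∞} (hr : 1 ≤ r) {X : α → ℝ≥0∞}
    (hXm : AEMeasurable X μ) (hX : ∀ᵐ τ ∂μ, X τ ≠ ⊤) {a : ℤ → α → ℝ≥0∞}
    (ha : ∀ j, AEMeasurable (a j) μ) :
    ENNReal.ofReal C * weightedNorm s r (fun j => ∫⁻ τ, X τ * a j τ ∂μ)
      ≤ ENNReal.ofReal (C ^ (1 / θ) * θ / ε ^ ((1 - θ) / θ))
          * ∫⁻ τ, X τ ^ (1 / θ) * weightedNorm s₁ r (fun j => a j τ) ∂μ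
        + ENNReal.ofReal ((1 - θ) * ε) * weightedNorm s₂ r (fun j => ∫⁻ τ, a j τ ∂μ) := by
  set c₁ := C ^ (1 / θ) * θ / ε ^ ((1 - θ) / θ) with hc₁
  have h0 := hθ.1
  have h1 := hθ.2
  have hc₁0 : 0 ≤ c₁ := by positivity
  have h2pow : ∀ y : ℝ, (2 : ℝ≥0∞) ^ y = ENNReal.ofReal ((2 : ℝ) ^ y) := fun y => by
    rw [← ENNReal.ofReal_rpow_of_pos two_pos, ENNReal.ofReal_ofNat]
  have hpt : ∀ j : ℤ, ∀ᵐ τ ∂μ, ENNReal.ofReal C * ((2 : ℝ≥0∞) ^ ((j : ℝ) * s) * (X τ * a j τ))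
      ≤ (2 : ℝ≥0∞) ^ ((j : ℝ) * s₁) * (ENNReal.ofReal c₁ * (X τ ^ (1 / θ) * a j τ))
        + (2 : ℝ≥0∞) ^ ((j : ℝ) * s₂) * (ENNReal.ofReal ((1 - θ) * ε) * a j τ) := by
    intro j
    filter_upwards [hX] with τ hτ
    obtain ⟨x, hx⟩ : ∃ x : ℝ≥0, (x : ℝ≥0∞) = X τ := ⟨_, ENNReal.coe_toNNReal hτ⟩
    rw [← hx]
    have key := mul_rpow_interpolation_le hθ (x := (x : ℝ)) (w₁ := (2 : ℝ) ^ ((j : ℝ) * s₁))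
      (w₂ := (2 : ℝ) ^ ((j : ℝ) * s₂)) hC x.coe_nonneg (by positivity) (by positivity) hε
    have e : ((2 : ℝ) ^ ((j : ℝ) * s₁)) ^ θ * ((2 : ℝ) ^ ((j : ℝ) * s₂)) ^ (1 - θ)
        = 2 ^ ((j : ℝ) * s) := by
      rw [← Real.rpow_mul two_pos.le, ← Real.rpow_mul two_pos.le, ← Real.rpow_add two_pos, hs]
      ring_nf
    rw [e] at key
    have key' := ENNReal.ofReal_le_ofReal key
    have hxθ : ((x : ℝ≥0∞)) ^ (1 / θ) = ENNReal.ofReal ((x : ℝ) ^ (1 / θ)) := by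
      rw [← ENNReal.ofReal_rpow_of_nonneg x.coe_nonneg (by positivity), ENNReal.ofReal_coe_nnreal]
    rw [h2pow, h2pow, h2pow, hxθ, ← ENNReal.ofReal_coe_nnreal (p := x)]
    have h1θ : 0 ≤ (1 - θ) * ε := mul_nonneg (by linarith) hε.le
    rw [ENNReal.ofReal_add (by positivity) (by positivity), ENNReal.ofReal_mul hC.le,
      ENNReal.ofReal_mul x.coe_nonneg, ENNReal.ofReal_mul hc₁0, ENNReal.ofReal_mul (by positivity),
      ENNReal.ofReal_mul h1θ] at key'
    calc _ = ENNReal.ofReal C * (ENNReal.ofReal x * ENNReal.ofReal (2 ^ ((j : ℝ) * s)))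
            * a j τ := by ring
      _ ≤ _ := mul_le_mul_left key' _
      _ = _ := by ring
  have hb : ∀ j, AEMeasurable (fun τ => ENNReal.ofReal c₁ * (X τ ^ (1 / θ) * a j τ)) μ := fun j =>
    ((hXm.pow_const _).mul (ha j)).const_mul _
  have hterm : ∀ j : ℤ, ENNReal.ofReal C * ((2 : ℝ≥0∞) ^ ((j : ℝ) * s) * ∫⁻ τ, X τ * a j τ ∂μ)
      ≤ (2 : ℝ≥0∞) ^ ((j : ℝ) * s₁) * (∫⁻ τ, ENNReal.ofReal c₁ * (X τ ^ (1 / θ) * a j τ) ∂μ)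
        + (2 : ℝ≥0∞) ^ ((j : ℝ) * s₂) * (ENNReal.ofReal ((1 - θ) * ε) * ∫⁻ τ, a j τ ∂μ) := by
    intro j
    have hm : AEMeasurable (fun τ => X τ * a j τ) μ := hXm.mul (ha j)
    calc ENNReal.ofReal C * ((2 : ℝ≥0∞) ^ ((j : ℝ) * s) * ∫⁻ τ, X τ * a j τ ∂μ)
        = ∫⁻ τ, ENNReal.ofReal C * ((2 : ℝ≥0∞) ^ ((j : ℝ) * s) * (X τ * a j τ)) ∂μ := by
          rw [lintegral_const_mul'' _ (hm.const_mul _), lintegral_const_mul'' _ hm]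
      _ ≤ _ := lintegral_mono_ae (hpt j)
      _ = _ := by
          rw [lintegral_add_right' _ (((ha j).const_mul _).const_mul _),
            lintegral_const_mul'' _ (hb j), lintegral_const_mul'' _ ((ha j).const_mul _),
            lintegral_const_mul'' _ (ha j)]
  have hnorm : ENNReal.ofReal C * weightedNorm s r (fun j => ∫⁻ τ, X τ * a j τ ∂μ)
      ≤ weightedNorm s₁ r (fun j => ∫⁻ τ, ENNReal.ofReal c₁ * (X τ ^ (1 / θ) * a j τ) ∂μ)
        + weightedNorm s₂ r (fun j => ENNReal.ofReal ((1 - θ) * ε) * ∫⁻ τ, a j τ ∂μ) := by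
    unfold weightedNorm
    rw [← eLpNorm_const_mul_ennreal Measurable.of_discrete r hr]
    refine le_trans (eLpNorm_mono_enorm fun j => ?_)
      (eLpNorm_add_le (Measurable.of_discrete).aestronglyMeasurable
        (Measurable.of_discrete).aestronglyMeasurable hr)
    simpa using hterm j
  refine hnorm.trans (add_le_add ?_ (le_of_eq (weightedNorm_const_mul hr _ _)))
  refine (weightedNorm_lintegral_le hr hb).trans (le_of_eq ?_)
  rw [← lintegral_const_mul' _ _ ENNReal.ofReal_ne_top]
  refine lintegral_congr fun τ => ?_
  rw [weightedNorm_const_mul hr, weightedNorm_const_mul hr]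

end LittlewoodPaley

/-! ### Measurability in time -/

namespace LittlewoodPaley

variable {d : ℕ} {α : Type*} [MeasurableSpace α] {μ : Measure α} {F : Type*}
  [NormedAddCommGroup F]

instance sFinite_timeMeasure (T : ℝ≥0∞) : SFinite (timeMeasure T) := by
  unfold timeMeasure
  infer_instance

/-- A family `u τ` of functions on `ℝ^d` which, at almost every time `τ`, agrees almost everywhere
in space with the section of a jointly measurable function. This is weaker than joint almost
everywhere measurability of `u`: no exceptional set in the product has to be measurable. -/
def HasMeasurableSections (μ : Measure α) (u : α → Rd d → F) : Prop :=
  ∃ G : α → Rd d → F, StronglyMeasurable (Function.uncurry G) ∧ ∀ᵐ τ ∂μ, u τ =ᵐ[volume] G τ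

theorem IsLipschitzField.hasMeasurableSections {T : ℝ≥0∞} {f : ℝ → Rd d → ℝ}
    (hf : IsLipschitzField T f) : HasMeasurableSections (timeMeasure T) f :=
  ⟨fun τ x => hf.aestronglyMeasurable.mk _ (τ, x), hf.aestronglyMeasurable.stronglyMeasurable_mk,
    Measure.ae_ae_of_ae_prod hf.aestronglyMeasurable.ae_eq_mk⟩

theorem HasMeasurableSections.aemeasurable_eLpNorm {u : α → Rd d → F}
    (hu : HasMeasurableSections μ u) (p : ℝ≥0∞) :
    AEMeasurable (fun τ => eLpNorm (u τ) p volume) μ := by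
  obtain ⟨G, hG, hGu⟩ := hu
  refine ⟨fun τ => eLpNorm (G τ) p volume, ?_, ?_⟩
  · have := measurable_eLpNorm_section (f := fun τ x => ‖G τ x‖ₑ) hG.enorm p
      (volume : Measure (Rd d))
    simpa only [eLpNorm_enorm] using this
  · filter_upwards [hGu] with τ hτ using eLpNorm_congr_ae hτ

variable [NormedSpace ℝ F]

theorem HasMeasurableSections.dyadicBlock {χ : Rd d → ℝ} (hχ : IsCutoff χ) {u : α → Rd d → F}
    (hu : HasMeasurableSections μ u) (j : ℤ) :
    HasMeasurableSections μ fun τ => dyadicBlock χ j (u τ) := by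
  rcases le_or_gt j (-2) with hj | hj
  · refine ⟨fun _ _ => 0, stronglyMeasurable_const, ae_of_all _ fun τ => ?_⟩
    simp only [dyadicBlock_of_le χ hj]
    rfl
  obtain ⟨G, hG, hGu⟩ := hu
  refine ⟨fun τ => LittlewoodPaley.dyadicBlock χ j (G τ), ?_, ?_⟩
  · have hK := (hχ.isSymbol_dyadicSymbol (show -1 ≤ j by omega)).continuous_kernel
    have h1 : StronglyMeasurable fun q : (α × Rd d) × Rd d =>
        kernel (dyadicSymbol χ j) (q.1.2 - q.2) :=
      (hK.measurable.comp ((measurable_snd.comp measurable_fst).sub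
        measurable_snd)).stronglyMeasurable
    have h2 : StronglyMeasurable fun q : (α × Rd d) × Rd d => G q.1.1 q.2 :=
      hG.comp_measurable ((measurable_fst.comp measurable_fst).prodMk measurable_snd)
    exact (h1.smul h2).integral_prod_right'
  · filter_upwards [hGu] with τ hτ
    simp only [dyadicBlock_eq_convolve, convolve_congr_ae _ hτ]
    rfl

/-- The pointwise gradient of a field of Lipschitz functions inherits measurability in time,
although the jointly measurable representative need not be differentiable in space. -/
theorem HasMeasurableSections.gradient {u : α → Rd d → ℝ} (hu : HasMeasurableSections μ u)
    (hLip : ∀ᵐ τ ∂μ, ∃ K : ℝ≥0, LipschitzWith K (u τ)) :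
    HasMeasurableSections μ fun τ => gradient (u τ) := by
  obtain ⟨G, hG, hGu⟩ := hu
  -- the partial derivatives of a Lipschitz function are almost everywhere the limits of difference
  -- quotients along a fixed sequence of increments, which only sees the values almost everywhere
  set c : ℕ → ℝ := fun n => (n : ℝ) + 1
  set e := EuclideanSpace.basisFun (Fin d) ℝ
  set D : Fin d → α → Rd d → ℝ := fun i τ x =>
    limsup (fun n => c n • (G τ (x + (c n)⁻¹ • e i) - G τ x)) atTop
  have hD : ∀ i, Measurable (Function.uncurry (D i)) := by
    intro i
    refine Measurable.limsup fun n => ?_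
    have h1 : Measurable fun q : α × Rd d => G q.1 (q.2 + (c n)⁻¹ • e i) :=
      hG.measurable.comp (measurable_fst.prodMk (measurable_snd.add_const _))
    exact show Measurable fun q : α × Rd d =>
        c n • (G q.1 (q.2 + (c n)⁻¹ • e i) - G q.1 q.2) from
      (h1.sub hG.measurable).const_smul (c n)
  refine ⟨fun τ x => ∑ i, D i τ x • e i, ?_, ?_⟩
  · refine Measurable.stronglyMeasurable ?_
    exact Finset.measurable_fun_sum _ fun i _ => (hD i).smul_const (e i)
  · filter_upwards [hGu, hLip] with τ hτ hL
    obtain ⟨L, hL⟩ := hL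
    have hshift : ∀ᵐ x, ∀ n i, u τ (x + (c n)⁻¹ • e i) = G τ (x + (c n)⁻¹ • e i) :=
      ae_all_iff.2 fun n => ae_all_iff.2 fun i =>
        (measurePreserving_add_right volume ((c n)⁻¹ • e i)).quasiMeasurePreserving.ae hτ
    filter_upwards [hτ, hshift, hL.ae_differentiableAt] with x hx hxs hdiff
    have hlim : ∀ i, D i τ x = inner ℝ (e i) (_root_.gradient (u τ) x) := by
      intro i
      have hc : Tendsto (fun n => ‖c n‖) atTop atTop :=
        tendsto_norm_atTop_atTop.comp
          (tendsto_atTop_add_const_right _ _ tendsto_natCast_atTop_atTop)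
      have := hdiff.hasFDerivAt.lim (e i) hc
      simp only [hxs, hx] at this
      rw [real_inner_comm, _root_.gradient, InnerProductSpace.toDual_symm_apply]
      exact this.limsup_eq
    simp only [hlim]
    exact (e.sum_repr' _).symm

end LittlewoodPaley

/-! ### The commutator estimates -/

namespace LittlewoodPaley

variable {d : ℕ} {χ : Rd d → ℝ}

theorem weightedNorm_blockBound_le {s : ℝ} {p r : ℝ≥0∞} (hr : 1 ≤ r) (φ ψ : Rd d → ℝ) :
    weightedNorm s r (blockBound χ p φ ψ)
      ≤ eLpNorm (gradient φ) ∞ volume * besovNorm χ s p r ψ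
        + besovNorm χ (s - 1) p r (gradient φ) * eLpNorm (gradient ψ) ∞ volume := by
  refine (weightedNorm_add_le hr _ _).trans (add_le_add ?_ ?_)
  · exact (weightedNorm_const_mul hr _ _).le
  · rw [weightedNorm_zpow_neg_mul]
    simp only [mul_comm _ (eLpNorm (gradient ψ) ∞ volume)]
    exact (weightedNorm_const_mul hr _ _).le

/-- No measurability in time is needed here: the inequality is pointwise in time. -/
theorem exists_lintegral_weightedNorm_commutator_le (hχ : IsCutoff χ) {s : ℝ} (hs : 0 < s)
    {p r : ℝ≥0∞} (hp : 1 ≤ p) (hr : 1 ≤ r) :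
    ∃ C : ℝ, 0 < C ∧ ∀ (t : ℝ≥0∞) (φ ψ : ℝ → Rd d → ℝ),
      IsLipschitzField t φ → IsLipschitzField t ψ →
      ∫⁻ τ, weightedNorm s r (fun j =>
          eLpNorm (commutator χ (φ τ) j (gradient (ψ τ))) p volume) ∂(timeMeasure t)
        ≤ ENNReal.ofReal C *
          ∫⁻ τ, (eLpNorm (gradient (φ τ)) ∞ volume * besovNorm χ s p r (ψ τ)
            + besovNorm χ (s - 1) p r (gradient (φ τ)) * eLpNorm (gradient (ψ τ)) ∞ volume)
            ∂(timeMeasure t) := by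
  obtain ⟨C₀, hC₀, hcomm⟩ := exists_eLpNorm_commutator_le hχ hp
  obtain ⟨c, hc, hsum⟩ := exists_weightedNorm_tsum_le hs hr
  refine ⟨C₀ * c, by positivity, fun t φ ψ hφ hψ => ?_⟩
  rw [← lintegral_const_mul' _ _ ENNReal.ofReal_ne_top]
  refine lintegral_mono_ae ?_
  filter_upwards [hφ.lipschitz, hψ.lipschitz] with τ ⟨L, hL⟩ ⟨L', hL'⟩
  refine (weightedNorm_mono fun j => (hcomm _ _ L L' hL hL' j).1).trans ?_
  rw [weightedNorm_const_mul hr, ENNReal.ofReal_mul hC₀.le, mul_assoc]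
  gcongr
  refine (hsum _).trans ?_
  gcongr
  exact weightedNorm_blockBound_le hr _ _

/-- The estimate in Chemin-Lerner spaces before interpolation in time. The gradient of the commutator
costs a factor `2^j`, so the sum over frequencies is taken in the space of index `s + 1`; in the
second term the factor `2^{-k}` brings the index back to `s`. -/
theorem exists_weightedNorm_lintegral_fderiv_commutator_le (hχ : IsCutoff χ) {s : ℝ} (hs : 0 < s)
    {p r : ℝ≥0∞} (hp : 1 ≤ p) (hr : 1 ≤ r) :
    ∃ C : ℝ, 0 < C ∧ ∀ (t : ℝ≥0∞) (φ ψ : ℝ → Rd d → ℝ),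
      IsLipschitzField t φ → IsLipschitzField t ψ →
      weightedNorm s r (fun j =>
          ∫⁻ τ, eLpNorm (fderiv ℝ (commutator χ (φ τ) j (gradient (ψ τ)))) p volume
            ∂(timeMeasure t))
        ≤ ENNReal.ofReal C * weightedNorm (s + 1) r (fun k =>
              ∫⁻ τ, eLpNorm (gradient (φ τ)) ∞ volume * eLpNorm (dyadicBlock χ k (ψ τ)) p volume
                ∂(timeMeasure t))
          + ENNReal.ofReal C * weightedNorm s r (fun k =>
              ∫⁻ τ, eLpNorm (gradient (ψ τ)) ∞ volume
                * eLpNorm (dyadicBlock χ k (gradient (φ τ))) p volume ∂(timeMeasure t)) := by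
  obtain ⟨C₀, hC₀, hcomm⟩ := exists_eLpNorm_commutator_le hχ hp
  obtain ⟨c, hc, hsum⟩ := exists_weightedNorm_tsum_le (show 0 < s + 1 by linarith) hr
  refine ⟨C₀ * c, by positivity, fun t φ ψ hφ hψ => ?_⟩
  have hφm := hφ.hasMeasurableSections
  have hψm := hψ.hasMeasurableSections
  have hGφ := hφm.gradient hφ.lipschitz
  have hGψ := hψm.gradient hψ.lipschitz
  have hA : ∀ k, AEMeasurable (fun τ => eLpNorm (gradient (φ τ)) ∞ volume
      * eLpNorm (dyadicBlock χ k (ψ τ)) p volume) (timeMeasure t) := fun k =>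
    (hGφ.aemeasurable_eLpNorm ∞).mul ((hψm.dyadicBlock hχ k).aemeasurable_eLpNorm p)
  have hB : ∀ k, AEMeasurable (fun τ => eLpNorm (gradient (ψ τ)) ∞ volume
      * eLpNorm (dyadicBlock χ k (gradient (φ τ))) p volume) (timeMeasure t) := fun k =>
    (hGψ.aemeasurable_eLpNorm ∞).mul ((hGφ.dyadicBlock hχ k).aemeasurable_eLpNorm p)
  set A : ℤ → ℝ≥0∞ := fun k => ∫⁻ τ, eLpNorm (gradient (φ τ)) ∞ volume
    * eLpNorm (dyadicBlock χ k (ψ τ)) p volume ∂(timeMeasure t)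
  set B : ℤ → ℝ≥0∞ := fun k => ∫⁻ τ, eLpNorm (gradient (ψ τ)) ∞ volume
    * eLpNorm (dyadicBlock χ k (gradient (φ τ))) p volume ∂(timeMeasure t)
  have hblock : ∀ k τ, blockBound χ p (φ τ) (ψ τ) k
      = eLpNorm (gradient (φ τ)) ∞ volume * eLpNorm (dyadicBlock χ k (ψ τ)) p volume
        + ENNReal.ofReal (2 ^ (-k)) * (eLpNorm (gradient (ψ τ)) ∞ volume
          * eLpNorm (dyadicBlock χ k (gradient (φ τ))) p volume) := fun k τ => by
    rw [blockBound, mul_comm (eLpNorm (gradient (ψ τ)) ∞ volume)]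
  have hblockm : ∀ k, AEMeasurable (fun τ => blockBound χ p (φ τ) (ψ τ) k) (timeMeasure t) :=
    fun k => by
      simp only [hblock]
      exact (hA k).add ((hB k).const_mul _)
  have hint : ∀ k, ∫⁻ τ, blockBound χ p (φ τ) (ψ τ) k ∂(timeMeasure t)
      = A k + ENNReal.ofReal (2 ^ (-k)) * B k := fun k => by
    simp only [hblock]
    rw [lintegral_add_left' (hA k), lintegral_const_mul'' _ (hB k)]
  have hterm : ∀ j : ℤ,
      ∫⁻ τ, eLpNorm (fderiv ℝ (commutator χ (φ τ) j (gradient (ψ τ)))) p volume ∂(timeMeasure t)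
        ≤ ENNReal.ofReal C₀ * (ENNReal.ofReal (2 ^ j)
          * ∑' i : ℕ, (A (j - 2 + i) + ENNReal.ofReal (2 ^ (-(j - 2 + i))) * B (j - 2 + i))) := by
    intro j
    simp only [← hint]
    rw [← lintegral_tsum fun i : ℕ => hblockm (j - 2 + i),
      ← lintegral_const_mul' _ _ ENNReal.ofReal_ne_top,
      ← lintegral_const_mul' _ _ ENNReal.ofReal_ne_top]
    refine lintegral_mono_ae ?_
    filter_upwards [hφ.lipschitz, hψ.lipschitz] with τ ⟨L, hL⟩ ⟨L', hL'⟩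
    exact (hcomm _ _ L L' hL hL' j).2
  refine (weightedNorm_mono hterm).trans ?_
  rw [weightedNorm_const_mul hr, weightedNorm_zpow_mul, ← mul_add, ENNReal.ofReal_mul hC₀.le,
    mul_assoc]
  gcongr
  refine (hsum fun k => A k + ENNReal.ofReal (2 ^ (-k)) * B k).trans ?_
  gcongr
  refine (weightedNorm_add_le hr _ _).trans ?_
  rw [weightedNorm_zpow_neg_mul, add_sub_cancel_right]

theorem cheminLernerNorm_one {F : Type*} [NormedAddCommGroup F] [NormedSpace ℝ F] (T : ℝ≥0∞)
    (s : ℝ) (p r : ℝ≥0∞) (u : ℝ → Rd d → F) :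
    cheminLernerNorm χ 1 T s p r u
      = weightedNorm s r fun j =>
        ∫⁻ τ, eLpNorm (dyadicBlock χ j (u τ)) p volume ∂(timeMeasure T) := by
  simp only [cheminLernerNorm, eLpNorm_one_eq_lintegral_enorm, enorm_eq_self]

end LittlewoodPaley

theorem lemma4p1 (d : ℕ) (χ : LittlewoodPaley.Rd d → ℝ) (hχ : LittlewoodPaley.IsCutoff χ)
    (s : ℝ) (hs : 0 < s) (p r : ℝ≥0∞) (hp : 1 ≤ p) (hr : 1 ≤ r) :
    -- the classical estimate
    (∃ C : ℝ, 0 < C ∧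
      ∀ (t : ℝ≥0∞) (φ ψ : ℝ → LittlewoodPaley.Rd d → ℝ),
        LittlewoodPaley.IsLipschitzField t φ → LittlewoodPaley.IsLipschitzField t ψ →
        ∫⁻ τ, LittlewoodPaley.weightedNorm s r (fun j =>
            eLpNorm (LittlewoodPaley.commutator χ (φ τ) j (gradient (ψ τ))) p volume)
            ∂(LittlewoodPaley.timeMeasure t)
          ≤ ENNReal.ofReal C *
            ∫⁻ τ, (eLpNorm (gradient (φ τ)) ∞ volume * LittlewoodPaley.besovNorm χ s p r (ψ τ)
              + LittlewoodPaley.besovNorm χ (s - 1) p r (gradient (φ τ))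
                * eLpNorm (gradient (ψ τ)) ∞ volume)
              ∂(LittlewoodPaley.timeMeasure t)) ∧
    -- the estimate in Chemin-Lerner spaces
    (∀ θ η : ℝ, θ ∈ Set.Ioc (0 : ℝ) 1 → η ∈ Set.Ioc (0 : ℝ) 1 →
      ∃ C : ℝ, 0 < C ∧
        ∀ s₁ s₂ σ₁ σ₂ : ℝ,
          s + 1 = θ * s₁ + (1 - θ) * s₂ → s + 1 = η * σ₁ + (1 - η) * σ₂ →
        ∀ ε : ℝ, 0 < ε →
        ∀ (t : ℝ≥0∞) (φ ψ : ℝ → LittlewoodPaley.Rd d → ℝ),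
          LittlewoodPaley.IsLipschitzField t φ → LittlewoodPaley.IsLipschitzField t ψ →
          LittlewoodPaley.weightedNorm s r (fun j =>
              ∫⁻ τ, eLpNorm
                (fderiv ℝ (LittlewoodPaley.commutator χ (φ τ) j (gradient (ψ τ)))) p volume
                ∂(LittlewoodPaley.timeMeasure t))
            ≤ ENNReal.ofReal (C * θ / ε ^ ((1 - θ) / θ)) *
                ∫⁻ τ, eLpNorm (gradient (φ τ)) ∞ volume ^ (1 / θ)
                  * LittlewoodPaley.besovNorm χ s₁ p r (ψ τ) ∂(LittlewoodPaley.timeMeasure t)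
              + ENNReal.ofReal (C * η / ε ^ ((1 - η) / η)) *
                ∫⁻ τ, eLpNorm (gradient (ψ τ)) ∞ volume ^ (1 / η)
                  * LittlewoodPaley.besovNorm χ (σ₁ - 1) p r (gradient (φ τ))
                  ∂(LittlewoodPaley.timeMeasure t)
              + ENNReal.ofReal ((1 - θ) * ε) *
                LittlewoodPaley.cheminLernerNorm χ 1 t s₂ p r ψ
              + ENNReal.ofReal ((1 - η) * ε) *
                LittlewoodPaley.cheminLernerNorm χ 1 t (σ₂ - 1) p r
                  (fun τ => gradient (φ τ))) := by
  refine ⟨LittlewoodPaley.exists_lintegral_weightedNorm_commutator_le hχ hs hp hr,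
    fun θ η hθ hη => ?_⟩
  obtain ⟨C, hC, hcomm⟩ :=
    LittlewoodPaley.exists_weightedNorm_lintegral_fderiv_commutator_le hχ hs hp hr
  have hθ0 : 0 < θ := hθ.1
  have hη0 : 0 < η := hη.1
  -- Young's inequality raises the constant to the powers `1/θ` and `1/η`
  refine ⟨max (C ^ (1 / θ)) (C ^ (1 / η)), lt_max_of_lt_left (by positivity),
    fun s₁ s₂ σ₁ σ₂ hs₁ hσ₁ ε hε t φ ψ hφ hψ => (hcomm t φ ψ hφ hψ).trans ?_⟩
  have hφm := hφ.hasMeasurableSections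
  have hψm := hψ.hasMeasurableSections
  have hGφ := hφm.gradient hφ.lipschitz
  have hGψ := hψm.gradient hψ.lipschitz
  have h1 := LittlewoodPaley.weightedNorm_lintegral_mul_le hθ hC hε hs₁ hr
    (hGφ.aemeasurable_eLpNorm ∞)
    (hφ.lipschitz.mono fun τ ⟨L, hL⟩ => LittlewoodPaley.eLpNorm_gradient_top_ne_top hL)
    fun k => (hψm.dyadicBlock hχ k).aemeasurable_eLpNorm p
  have h2 := LittlewoodPaley.weightedNorm_lintegral_mul_le hη hC hε
    (show s = η * (σ₁ - 1) + (1 - η) * (σ₂ - 1) by linarith) hr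
    (hGψ.aemeasurable_eLpNorm ∞)
    (hψ.lipschitz.mono fun τ ⟨L, hL⟩ => LittlewoodPaley.eLpNorm_gradient_top_ne_top hL)
    fun k => (hGφ.dyadicBlock hχ k).aemeasurable_eLpNorm p
  rw [LittlewoodPaley.cheminLernerNorm_one, LittlewoodPaley.cheminLernerNorm_one]
  refine (add_le_add h1 h2).trans ?_
  rw [add_add_add_comm, add_assoc (_ + _)]
  gcongr
  · exact le_max_left _ _
  · exact le_rfl
  · exact le_max_right _ _
  · exact le_rfl
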